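/- **Proposition (Encoding Completeness).** If $C$ is a configuration, $P_0$ is an encoding $[\![C]\!]$ of $C$ and $P_0\stackrel{\tau}{\Longrightarrow}P$, then there is a component $C'$ with $C\stackrel{\tau}{\Longrightarrow}C'$ and there are processes $P'$ and $Q$ such that $P\stackrel{\tau}{\Longrightarrow}P'$, $P'\equiv Q$ and $Q$ is an encoding $[\![C']\!]$ of $C'$. Here $\stackrel{\tau}{\Longrightarrow}$ is zero or more $\tau$ transitions, and the notions are as follows. *Source language.* There are countably many ports, roles $p,q,r,s$ and message labels $\ell$. Values $v$ are two distinct constants $\mathtt{inl},\mathtt{inr}$ and elements of an arbitrary set. Stores $\sigma$ are partial maps from ports to values. A local binder $y\{\tilde\sigma\}=f(\tilde x)$ has an output port $y$, a queue $\tilde\sigma$ of stores and a partial function $f$ of the parameters $\tilde x$. Protocols are $$G::= p\xrightarrow{\ell}\tilde q;G \mid p\xrightarrow{\ell}\tilde q(G_1,G_2)\mid \mu X.G\mid X\mid \mathbf{end}\mid \xrightarrow{\ell,v}\tilde q;G\mid \xrightarrow{\ell,v}\tilde q(G_1,G_2),$$ up to renaming of bound recursion variables, with $\tilde q$ a finite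 set of roles; the last two are runtime terms (value $v$ sent, not yet received by $\tilde q$). Components are base, $[\tilde x\rangle\tilde y]\{L\}$ with $L$ a list of local binders, or composite, $[\tilde x\rangle\tilde y]\{G;R;D;r[F]\}$, where $R$ is a list of role assignments $p=C$, $D$ a list of connection binders $\ell: q.w\leftarrow p.z$ (input port $w$ of receiver $q$, output port $z$ of sender $p$), and $F$ a list of input forwarders $w\leftarrow x$ and output forwarders $y\leftarrow z$ between the external ports $x\in\tilde x$, $y\in\tilde y$ and internal ports $w,z$ of the component of role $r$. *Source transitions.* Binders: with no parameters, $y\{\cdot\}=f()$ outputs $y!v$ unchanged if $f()=v$; otherwise, if the domain of the first store $\sigma$ of the queue is exactly $\tilde x$ and $f(\sigma(\tilde x))=v$, it outputs $y!v$ and drops that store. An input $x?v$ with $x\in\tilde x$ is written in the first store without a value for $x$, or in a new last store if there is none; with $x\notin\tilde x$ it is discarded. In a list $L$ one binder outputs; all binders react to an input. A base component does the outputs of $L$ on $\tilde y$ and the inputs on $\tilde x$. Protocols, with actions $p!\ell\langle v\rangle$ and $q?\ell\langle v\rangle$: $p\xrightarrow{\ell}\tilde q$ does $p!\ell\langle v\rangle$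 (for choices only with $v\in\{\mathtt{inl},\mathtt{inr}\}$) and becomes the runtime term with $\ell,v$; a runtime term does $q?\ell\langle v\rangle$ for $q\in\tilde q$ and loses $q$, and if $q$ was the last receiver it becomes its continuation (for choices $G_1$ if $v=\mathtt{inl}$, $G_2$ if $v=\mathtt{inr}$); $\mu X.G$ acts as its unfolding. An action of a role not among those of the prefix ($p,\tilde q$, or $\tilde q$ for runtime terms) may be taken in the continuation under the prefix: in both branches, with the same action, for $p\xrightarrow{\ell}\tilde q(G_1,G_2)$; in the branch selected by $v$ for a runtime choice. A composite component does $\tau$ if (i) $C\xrightarrow{z!v}C'$ for $p=C$ in $R$, $\ell:q.w\leftarrow p.z$ is in $D$ and $G\xrightarrow{p!\ell\langle v\rangle}G'$; or (ii) $C\xrightarrow{w?v}C'$ for $q=C$ in $R$, $\ell:q.w\leftarrow p.z$ is in $D$ and $G\xrightarrow{q?\ell\langle v\rangle}G'$; or (iii) a component in $R$ does $\tau$. It does $y!v$ if the component of $r$ does $z!v$ and $y\leftarrow z$ is in $F$, $y\in\tilde y$; and $x?v$ if the component of $r$ does $w?v$ and $w\leftarrow x$ is in $F$, $x\in\tilde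 x$. *Configurations.* A *program* has empty queues in all local binders and no runtime terms. A component *accepts* $x$ if $x\in\tilde x$ and, when it is composite, some $w\leftarrow x$ is in $F$ and the component of $r$ accepts $w$. A component is *well-formed* if the ports in its interface $\tilde x,\tilde y$ are distinct; the local binders of a base component have distinct output ports; and in a composite component: all $C$ in $R$ are well-formed and are assigned to distinct roles; the external ports of $F$ are distinct, the internal ones are distinct, and input (output) forwarders link input (output) ports of the interfaces of the composite component and of the component of $r$; the receiver ports $(q,w)$ in $D$ are distinct, equal sender ports $(p,z)$ come with equal labels, and for each $\ell:q.w\leftarrow p.z$ in $D$ the component of $q$ accepts $w$ and $z$ is an output port of the component of $p$; $G$ has no free recursion variable; distinct communication steps of $G$ have distinct labels; each step $p\xrightarrow{\ell}\tilde q$ in $G$ has $\tilde q\neq\emptyset$ and $p\notin\tilde q$, and the binders labelled $\ell$ in $D$ are exactly $\ell:q.w_q\leftarrow p.z$, $q\in\tilde q$, for one $z$ and one $w_q$ for each $q$; and if $\mu X.G'$ inside a loop $\mu Y.G''$ contains $Y$ free, then $\mathit{roles}(G'')\subseteq \mathit{roles}(G')$. A *configuration* is any component reached, by zero or more transitions with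 any labels, from a well-formed program that has an encoding. *Processes.* $$P::=\mathbf 0\mid P|P\mid(\nu z)P\mid\mu X.P\mid X\mid z!o.P\mid z?a.P\mid z\&(P,P)\mid\lfloor L\rfloor_S\mid(z\triangleright w)P\mid(z\triangleleft w)P,$$ with $o$ a variable or a value and $S$ a set of ports delimiting $L$, the forwarder $\triangleright$ for inputs, $\triangleleft$ for outputs. Labels are $\tau$, the actions $\lambda$ ($z!v$ or $z?v$) of local binders and the actions $\overline\lambda$ of communication primitives. $\lfloor L\rfloor_S$ does the transitions of $L$ on ports in $S$; $z!v.P\xrightarrow{\overline{z!v}}P$; $z?a.P\xrightarrow{\overline{z?v}}P\{v/a\}$; $z\&(P,Q)$ goes to $P$ by $\overline{z?\mathtt{inl}}$ and to $Q$ by $\overline{z?\mathtt{inr}}$; parallel components act alone or synchronise to $\tau$, one doing $\lambda$ and the other the bar of the complementary action ($z!v$ and $z?v$ are complementary); $\mu X.P$ acts as its unfolding; $(\nu z)$ passes $\tau$ and labels not on $z$; a forwarder on $z,w$ passes $\tau$ and labels not on $z,w$, and turns inputs ($\triangleright$) or outputs ($\triangleleft$) on $w$, barred or not, into the same on $z$.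 Structural congruence $\equiv$ is the least congruence with the commutative monoid laws of $|,\mathbf 0$; $(\nu z)\mathbf 0\equiv\mathbf 0$, exchange of restrictions, $(\nu z)(P|Q)\equiv P|(\nu z)Q$ if $z$ is not free in $P$; renaming of bound names; $\mu X.P\equiv P\{\mu X.P/X\}$; permutation of $L$ in $\lfloor L\rfloor_S$; and swapping of adjacent forwarders whose four ports are distinct. *Encoding.* $\gamma$ is an injective map from pairs (role, port) and (role, label) to ports. The encoding $[\![G]\!]_{s,D,\gamma}$ of $G$ for role $s$ is a partial function. Write $u=\gamma(s,\ell)$. If $s$ is the sender of the prefix and $\ell:q.w\leftarrow s.z\in D$, $z'=\gamma(s,z)$: $z'?a.u!a.[\![G]\!]$ for a communication, $z'\&(u!\mathtt{inl}.[\![G_1]\!],u!\mathtt{inr}.[\![G_2]\!])$ for a choice. If $s\in\tilde q$ (runtime term or not) and $\ell:s.w\leftarrow p.z\in D$ (with $p$ the sender, if it is present), $w'=\gamma(s,w)$: $u?a.w'!a.[\![G]\!]$, respectively $u\&(w'!\mathtt{inl}.[\![G_1]\!],w'!\mathtt{inr}.[\![G_2]\!])$. If $s$ is not in the prefix: $[\![G]\!]$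 of the continuation, for a choice the common encoding of $G_1$ and $G_2$ (undefined if they differ), for a runtime choice the encoding of the branch selected by $v$. $[\![\mu X.G]\!]=\mu X.[\![G]\!]$ if $s\in\mathit{roles}(G)$ and $\mathbf 0$ otherwise; $[\![X]\!]=X$; $[\![\mathbf{end}]\!]=\mathbf 0$. The monitor queues of $D$ are the binders $\gamma(q,\ell)\{\cdot\}=\mathrm{id}(\gamma(p,\ell))$ for $\ell:q.w\leftarrow p.z$ in $D$, filled with the values in transit in $G$: going through $G$ from the outside, each runtime prefix $\xrightarrow{\ell,v}\tilde q$ appends the store $\{u'\mapsto v\}$, $u'$ the parameter, to the queues that define $\gamma(q,\ell)$, $q\in\tilde q$; one continues with the selected branch of a runtime choice, and for other choices both branches have to give the same result. A base component $[\tilde x\rangle\tilde y]\{L\}$ is encoded as $(\nu\tilde z)(x_i\triangleright\gamma(r,x_i))_i(y_j\triangleleft\gamma(r,y_j))_j\lfloor\gamma(r,L)\rfloor_{\tilde z}$ for any role $r$, where $\gamma(r,L)$ is $L$ with its ports renamed and $\tilde z$ enumerates the $\gamma(r,u)$ with $u$ in $\tilde x,\tilde y$ or $L$. A composite component is encoded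 as $(\nu\tilde z)$ of forwarders $x\triangleright\gamma(r,w)$ for $w\leftarrow x$ in $F$ and $y\triangleleft\gamma(r,z)$ for $y\leftarrow z$ in $F$, applied to the parallel composition of the encodings $[\![p=C]\!]_\gamma$ of the role assignments, of $[\![G]\!]_{s,D,\gamma}$ for each $s\in\mathit{roles}(G)$, and of $\lfloor\cdot\rfloor_S$ with the filled monitor queues, $S$ the set of all $\gamma(q,\ell),\gamma(p,\ell)$ for $\ell:q.w\leftarrow p.z$ in $D$; $\tilde z$ enumerates the image under $\gamma$ of its domain, the pairs $(q,w),(p,z),(q,\ell),(p,\ell)$ for $\ell:q.w\leftarrow p.z$ in $D$ and the pairs of $r$ with the internal ports of $F$. In both cases $\tilde z$ is disjoint from $\tilde x,\tilde y$. $[\![p=C]\!]_\gamma$ is $(\nu\tilde x,\tilde y)(\gamma(p,x_i)\triangleright x_i)_i(\gamma(p,y_j)\triangleleft y_j)_j[\![C]\!]$, with $\tilde x,\tilde y$ the interface of $C$; the pairs of $p$ with these ports must be in the domain, and the image of the domain must be disjoint from $\tilde x,\tilde y$. The encoding is defined when all of this is, and is unique up to the choice of $\gamma$ and the order of independent parts.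 -/

import Mathlib

namespace GC

universe u

/-! ## Identifiers and values -/

/-- Ports: an inexhaustible supply of names. -/
abbrev Port := ℕ

/-- Roles of protocols. -/
abbrev Role := ℕ

/-- Labels of communications. -/
abbrev MLabel := ℕ

/-- Values: the two selection constants, and basic values from an arbitrary type. -/
inductive Val (B : Type*) where
  | inl : Val B
  | inr : Val B
  | base : B → Val B

/-- Actions `y!v` (`out y v`) and `x?v` (`inp x v`). -/
inductive Act (B : Type*) where
  | out : Port → Val B → Act B
  | inp : Port → Val B → Act B

/-- The port of an action. -/
def Act.port {B : Type*} : Act B → Port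
  | .out y _ => y
  | .inp x _ => x

/-- The complementary action: `z!v` and `z?v` are complementary. -/
def Act.dual {B : Type*} : Act B → Act B
  | .out y v => .inp y v
  | .inp x v => .out x v

/-! ## Local binders -/

/-- A store: a partial map from ports to values. -/
abbrev Store (B : Type*) := Port → Option (Val B)

/-- The store `{x ↦ v}`. -/
def Store.single {B : Type*} (x : Port) (v : Val B) : Store B :=
  fun u => if u = x then some v else none

/-- A local binder with output port `lhs`, queue of stores `queue`, and expression `f(params)`;
`f vs = some v` means that `f` applied to `vs` evaluates to `v`. -/
structure LBinder (B : Type*) where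
  lhs : Port
  queue : List (Store B)
  f : List (Val B) → Option (Val B)
  params : List Port

/-- Transitions of a single local binder. -/
inductive LBinder.Step {B : Type*} : LBinder B → Act B → LBinder B → Prop
  | const {y f v} (h : f [] = some v) :
      LBinder.Step ⟨y, [], f, []⟩ (.out y v) ⟨y, [], f, []⟩
  | out {y σ σs f xs vs v} (hne : xs ≠ [])
      (hdom : ∀ x, x ∈ xs ↔ σ x ≠ none)
      (hvs : List.Forall₂ (fun x w => σ x = some w) xs vs) (h : f vs = some v) :
      LBinder.Step ⟨y, σ :: σs, f, xs⟩ (.out y v) ⟨y, σs, f, xs⟩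
  | inpNew {y σs f xs x v} (hx : x ∈ xs) (hall : ∀ σ ∈ σs, σ x ≠ none) :
      LBinder.Step ⟨y, σs, f, xs⟩ (.inp x v) ⟨y, σs ++ [Store.single x v], f, xs⟩
  | inpUpd {y σs₁ σ σs₂ f xs x v} (hx : x ∈ xs) (hall : ∀ τ ∈ σs₁, τ x ≠ none)
      (hσ : σ x = none) :
      LBinder.Step ⟨y, σs₁ ++ σ :: σs₂, f, xs⟩ (.inp x v)
        ⟨y, σs₁ ++ Function.update σ x (some v) :: σs₂, f, xs⟩
  | inpDisc {y σs f xs x v} (hx : x ∉ xs) :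
      LBinder.Step ⟨y, σs, f, xs⟩ (.inp x v) ⟨y, σs, f, xs⟩

/-- Transitions of a collection of local binders: one binder performs an output, and all of them
react to an input. -/
inductive LStep {B : Type*} : List (LBinder B) → Act B → List (LBinder B) → Prop
  | out {L₁ b b' L₂ y v} (h : b.Step (.out y v) b') :
      LStep (L₁ ++ b :: L₂) (.out y v) (L₁ ++ b' :: L₂)
  | inp {L L' x v} (h : List.Forall₂ (fun b b' => LBinder.Step b (.inp x v) b') L L') :
      LStep L (.inp x v) L'

/-- Apply an injective renaming of ports to a local binder. -/
noncomputable def LBinder.rename {B : Type*} (g : Port → Port) (b : LBinder B) : LBinder B where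
  lhs := g b.lhs
  queue := b.queue.map fun σ => Function.extend g σ fun _ => none
  f := b.f
  params := b.params.map g

/-- The ports written in a local binder. -/
def LBinder.fp {B : Type*} (b : LBinder B) : Set Port :=
  {u | u = b.lhs ∨ u ∈ b.params ∨ ∃ σ ∈ b.queue, σ u ≠ none}

/-! ## Protocols -/

/-- Protocols, with de Bruijn indices for recursion variables. `comR` and `choiceR` are the runtime
terms: the value has been sent and the listed receivers have not received it yet. -/
inductive Proto (B : Type*) where
  | com : Role → MLabel → Finset Role → Proto B → Proto B
  | choice : Role → MLabel → Finset Role → Proto B → Proto B → Proto B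
  | mu : Proto B → Proto B
  | rvar : ℕ → Proto B
  | fin : Proto B
  | comR : MLabel → Val B → Finset Role → Proto B → Proto B
  | choiceR : MLabel → Val B → Finset Role → Proto B → Proto B → Proto B

namespace Proto

/-- Increment the recursion variables with index at least `c`. -/
def lift {B : Type*} : ℕ → Proto B → Proto B
  | c, com p l qs G => com p l qs (lift c G)
  | c, choice p l qs G₁ G₂ => choice p l qs (lift c G₁) (lift c G₂)
  | c, mu G => mu (lift (c + 1) G)
  | c, rvar i => rvar (if c ≤ i then i + 1 else i)
  | _, fin => fin
  | c, comR l v qs G => comR l v qs (lift c G)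
  | c, choiceR l v qs G₁ G₂ => choiceR l v qs (lift c G₁) (lift c G₂)

/-- Capture-avoiding substitution of a protocol for the recursion variable with index `k`. -/
def subst {B : Type*} : Proto B → ℕ → Proto B → Proto B
  | H, k, com p l qs G => com p l qs (subst H k G)
  | H, k, choice p l qs G₁ G₂ => choice p l qs (subst H k G₁) (subst H k G₂)
  | H, k, mu G => mu (subst (lift 0 H) (k + 1) G)
  | H, k, rvar i => if i < k then rvar i else if i = k then H else rvar (i - 1)
  | _, _, fin => fin
  | H, k, comR l v qs G => comR l v qs (subst H k G)
  | H, k, choiceR l v qs G₁ G₂ => choiceR l v qs (subst H k G₁) (subst H k G₂)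

/-- The roles of a protocol. -/
def roles {B : Type*} : Proto B → Finset Role
  | com p _ qs G => insert p (qs ∪ roles G)
  | choice p _ qs G₁ G₂ => insert p (qs ∪ roles G₁ ∪ roles G₂)
  | mu G => roles G
  | rvar _ => ∅
  | fin => ∅
  | comR _ _ qs G => qs ∪ roles G
  | choiceR _ _ qs G₁ G₂ => qs ∪ roles G₁ ∪ roles G₂

/-- The recursion variable with index `i` occurs free. -/
def Occurs {B : Type*} : ℕ → Proto B → Prop
  | i, com _ _ _ G => Occurs i G
  | i, choice _ _ _ G₁ G₂ => Occurs i G₁ ∨ Occurs i G₂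
  | i, mu G => Occurs (i + 1) G
  | i, rvar j => i = j
  | _, fin => False
  | i, comR _ _ _ G => Occurs i G
  | i, choiceR _ _ _ G₁ G₂ => Occurs i G₁ ∨ Occurs i G₂

/-- The protocol contains no runtime terms. -/
def Static {B : Type*} : Proto B → Prop
  | com _ _ _ G => Static G
  | choice _ _ _ G₁ G₂ => Static G₁ ∧ Static G₂
  | mu G => Static G
  | rvar _ => True
  | fin => True
  | comR _ _ _ _ => False
  | choiceR _ _ _ _ _ => False

/-- The communication steps (sender, label, receivers) written in a protocol without runtime
terms. -/
def steps {B : Type*} : Proto B → List (Role × MLabel × Finset Role)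
  | com p l qs G => (p, l, qs) :: steps G
  | choice p l qs G₁ G₂ => (p, l, qs) :: (steps G₁ ++ steps G₂)
  | mu G => steps G
  | rvar _ => []
  | fin => []
  | comR _ _ _ G => steps G
  | choiceR _ _ _ G₁ G₂ => steps G₁ ++ steps G₂

/-- `NestOk A G`, where `A` lists the roles of the bodies of the enclosing loops, innermost first:
a loop from which one can jump back to an enclosing loop involves all roles of the latter. -/
def NestOk {B : Type*} : List (Finset Role) → Proto B → Prop
  | A, com _ _ _ G => NestOk A G
  | A, choice _ _ _ G₁ G₂ => NestOk A G₁ ∧ NestOk A G₂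
  | A, mu G => (∀ i S, A[i]? = some S → Occurs i (mu G) → S ⊆ roles G) ∧
      NestOk (roles G :: A) G
  | _, rvar _ => True
  | _, fin => True
  | A, comR _ _ _ G => NestOk A G
  | A, choiceR _ _ _ G₁ G₂ => NestOk A G₁ ∧ NestOk A G₂

end Proto

/-- Labels of protocol transitions: a role sends or receives a value on an interaction. -/
inductive GAct (B : Type*) where
  | send : Role → MLabel → Val B → GAct B
  | recv : Role → MLabel → Val B → GAct B

/-- The role of a protocol action. -/
def GAct.role {B : Type*} : GAct B → Role
  | .send p _ _ => p
  | .recv p _ _ => p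

/-- Transitions of protocols. -/
inductive GStep {B : Type*} : Proto B → GAct B → Proto B → Prop
  | sVal {p l qs G v} : GStep (.com p l qs G) (.send p l v) (.comR l v qs G)
  | sChoice {p l qs G₁ G₂ v} (hv : v = .inl ∨ v = .inr) :
      GStep (.choice p l qs G₁ G₂) (.send p l v) (.choiceR l v qs G₁ G₂)
  | rVal {l v qs q G} (hq : q ∉ qs) (hne : qs.Nonempty) :
      GStep (.comR l v (insert q qs) G) (.recv q l v) (.comR l v qs G)
  | rVal2 {l v q G} : GStep (.comR l v {q} G) (.recv q l v) G
  | rChoice {l v qs q G₁ G₂} (hq : q ∉ qs) (hne : qs.Nonempty) :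
      GStep (.choiceR l v (insert q qs) G₁ G₂) (.recv q l v) (.choiceR l v qs G₁ G₂)
  | rChoice2L {l q G₁ G₂} : GStep (.choiceR l .inl {q} G₁ G₂) (.recv q l .inl) G₁
  | rChoice2R {l q G₁ G₂} : GStep (.choiceR l .inr {q} G₁ G₂) (.recv q l .inr) G₂
  | unfold {G a G'} (h : GStep (Proto.subst (.mu G) 0 G) a G') : GStep (.mu G) a G'
  | conc1 {p l qs G G' a} (h : GStep G a G') (hp : a.role ≠ p) (hq : a.role ∉ qs) :
      GStep (.com p l qs G) a (.com p l qs G')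
  | conc2 {p l qs G₁ G₁' G₂ G₂' a} (h₁ : GStep G₁ a G₁') (h₂ : GStep G₂ a G₂')
      (hp : a.role ≠ p) (hq : a.role ∉ qs) :
      GStep (.choice p l qs G₁ G₂) a (.choice p l qs G₁' G₂')
  | conc3 {l v qs G G' a} (h : GStep G a G') (hq : a.role ∉ qs) :
      GStep (.comR l v qs G) a (.comR l v qs G')
  | conc4 {l qs G₁ G₁' G₂ a} (h : GStep G₁ a G₁') (hq : a.role ∉ qs) :
      GStep (.choiceR l .inl qs G₁ G₂) a (.choiceR l .inl qs G₁' G₂)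
  | conc5 {l qs G₁ G₂ G₂' a} (h : GStep G₂ a G₂') (hq : a.role ∉ qs) :
      GStep (.choiceR l .inr qs G₁ G₂) a (.choiceR l .inr qs G₁ G₂')

/-! ## Components -/

/-- A connection binder `label : receiver.rport ← sender.sport`. -/
structure Conn where
  label : MLabel
  receiver : Role
  rport : Port
  sender : Role
  sport : Port

/-- The two kinds of forwarders. -/
inductive Dir where
  | inp
  | out

/-- A forwarder of a composite component: it forwards inputs from the external port `ext` to the
internal port `int`, or outputs from `int` to `ext`. -/
structure Fwd where
  dir : Dir
  ext : Port
  int : Port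

/-- Components: base components `[xs ⟩ ys]{L}` and composite components
`[xs ⟩ ys]{G; R; D; r[F]}`. -/
inductive Comp (B : Type*) where
  | base (xs ys : List Port) (L : List (LBinder B)) : Comp B
  | composite (xs ys : List Port) (D : List Conn) (r : Role) (F : List Fwd)
      (R : List (Role × Comp B)) (G : Proto B) : Comp B

/-- The input ports of the interface. -/
def Comp.ins {B : Type*} : Comp B → List Port
  | .base xs _ _ => xs
  | .composite xs _ _ _ _ _ _ => xs

/-- The output ports of the interface. -/
def Comp.outs {B : Type*} : Comp B → List Port
  | .base _ ys _ => ys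
  | .composite _ ys _ _ _ _ _ => ys

/-- Labels of component transitions. -/
inductive Lab (B : Type*) where
  | act : Act B → Lab B
  | tau : Lab B

/-- Transitions of components. -/
inductive Step {B : Type*} : Comp B → Lab B → Comp B → Prop
  | outBase {xs ys L y v L'} (h : LStep L (.out y v) L') (hy : y ∈ ys) :
      Step (.base xs ys L) (.act (.out y v)) (.base xs ys L')
  | inpBase {xs ys L x v L'} (h : LStep L (.inp x v) L') (hx : x ∈ xs) :
      Step (.base xs ys L) (.act (.inp x v)) (.base xs ys L')
  | outChor {xs ys D r F R₁ R₂ C C' G G' v} {b : Conn}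
      (h : Step C (.act (.out b.sport v)) C') (hb : b ∈ D)
      (hG : GStep G (.send b.sender b.label v) G') :
      Step (.composite xs ys D r F (R₁ ++ (b.sender, C) :: R₂) G) .tau
        (.composite xs ys D r F (R₁ ++ (b.sender, C') :: R₂) G')
  | inpChor {xs ys D r F R₁ R₂ C C' G G' v} {b : Conn}
      (h : Step C (.act (.inp b.rport v)) C') (hb : b ∈ D)
      (hG : GStep G (.recv b.receiver b.label v) G') :
      Step (.composite xs ys D r F (R₁ ++ (b.receiver, C) :: R₂) G) .tau
        (.composite xs ys D r F (R₁ ++ (b.receiver, C') :: R₂) G')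
  | internal {xs ys D r F R₁ R₂ C C' G s} (h : Step C .tau C') :
      Step (.composite xs ys D r F (R₁ ++ (s, C) :: R₂) G) .tau
        (.composite xs ys D r F (R₁ ++ (s, C') :: R₂) G)
  | outComp {xs ys D r F R₁ R₂ C C' G y z v}
      (h : Step C (.act (.out z v)) C') (hF : ⟨.out, y, z⟩ ∈ F) (hy : y ∈ ys) :
      Step (.composite xs ys D r F (R₁ ++ (r, C) :: R₂) G) (.act (.out y v))
        (.composite xs ys D r F (R₁ ++ (r, C') :: R₂) G)
  | inpComp {xs ys D r F R₁ R₂ C C' G x z v}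
      (h : Step C (.act (.inp z v)) C') (hF : ⟨.inp, x, z⟩ ∈ F) (hx : x ∈ xs) :
      Step (.composite xs ys D r F (R₁ ++ (r, C) :: R₂) G) (.act (.inp x v))
        (.composite xs ys D r F (R₁ ++ (r, C') :: R₂) G)

/-- Programs: no runtime terms, that is, empty queues and static protocols everywhere. -/
inductive IsProgram {B : Type*} : Comp B → Prop
  | base {xs ys L} (h : ∀ b ∈ L, b.queue = []) : IsProgram (.base xs ys L)
  | composite {xs ys D r F R G} (hR : ∀ s C, (s, C) ∈ R → IsProgram C) (hG : G.Static) :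
      IsProgram (.composite xs ys D r F R G)

/-- `Accepts C x`: the component can always receive on its input port `x`. An input port of a
composite component has to be forwarded to such a port of the interfacing subcomponent. -/
inductive Accepts {B : Type*} : Comp B → Port → Prop
  | base {xs ys L x} (hx : x ∈ xs) : Accepts (.base xs ys L) x
  | composite {xs ys D r F R G x z C} (hx : x ∈ xs) (hF : ⟨.inp, x, z⟩ ∈ F) (hC : (r, C) ∈ R)
      (h : Accepts C z) : Accepts (.composite xs ys D r F R G) x

/-- The connection binders labelled `l` realise the communication from `p` to `qs`: they link one
output port `z` of `p` to one input port `w q` of each receiver `q`. -/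
def Realises (D : List Conn) (p : Role) (l : MLabel) (qs : Finset Role) : Prop :=
  ∃ (z : Port) (w : Role → Port), ∀ b : Conn,
    (b ∈ D ∧ b.label = l) ↔ ∃ q ∈ qs, b = ⟨l, q, w q, p, z⟩

/-- Well-formedness of a protocol: no free recursion variable, labels identify communication
steps, every step has a receiver, senders are not receivers, and the condition on nested loops. -/
def WFProto {B : Type*} (G : Proto B) : Prop :=
  (∀ i, ¬ G.Occurs i) ∧ (G.steps.map fun s => s.2.1).Nodup ∧
    (∀ s ∈ G.steps, s.2.2.Nonempty ∧ s.1 ∉ s.2.2) ∧ G.NestOk []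

/-- Well-formed components: interface ports are distinct, local binders define distinct ports, roles
are assigned once, forwarders link input ports to input ports and output ports to output ports,
connection binders link output ports to input ports, each forwarder uses its own ports, receiver
ports are used at most once, sender ports always with the same label, every communication step is realised by
the connection binders with its label, and receivers accept what is delivered to them. -/
inductive WF {B : Type*} : Comp B → Prop
  | base {xs ys L} (hports : (xs ++ ys).Nodup) (hdef : (L.map LBinder.lhs).Nodup) :
      WF (.base xs ys L)
  | composite {xs ys D r F R G}
      (hports : (xs ++ ys).Nodup)
      (hroles : (R.map Prod.fst).Nodup)
      (hsub : ∀ s C, (s, C) ∈ R → WF C)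
      (hG : WFProto G)
      (hext : (F.map Fwd.ext).Nodup)
      (hint : (F.map Fwd.int).Nodup)
      (hfwd : ∀ φ ∈ F, ∃ C, (r, C) ∈ R ∧ (φ.dir = .inp → φ.ext ∈ xs ∧ φ.int ∈ C.ins) ∧
        (φ.dir = .out → φ.ext ∈ ys ∧ φ.int ∈ C.outs))
      (hrecv : (D.map fun b => (b.receiver, b.rport)).Nodup)
      (hsend : ∀ b ∈ D, ∀ b' ∈ D, b.sender = b'.sender → b.sport = b'.sport →
        b.label = b'.label)
      (hreal : ∀ s ∈ G.steps, Realises D s.1 s.2.1 s.2.2)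
      (hin : ∀ b ∈ D, ∃ C, (b.receiver, C) ∈ R ∧ Accepts C b.rport)
      (hout : ∀ b ∈ D, ∃ C, (b.sender, C) ∈ R ∧ b.sport ∈ C.outs) :
      WF (.composite xs ys D r F R G)

/-! ## Processes -/

/-- Objects: variables (de Bruijn indices) and values. -/
inductive Obj (B : Type*) where
  | var : ℕ → Obj B
  | val : Val B → Obj B

/-- Processes. Variables bound by inputs and recursion variables are de Bruijn indices, ports are
names. `box S L` is the set of local binders `L` delimited by the set of ports `S`, and `fwd d z w P`
exhibits on `z` the inputs (outputs) of `P` on `w`. -/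
inductive Proc (B : Type*) where
  | nil : Proc B
  | par : Proc B → Proc B → Proc B
  | nu : Port → Proc B → Proc B
  | mu : Proc B → Proc B
  | rvar : ℕ → Proc B
  | out : Port → Obj B → Proc B → Proc B
  | inp : Port → Proc B → Proc B
  | branch : Port → Proc B → Proc B → Proc B
  | box : Set Port → List (LBinder B) → Proc B
  | fwd : Dir → Port → Port → Proc B → Proc B

/-- Apply a permutation of ports to a local binder. -/
def LBinder.perm {B : Type*} (π : Equiv.Perm Port) (b : LBinder B) : LBinder B where
  lhs := π b.lhs
  queue := b.queue.map fun σ => σ ∘ π.symm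
  f := b.f
  params := b.params.map π

namespace Proc

/-- Free ports. -/
def fp {B : Type*} : Proc B → Set Port
  | nil => ∅
  | par P Q => fp P ∪ fp Q
  | nu z P => fp P \ {z}
  | mu P => fp P
  | rvar _ => ∅
  | out z _ P => {z} ∪ fp P
  | inp z P => {z} ∪ fp P
  | branch z P Q => {z} ∪ fp P ∪ fp Q
  | box S L => S ∪ {u | ∃ b ∈ L, u ∈ b.fp}
  | fwd _ z w P => {z, w} ∪ fp P

/-- Apply a permutation of ports (also to bound ports). -/
def perm {B : Type*} (π : Equiv.Perm Port) : Proc B → Proc B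
  | nil => nil
  | par P Q => par (perm π P) (perm π Q)
  | nu z P => nu (π z) (perm π P)
  | mu P => mu (perm π P)
  | rvar i => rvar i
  | out z o P => out (π z) o (perm π P)
  | inp z P => inp (π z) (perm π P)
  | branch z P Q => branch (π z) (perm π P) (perm π Q)
  | box S L => box (π '' S) (L.map (LBinder.perm π))
  | fwd d z w P => fwd d (π z) (π w) (perm π P)

/-- Increment the recursion variables with index at least `c`. -/
def liftRec {B : Type*} : ℕ → Proc B → Proc B
  | _, nil => nil
  | c, par P Q => par (liftRec c P) (liftRec c Q)
  | c, nu z P => nu z (liftRec c P)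
  | c, mu P => mu (liftRec (c + 1) P)
  | c, rvar i => rvar (if c ≤ i then i + 1 else i)
  | c, out z o P => out z o (liftRec c P)
  | c, inp z P => inp z (liftRec c P)
  | c, branch z P Q => branch z (liftRec c P) (liftRec c Q)
  | _, box S L => box S L
  | c, fwd d z w P => fwd d z w (liftRec c P)

/-- Increment the variables with index at least `c`. -/
def liftVar {B : Type*} : ℕ → Proc B → Proc B
  | _, nil => nil
  | c, par P Q => par (liftVar c P) (liftVar c Q)
  | c, nu z P => nu z (liftVar c P)
  | c, mu P => mu (liftVar c P)
  | _, rvar i => rvar i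
  | c, out z (.var i) P => out z (.var (if c ≤ i then i + 1 else i)) (liftVar c P)
  | c, out z (.val v) P => out z (.val v) (liftVar c P)
  | c, inp z P => inp z (liftVar (c + 1) P)
  | c, branch z P Q => branch z (liftVar c P) (liftVar c Q)
  | _, box S L => box S L
  | c, fwd d z w P => fwd d z w (liftVar c P)

/-- Substitution of a value for the variable with index `c`. -/
def substVal {B : Type*} (v : Val B) : ℕ → Proc B → Proc B
  | _, nil => nil
  | c, par P Q => par (substVal v c P) (substVal v c Q)
  | c, nu z P => nu z (substVal v c P)
  | c, mu P => mu (substVal v c P)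
  | _, rvar i => rvar i
  | c, out z (.var i) P =>
      out z (if i < c then .var i else if i = c then .val v else .var (i - 1)) (substVal v c P)
  | c, out z (.val w) P => out z (.val w) (substVal v c P)
  | c, inp z P => inp z (substVal v (c + 1) P)
  | c, branch z P Q => branch z (substVal v c P) (substVal v c Q)
  | _, box S L => box S L
  | c, fwd d z w P => fwd d z w (substVal v c P)

open Classical in
/-- A port that may replace the bound port `z` without clashing with the ports in `A`: `z` itself
if possible, otherwise a fresh one. -/
noncomputable def pick (z : Port) (A : Set Port) : Port :=
  if z ∈ A then Classical.epsilon fun u => u ∉ A else z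

/-- Capture-avoiding substitution of `Q` for the recursion variable with index `k`, where the
permutation `π` records how the bound ports met so far have been renamed. -/
noncomputable def substRec {B : Type*} : Proc B → ℕ → Equiv.Perm Port → Proc B → Proc B
  | _, _, _, nil => nil
  | Q, k, π, par P P' => par (substRec Q k π P) (substRec Q k π P')
  | Q, k, π, nu z P =>
      nu (pick (π z) (fp Q ∪ π '' fp (nu z P)))
        (substRec Q k (Equiv.swap (π z) (pick (π z) (fp Q ∪ π '' fp (nu z P))) * π) P)
  | Q, k, π, mu P => mu (substRec (liftRec 0 Q) (k + 1) π P)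
  | Q, k, _, rvar i => if i < k then rvar i else if i = k then Q else rvar (i - 1)
  | Q, k, π, out z o P => out (π z) o (substRec Q k π P)
  | Q, k, π, inp z P => inp (π z) (substRec (liftVar 0 Q) k π P)
  | Q, k, π, branch z P P' => branch (π z) (substRec Q k π P) (substRec Q k π P')
  | _, _, π, box S L => box (π '' S) (L.map (LBinder.perm π))
  | Q, k, π, fwd d z w P => fwd d (π z) (π w) (substRec Q k π P)

/-- The unfolding `P{μX.P/X}` of `μX.P`. -/
noncomputable def unfold {B : Type*} (P : Proc B) : Proc B := substRec (mu P) 0 1 P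

end Proc

/-- Labels of process transitions: `queue a` for actions of local binders, `prim a` for actions of
communication primitives, and `tau`. -/
inductive PLab (B : Type*) where
  | queue : Act B → PLab B
  | prim : Act B → PLab B
  | tau : PLab B

/-- The port of a label is not `u`; this holds for `tau`. -/
def PLab.Avoids {B : Type*} (u : Port) : PLab B → Prop
  | .queue a => a.port ≠ u
  | .prim a => a.port ≠ u
  | .tau => True

/-- Transitions of processes. -/
inductive PStep {B : Type*} : Proc B → PLab B → Proc B → Prop
  | act {S L L' a} (h : LStep L a L') (ha : a.port ∈ S) :
      PStep (.box S L) (.queue a) (.box S L')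
  | res {z P Q lam} (h : PStep P lam Q) (hz : lam.Avoids z) : PStep (.nu z P) lam (.nu z Q)
  | parL {P Q R lam} (h : PStep P lam Q) : PStep (.par P R) lam (.par Q R)
  | parR {P Q R lam} (h : PStep P lam Q) : PStep (.par R P) lam (.par R Q)
  | comL {P P' Q Q' a} (h₁ : PStep P (.queue a) P') (h₂ : PStep Q (.prim a.dual) Q') :
      PStep (.par P Q) .tau (.par P' Q')
  | comR {P P' Q Q' a} (h₁ : PStep P (.prim a.dual) P') (h₂ : PStep Q (.queue a) Q') :
      PStep (.par P Q) .tau (.par P' Q')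
  | unfold {P lam Q} (h : PStep P.unfold lam Q) : PStep (.mu P) lam Q
  | fwd {d z w P Q lam} (h : PStep P lam Q) (hz : lam.Avoids z) (hw : lam.Avoids w) :
      PStep (.fwd d z w P) lam (.fwd d z w Q)
  | fwdInp {z w P Q v} (h : PStep P (.queue (.inp w v)) Q) :
      PStep (.fwd .inp z w P) (.queue (.inp z v)) (.fwd .inp z w Q)
  | fwdOut {z w P Q v} (h : PStep P (.queue (.out w v)) Q) :
      PStep (.fwd .out z w P) (.queue (.out z v)) (.fwd .out z w Q)
  | fwdInp2 {z w P Q v} (h : PStep P (.prim (.inp w v)) Q) :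
      PStep (.fwd .inp z w P) (.prim (.inp z v)) (.fwd .inp z w Q)
  | fwdOut2 {z w P Q v} (h : PStep P (.prim (.out w v)) Q) :
      PStep (.fwd .out z w P) (.prim (.out z v)) (.fwd .out z w Q)
  | out {z v P} : PStep (.out z (.val v) P) (.prim (.out z v)) P
  | inp {z v P} : PStep (.inp z P) (.prim (.inp z v)) (P.substVal v 0)
  | choL {z P Q} : PStep (.branch z P Q) (.prim (.inp z .inl)) P
  | choR {z P Q} : PStep (.branch z P Q) (.prim (.inp z .inr)) Q

/-- Structural congruence: the least congruence that contains the monoid laws of parallel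
composition, the laws of restriction, renaming of bound ports, unfolding of recursion, exchange of
local binders, and swapping of forwarders on distinct ports. -/
inductive SCong {B : Type*} : Proc B → Proc B → Prop
  | refl {P} : SCong P P
  | symm {P Q} (h : SCong P Q) : SCong Q P
  | trans {P Q R} (h₁ : SCong P Q) (h₂ : SCong Q R) : SCong P R
  | par {P P' Q Q'} (h₁ : SCong P P') (h₂ : SCong Q Q') : SCong (.par P Q) (.par P' Q')
  | nu {z P P'} (h : SCong P P') : SCong (.nu z P) (.nu z P')
  | mu {P P'} (h : SCong P P') : SCong (.mu P) (.mu P')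
  | out {z o P P'} (h : SCong P P') : SCong (.out z o P) (.out z o P')
  | inp {z P P'} (h : SCong P P') : SCong (.inp z P) (.inp z P')
  | branch {z P P' Q Q'} (h₁ : SCong P P') (h₂ : SCong Q Q') :
      SCong (.branch z P Q) (.branch z P' Q')
  | fwd {d z w P P'} (h : SCong P P') : SCong (.fwd d z w P) (.fwd d z w P')
  | par_nil {P} : SCong (.par P .nil) P
  | par_comm {P Q} : SCong (.par P Q) (.par Q P)
  | par_assoc {P Q R} : SCong (.par (.par P Q) R) (.par P (.par Q R))
  | nu_nil {z} : SCong (.nu z .nil) .nil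
  | nu_comm {z w P} : SCong (.nu z (.nu w P)) (.nu w (.nu z P))
  | nu_par {z P Q} (hz : z ∉ P.fp) : SCong (.nu z (.par P Q)) (.par P (.nu z Q))
  | alpha {z w P} (hw : w ∉ P.fp) : SCong (.nu z P) (.nu w (P.perm (Equiv.swap z w)))
  | unfold {P} : SCong (.mu P) P.unfold
  | exchange {S L L'} (h : L.Perm L') : SCong (.box S L) (.box S L')
  | fwd_swap {d d' z w z' w' P} (h : [z, w, z', w'].Nodup) :
      SCong (.fwd d z w (.fwd d' z' w' P)) (.fwd d' z' w' (.fwd d z w P))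

/-! ## The encoding -/

/-- Arguments of the mapping `γ`: role-port pairs and role-label pairs. -/
inductive Key where
  | port : Role → Port → Key
  | label : Role → MLabel → Key

/-- `EncG D γ r G P`: the process `P` encodes the protocol `G` for the role `r`. -/
inductive EncG {B : Type*} (D : List Conn) (γ : Key → Port) (r : Role) :
    Proto B → Proc B → Prop
  | comSend {l qs G P} {b : Conn} (hb : b ∈ D) (hl : b.label = l) (hs : b.sender = r)
      (h : EncG D γ r G P) :
      EncG D γ r (.com r l qs G)
        (.inp (γ (.port r b.sport)) (.out (γ (.label r l)) (.var 0) (P.liftVar 0)))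
  | comRecv {p l qs G P} {b : Conn} (hq : r ∈ qs) (hb : b ∈ D) (hl : b.label = l)
      (hr : b.receiver = r) (hs : b.sender = p) (h : EncG D γ r G P) :
      EncG D γ r (.com p l qs G)
        (.inp (γ (.label r l)) (.out (γ (.port r b.rport)) (.var 0) (P.liftVar 0)))
  | comSkip {p l qs G P} (hp : r ≠ p) (hq : r ∉ qs) (h : EncG D γ r G P) :
      EncG D γ r (.com p l qs G) P
  | comRRecv {l v qs G P} {b : Conn} (hq : r ∈ qs) (hb : b ∈ D) (hl : b.label = l)
      (hr : b.receiver = r) (h : EncG D γ r G P) :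
      EncG D γ r (.comR l v qs G)
        (.inp (γ (.label r l)) (.out (γ (.port r b.rport)) (.var 0) (P.liftVar 0)))
  | comRSkip {l v qs G P} (hq : r ∉ qs) (h : EncG D γ r G P) : EncG D γ r (.comR l v qs G) P
  | choiceSend {l qs G₁ G₂ P₁ P₂} {b : Conn} (hb : b ∈ D) (hl : b.label = l)
      (hs : b.sender = r) (h₁ : EncG D γ r G₁ P₁) (h₂ : EncG D γ r G₂ P₂) :
      EncG D γ r (.choice r l qs G₁ G₂)
        (.branch (γ (.port r b.sport)) (.out (γ (.label r l)) (.val .inl) P₁)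
          (.out (γ (.label r l)) (.val .inr) P₂))
  | choiceRecv {p l qs G₁ G₂ P₁ P₂} {b : Conn} (hq : r ∈ qs) (hb : b ∈ D) (hl : b.label = l)
      (hr : b.receiver = r) (hs : b.sender = p) (h₁ : EncG D γ r G₁ P₁) (h₂ : EncG D γ r G₂ P₂) :
      EncG D γ r (.choice p l qs G₁ G₂)
        (.branch (γ (.label r l)) (.out (γ (.port r b.rport)) (.val .inl) P₁)
          (.out (γ (.port r b.rport)) (.val .inr) P₂))
  | choiceSkip {p l qs G₁ G₂ P} (hp : r ≠ p) (hq : r ∉ qs) (h₁ : EncG D γ r G₁ P)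
      (h₂ : EncG D γ r G₂ P) : EncG D γ r (.choice p l qs G₁ G₂) P
  | choiceRRecv {l v qs G₁ G₂ P₁ P₂} {b : Conn} (hq : r ∈ qs) (hb : b ∈ D) (hl : b.label = l)
      (hr : b.receiver = r) (h₁ : EncG D γ r G₁ P₁) (h₂ : EncG D γ r G₂ P₂) :
      EncG D γ r (.choiceR l v qs G₁ G₂)
        (.branch (γ (.label r l)) (.out (γ (.port r b.rport)) (.val .inl) P₁)
          (.out (γ (.port r b.rport)) (.val .inr) P₂))
  | choiceRSkipL {l qs G₁ G₂ P} (hq : r ∉ qs) (h : EncG D γ r G₁ P) :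
      EncG D γ r (.choiceR l .inl qs G₁ G₂) P
  | choiceRSkipR {l qs G₁ G₂ P} (hq : r ∉ qs) (h : EncG D γ r G₂ P) :
      EncG D γ r (.choiceR l .inr qs G₁ G₂) P
  | mu {G P} (hr : r ∈ G.roles) (h : EncG D γ r G P) : EncG D γ r (.mu G) (.mu P)
  | muSkip {G} (hr : r ∉ G.roles) : EncG D γ r (.mu G) .nil
  | rvar {i} : EncG D γ r (.rvar i) (.rvar i)
  | fin : EncG D γ r .fin .nil

/-- The identity function on values, as a function of a list of arguments. -/
def idFun {B : Type*} : List (Val B) → Option (Val B)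
  | [v] => some v
  | _ => none

/-- The queue of a connection binder: it reads from the sender's monitor and serves the receiver's
monitor. -/
def queueOf {B : Type*} (γ : Key → Port) (b : Conn) : LBinder B :=
  ⟨γ (.label b.receiver b.label), [], idFun, [γ (.label b.sender b.label)]⟩

/-- The ports of the monitor queues. -/
def queuePorts (γ : Key → Port) (D : List Conn) : Set Port :=
  {u | ∃ b ∈ D, u = γ (.label b.receiver b.label) ∨ u = γ (.label b.sender b.label)}

open Classical in
/-- Append the store `{u' ↦ v}` to the queues of the binders that define a port in `us`. -/
noncomputable def enqueue {B : Type*} (us : Set Port) (u' : Port) (v : Val B)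
    (L : List (LBinder B)) : List (LBinder B) :=
  L.map fun b => if b.lhs ∈ us then { b with queue := b.queue ++ [Store.single u' v] } else b

/-- The ports `γ(q, l)` for `q ∈ qs`. -/
def waiting (γ : Key → Port) (l : MLabel) (qs : Finset Role) : Set Port :=
  {u | ∃ q ∈ qs, u = γ (.label q l)}

/-- The queues in `L` that define the ports `us` exist and all have the form `id(u')`. -/
def Served {B : Type*} (us : Set Port) (u' : Port) (L : List (LBinder B)) : Prop :=
  (∀ u ∈ us, ∃ b ∈ L, b.lhs = u) ∧ ∀ b ∈ L, b.lhs ∈ us → b.params = [u'] ∧ b.f = idFun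

/-- `Fill γ G L L'`: placing the values in transit in `G` in the queues `L` yields `L'`. -/
inductive Fill {B : Type*} (γ : Key → Port) :
    Proto B → List (LBinder B) → List (LBinder B) → Prop
  | com {p l qs G L L'} (h : Fill γ G L L') : Fill γ (.com p l qs G) L L'
  | comR {l v qs G L L' u'} (hu : Served (waiting γ l qs) u' L)
      (h : Fill γ G (enqueue (waiting γ l qs) u' v L) L') : Fill γ (.comR l v qs G) L L'
  | choice {p l qs G₁ G₂ L L'} (h₁ : Fill γ G₁ L L') (h₂ : Fill γ G₂ L L') :
      Fill γ (.choice p l qs G₁ G₂) L L'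
  | choiceRL {l qs G₁ G₂ L L' u'} (hu : Served (waiting γ l qs) u' L)
      (h : Fill γ G₁ (enqueue (waiting γ l qs) u' .inl L) L') :
      Fill γ (.choiceR l .inl qs G₁ G₂) L L'
  | choiceRR {l qs G₁ G₂ L L' u'} (hu : Served (waiting γ l qs) u' L)
      (h : Fill γ G₂ (enqueue (waiting γ l qs) u' .inr L) L') :
      Fill γ (.choiceR l .inr qs G₁ G₂) L L'
  | mu {G L L'} (h : Fill γ G L L') : Fill γ (.mu G) L L'
  | rvar {i L} : Fill γ (.rvar i) L L
  | fin {L} : Fill γ .fin L L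

/-- Restriction of a list of ports. -/
def nus {B : Type*} (zs : List Port) (P : Proc B) : Proc B := zs.foldr Proc.nu P

/-- A sequence of forwarders of the same kind, each between `f x` and `g x`. -/
def fwds {B : Type*} (d : Dir) (f g : Port → Port) (xs : List Port) (P : Proc B) : Proc B :=
  xs.foldr (fun x Q => .fwd d (f x) (g x) Q) P

/-- The domain of the mapping for a base component, for a dummy role `r`. -/
def baseDom {B : Type*} (r : Role) (xs ys : List Port) (L : List (LBinder B)) : Set Key :=
  {k | ∃ x, k = .port r x ∧ (x ∈ xs ∨ x ∈ ys ∨ ∃ b ∈ L, x ∈ b.fp)}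

/-- The domain of the mapping for a composite component: the role-port and role-label pairs of the
connection binders, and the forwarded ports of the interfacing role. -/
def compDom (D : List Conn) (r : Role) (F : List Fwd) : Set Key :=
  {k | (∃ b ∈ D, k = .port b.receiver b.rport ∨ k = .port b.sender b.sport ∨
      k = .label b.receiver b.label ∨ k = .label b.sender b.label) ∨
    ∃ φ ∈ F, k = .port r φ.int}

mutual

/-- `Enc C P`: the process `P` is an encoding of the component `C`, for some choice of the
injective mapping `γ`. The list `zs` enumerates the image of the domain of `γ`. -/
inductive Enc {B : Type u} : Comp B → Proc B → Prop
  | base {xs ys : List Port} {L : List (LBinder B)} (γ : Key → Port) (r : Role) (zs : List Port)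
      (hγ : Function.Injective γ) (hnd : zs.Nodup)
      (hzs : {z | z ∈ zs} = γ '' baseDom r xs ys L)
      (hfresh : ∀ z ∈ zs, z ∉ xs ∧ z ∉ ys) :
      Enc (.base xs ys L)
        (nus zs (fwds .inp id (fun x => γ (.port r x)) xs
          (fwds .out id (fun y => γ (.port r y)) ys
            (.box {z | z ∈ zs} (L.map (LBinder.rename fun x => γ (.port r x)))))))
  | composite {xs ys : List Port} {D : List Conn} {r : Role} {F : List Fwd}
      {R : List (Role × Comp B)} {G : Proto B} (γ : Key → Port) (zs : List Port)
      (ps : List Role) (Qs Ms : List (Proc B)) (L : List (LBinder B))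
      (hγ : Function.Injective γ) (hnd : zs.Nodup)
      (hzs : {z | z ∈ zs} = γ '' compDom D r F)
      (hfresh : ∀ z ∈ zs, z ∉ xs ∧ z ∉ ys)
      (hFin : ∀ φ ∈ F, φ.dir = .inp → φ.ext ∈ xs)
      (hFout : ∀ φ ∈ F, φ.dir = .out → φ.ext ∈ ys)
      (hps : ps.Nodup) (hroles : ∀ p, p ∈ ps ↔ p ∈ G.roles)
      (hQs : EncR γ (compDom D r F) R Qs)
      (hMs : List.Forall₂ (fun p M => EncG D γ p G M) ps Ms)
      (hL : Fill γ G (D.map (queueOf γ)) L) :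
      Enc (.composite xs ys D r F R G)
        (nus zs (F.foldr (fun φ P => .fwd φ.dir φ.ext (γ (.port r φ.int)) P)
          ((Qs ++ Ms).foldr Proc.par (.box (queuePorts γ D) L))))

/-- `EncR γ dom R Qs`: the processes `Qs` encode the role assignments `R` under the mapping `γ`
with domain `dom`, whose image avoids the ports restricted here. -/
inductive EncR {B : Type u} :
    (Key → Port) → Set Key → List (Role × Comp B) → List (Proc B) → Prop
  | nil {γ : Key → Port} {dom : Set Key} : EncR γ dom [] []
  | cons {γ : Key → Port} {dom : Set Key} {p : Role} {C : Comp B} {R : List (Role × Comp B)}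
      {Q : Proc B} {Qs : List (Proc B)}
      (h : Enc C Q)
      (hdom : ∀ x, x ∈ C.ins ∨ x ∈ C.outs → .port p x ∈ dom)
      (hfresh : ∀ k ∈ dom, γ k ∉ C.ins ∧ γ k ∉ C.outs)
      (hR : EncR γ dom R Qs) :
      EncR γ dom ((p, C) :: R)
        (nus (C.ins ++ C.outs)
          (fwds .inp (fun x => γ (.port p x)) id C.ins
            (fwds .out (fun y => γ (.port p y)) id C.outs Q)) :: Qs)

end

/-! ## Runs -/

/-- Zero or more `τ` transitions of components. -/
def Steps {B : Type*} : Comp B → Comp B → Prop :=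
  Relation.ReflTransGen fun C C' => Step C .tau C'

/-- Zero or more `τ` transitions of processes. -/
def PSteps {B : Type*} : Proc B → Proc B → Prop :=
  Relation.ReflTransGen fun P P' => PStep P .tau P'

/-- Components: the well-formed programs that have an encoding, and the runtime configurations that
they reach by transitions with arbitrary labels. -/
def IsConfiguration {B : Type*} (C : Comp B) : Prop :=
  ∃ (C₀ : Comp B) (E₀ : Proc B), IsProgram C₀ ∧ WF C₀ ∧ Enc C₀ E₀ ∧
    Relation.ReflTransGen (fun C₁ C₂ => ∃ lam, Step C₁ lam C₂) C₀ C

end GC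

namespace GC

universe u

variable {B : Type u}

/-! ## Recursion variables of protocols -/

theorem Proto.lift_of_closed {G : Proto B} {c : ℕ} (h : ∀ i, c ≤ i → ¬ G.Occurs i) :
    Proto.lift c G = G := by
  induction G generalizing c with
  | com p l qs G ih => simp only [Proto.lift, ih h]
  | comR l v qs G ih => simp only [Proto.lift, ih h]
  | choice p l qs G₁ G₂ ih₁ ih₂ =>
    simp only [Proto.Occurs, not_or] at h
    simp only [Proto.lift, ih₁ fun i hi => (h i hi).1, ih₂ fun i hi => (h i hi).2]
  | choiceR l v qs G₁ G₂ ih₁ ih₂ =>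
    simp only [Proto.Occurs, not_or] at h
    simp only [Proto.lift, ih₁ fun i hi => (h i hi).1, ih₂ fun i hi => (h i hi).2]
  | mu G ih =>
    simp only [Proto.lift]
    rw [ih]
    intro i hi
    obtain ⟨j, rfl⟩ : ∃ j, i = j + 1 := ⟨i - 1, by omega⟩
    exact h j (by omega)
  | rvar i =>
    have : ¬ c ≤ i := fun hc => h i hc rfl
    simp [Proto.lift, this]
  | fin => rfl

theorem Proto.static_subst {K G : Proto B} {k : ℕ} (hK : ∀ i, ¬ K.Occurs i) (h : K.Static)
    (hG : G.Static) : (Proto.subst K k G).Static := by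
  induction G generalizing k with
  | com p l qs G ih => exact ih hG
  | comR l v qs G ih => exact hG.elim
  | choice p l qs G₁ G₂ ih₁ ih₂ => exact ⟨ih₁ hG.1, ih₂ hG.2⟩
  | choiceR l v qs G₁ G₂ ih₁ ih₂ => exact hG.elim
  | mu G ih =>
    simp only [Proto.subst, Proto.Static, Proto.lift_of_closed fun i _ => hK i]
    exact ih hG
  | rvar i =>
    simp only [Proto.subst]
    split_ifs
    · trivial
    · exact h
    · trivial
  | fin => trivial

theorem Proto.occurs_subst {K G : Proto B} {k i : ℕ} (hK : ∀ i, ¬ K.Occurs i)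
    (h : ∀ j, G.Occurs j → j ≤ k) (hi : (Proto.subst K k G).Occurs i) : i < k ∧ G.Occurs i := by
  induction G generalizing k i with
  | com p l qs G ih => exact ih h hi
  | comR l v qs G ih => exact ih h hi
  | choice p l qs G₁ G₂ ih₁ ih₂ =>
    rcases hi with hi | hi
    · exact (ih₁ (fun j hj => h j (.inl hj)) hi).imp_right .inl
    · exact (ih₂ (fun j hj => h j (.inr hj)) hi).imp_right .inr
  | choiceR p l qs G₁ G₂ ih₁ ih₂ =>
    rcases hi with hi | hi
    · exact (ih₁ (fun j hj => h j (.inl hj)) hi).imp_right .inl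
    · exact (ih₂ (fun j hj => h j (.inr hj)) hi).imp_right .inr
  | mu G ih =>
    simp only [Proto.subst, Proto.Occurs, Proto.lift_of_closed fun i _ => hK i] at hi ⊢
    have := ih (k := k + 1) (i := i + 1) (fun j hj => by
      cases j with
      | zero => omega
      | succ j => have := h j hj; omega) hi
    exact ⟨by omega, this.2⟩
  | rvar j =>
    have hj := h j rfl
    simp only [Proto.subst] at hi
    split_ifs at hi with h₁ h₂
    · cases hi; exact ⟨h₁, rfl⟩
    · exact (hK _ hi).elim
    · omega
  | fin => exact hi.elim

theorem Proto.mem_roles_subst {K G : Proto B} {k : ℕ} {s : Role} (hK : ∀ i, ¬ K.Occurs i) :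
    s ∈ (Proto.subst K k G).roles ↔ s ∈ G.roles ∨ G.Occurs k ∧ s ∈ K.roles := by
  induction G generalizing k with
  | com p l qs G ih =>
    simp only [Proto.subst, Proto.roles, Finset.mem_insert, Finset.mem_union, ih, Proto.Occurs]
    tauto
  | comR l v qs G ih =>
    simp only [Proto.subst, Proto.roles, Finset.mem_union, ih, Proto.Occurs]
    tauto
  | choice p l qs G₁ G₂ ih₁ ih₂ =>
    simp only [Proto.subst, Proto.roles, Finset.mem_insert, Finset.mem_union, ih₁, ih₂,
      Proto.Occurs]
    tauto
  | choiceR l v qs G₁ G₂ ih₁ ih₂ =>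
    simp only [Proto.subst, Proto.roles, Finset.mem_union, ih₁, ih₂,
      Proto.Occurs]
    tauto
  | mu G ih =>
    simp only [Proto.subst, Proto.roles, Proto.Occurs, Proto.lift_of_closed fun i _ => hK i, ih]
  | rvar i =>
    simp only [Proto.subst, Proto.roles, Proto.Occurs]
    split_ifs with h₁ h₂
    · simp [Proto.roles]; omega
    · simp [h₂]
    · simp [Proto.roles]; omega
  | fin => simp [Proto.subst, Proto.roles, Proto.Occurs]

/-! ## Agreement of the branches of a choice -/

/-- `Tree S H G`: the protocol `G` consists of prefixes between roles in `S`, and all of its leaves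
are `H`. -/
inductive Tree (S : Finset Role) (H : Proto B) : Proto B → Prop
  | leaf : Tree S H H
  | com {p l qs G} (hp : p ∈ S) (hq : qs ⊆ S) (h : Tree S H G) : Tree S H (.com p l qs G)
  | choice {p l qs G₁ G₂} (hp : p ∈ S) (hq : qs ⊆ S) (h₁ : Tree S H G₁) (h₂ : Tree S H G₂) :
      Tree S H (.choice p l qs G₁ G₂)

theorem Tree.subst {S : Finset Role} {H G K : Proto B} {k : ℕ} (h : Tree S H G) :
    Tree S (Proto.subst K k H) (Proto.subst K k G) := by
  induction h with
  | leaf => exact .leaf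
  | com hp hq _ ih => exact .com hp hq ih
  | choice hp hq _ _ ih₁ ih₂ => exact .choice hp hq ih₁ ih₂

/-- `Confined ρ S G`: all actions of the static protocol `G`, where `ρ` lists the roles of the
enclosing loops, are actions of roles in `S`. -/
def Confined (ρ : List (Finset Role)) (S : Finset Role) (G : Proto B) : Prop :=
  G.Static ∧ G.roles ⊆ S ∧ ∀ i A, ρ[i]? = some A → G.Occurs i → A ⊆ S

/-- The branches of a choice between the roles in `S` agree on the actions of other roles. -/
def Agree (ρ : List (Finset Role)) (S : Finset Role) (G₁ G₂ : Proto B) : Prop :=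
  (∃ H, Tree S H G₁ ∧ Tree S H G₂) ∨ Confined ρ S G₁ ∧ Confined ρ S G₂

/-- The values in transit in a protocol do not come from roles in `S`. -/
def NoSend (D : List Conn) (S : Finset Role) : Proto B → Prop
  | .com _ _ _ G => NoSend D S G
  | .choice _ _ _ G₁ G₂ => NoSend D S G₁ ∧ NoSend D S G₂
  | .mu G => NoSend D S G
  | .rvar _ => True
  | .fin => True
  | .comR l _ _ G => (∀ b ∈ D, b.label = l → b.sender ∉ S) ∧ NoSend D S G
  | .choiceR l _ _ G₁ G₂ =>
    (∀ b ∈ D, b.label = l → b.sender ∉ S) ∧ NoSend D S G₁ ∧ NoSend D S G₂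

/-- The label `l` is realised by the connection binders in `D`, for some sender and receivers that
include those in `qs`. -/
def RealLabel (D : List Conn) (l : MLabel) (qs : Finset Role) : Prop :=
  ∃ p qs₀, Realises D p l qs₀ ∧ qs ⊆ qs₀ ∧ p ∉ qs₀

/-- The invariant of protocols at runtime, for a list `ρ` of the roles of the enclosing loops. -/
def GOk (D : List Conn) : List (Finset Role) → Proto B → Prop
  | ρ, .com p l qs G => (Realises D p l qs ∧ qs.Nonempty ∧ p ∉ qs) ∧ NoSend D (insert p qs) G ∧
      GOk D ρ G
  | ρ, .choice p l qs G₁ G₂ => (Realises D p l qs ∧ qs.Nonempty ∧ p ∉ qs) ∧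
      (NoSend D (insert p qs) G₁ ∧ NoSend D (insert p qs) G₂) ∧
      Agree ρ (insert p qs) G₁ G₂ ∧ GOk D ρ G₁ ∧ GOk D ρ G₂
  | ρ, .mu G => G.Static ∧ (∀ i A, ρ[i]? = some A → (Proto.mu G).Occurs i → A ⊆ G.roles) ∧
      GOk D (G.roles :: ρ) G
  | ρ, .rvar i => i < ρ.length
  | _, .fin => True
  | ρ, .comR l _ qs G => (RealLabel D l qs ∧ qs.Nonempty) ∧ GOk D ρ G
  | ρ, .choiceR l v qs G₁ G₂ => (RealLabel D l qs ∧ qs.Nonempty ∧ (v = .inl ∨ v = .inr)) ∧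
      GOk D ρ G₁ ∧ GOk D ρ G₂

theorem NoSend.of_static {D : List Conn} {S : Finset Role} {G : Proto B} (h : G.Static) :
    NoSend D S G := by
  induction G with
  | com p l qs G ih => exact ih h
  | comR l v qs G ih => exact h.elim
  | choice p l qs G₁ G₂ ih₁ ih₂ => exact ⟨ih₁ h.1, ih₂ h.2⟩
  | choiceR l v qs G₁ G₂ ih₁ ih₂ => exact h.elim
  | mu G ih => exact ih h
  | rvar i => trivial
  | fin => trivial

theorem GOk.lt_of_occurs {D : List Conn} {ρ : List (Finset Role)} {G : Proto B} (h : GOk D ρ G)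
    {i : ℕ} (hi : G.Occurs i) : i < ρ.length := by
  induction G generalizing ρ i with
  | com p l qs G ih => exact ih h.2.2 hi
  | comR l v qs G ih => exact ih h.2 hi
  | choice p l qs G₁ G₂ ih₁ ih₂ => exact hi.elim (ih₁ h.2.2.2.1) (ih₂ h.2.2.2.2)
  | choiceR l v qs G₁ G₂ ih₁ ih₂ => exact hi.elim (ih₁ h.2.1) (ih₂ h.2.2)
  | mu G ih => simpa using ih h.2.2 hi
  | rvar j => cases hi; exact h
  | fin => exact hi.elim

theorem GOk.closed {D : List Conn} {G : Proto B} (h : GOk D [] G) (i : ℕ) : ¬ G.Occurs i :=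
  fun hi => by simpa using h.lt_of_occurs hi

theorem getElem?_append_of_some {α : Type*} {ρ ρ' : List α} {i : ℕ} {A : α}
    (h : ρ[i]? = some A) : (ρ ++ ρ')[i]? = some A := by
  rw [List.getElem?_append_left (List.getElem?_eq_some_iff.1 h).1, h]

theorem Agree.weaken {ρ ρ' : List (Finset Role)} {S : Finset Role} {G₁ G₂ : Proto B}
    (h : Agree ρ S G₁ G₂) (h₁ : ∀ i, G₁.Occurs i → i < ρ.length)
    (h₂ : ∀ i, G₂.Occurs i → i < ρ.length) : Agree (ρ ++ ρ') S G₁ G₂ := by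
  refine h.imp_right fun h => ⟨⟨h.1.1, h.1.2.1, fun i A hA hi => ?_⟩, h.2.1, h.2.2.1,
    fun i A hA hi => ?_⟩
  · exact h.1.2.2 i A (by rwa [List.getElem?_append_left (h₁ i hi)] at hA) hi
  · exact h.2.2.2 i A (by rwa [List.getElem?_append_left (h₂ i hi)] at hA) hi

theorem GOk.weaken {D : List Conn} {ρ ρ' : List (Finset Role)} {G : Proto B} (h : GOk D ρ G) :
    GOk D (ρ ++ ρ') G := by
  induction G generalizing ρ with
  | com p l qs G ih => exact ⟨h.1, h.2.1, ih h.2.2⟩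
  | comR l v qs G ih => exact ⟨h.1, ih h.2⟩
  | choice p l qs G₁ G₂ ih₁ ih₂ =>
    exact ⟨h.1, h.2.1, h.2.2.1.weaken (fun _ => h.2.2.2.1.lt_of_occurs)
      (fun _ => h.2.2.2.2.lt_of_occurs), ih₁ h.2.2.2.1, ih₂ h.2.2.2.2⟩
  | choiceR l v qs G₁ G₂ ih₁ ih₂ => exact ⟨h.1, ih₁ h.2.1, ih₂ h.2.2⟩
  | mu G ih =>
    refine ⟨h.1, fun i A hA hi => ?_, ih h.2.2⟩
    have := h.lt_of_occurs hi
    exact h.2.1 i A (by rwa [List.getElem?_append_left this] at hA) hi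
  | rvar i => simp only [GOk, List.length_append] at h ⊢; omega
  | fin => trivial

theorem Confined.subst {ρ : List (Finset Role)} {S : Finset Role} {G K : Proto B}
    (hK : ∀ i, ¬ K.Occurs i) (hKs : K.Static) (hG : ∀ i, G.Occurs i → i ≤ ρ.length)
    (h : Confined (ρ ++ [K.roles]) S G) : Confined ρ S (Proto.subst K ρ.length G) := by
  refine ⟨Proto.static_subst hK hKs h.1, fun s hs => ?_, fun i A hA hi => ?_⟩
  · rcases (Proto.mem_roles_subst hK).1 hs with hs | ⟨ho, hs⟩
    · exact h.2.1 hs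
    · exact h.2.2 ρ.length K.roles (by simp) ho hs
  · have := Proto.occurs_subst hK hG hi
    exact h.2.2 i A (getElem?_append_of_some hA) this.2

theorem GOk.subst {D : List Conn} {ρ : List (Finset Role)} {G K : Proto B} (hK : GOk D [] K)
    (hKs : K.Static) (hGs : G.Static) (h : GOk D (ρ ++ [K.roles]) G) :
    GOk D ρ (Proto.subst K ρ.length G) := by
  have hle : ∀ {ρ : List (Finset Role)} {G : Proto B}, GOk D (ρ ++ [K.roles]) G →
      ∀ i, G.Occurs i → i ≤ ρ.length := fun h i hi => by
    have := h.lt_of_occurs hi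
    simp only [List.length_append, List.length_singleton] at this
    omega
  induction G generalizing ρ with
  | com p l qs G ih =>
    exact ⟨h.1, .of_static (Proto.static_subst hK.closed hKs hGs), ih hGs h.2.2⟩
  | comR l v qs G ih => exact hGs.elim
  | choice p l qs G₁ G₂ ih₁ ih₂ =>
    refine ⟨h.1, ⟨.of_static (Proto.static_subst hK.closed hKs hGs.1),
      .of_static (Proto.static_subst hK.closed hKs hGs.2)⟩, ?_, ih₁ hGs.1 h.2.2.2.1,
      ih₂ hGs.2 h.2.2.2.2⟩
    rcases h.2.2.1 with ⟨H, h₁, h₂⟩ | ⟨h₁, h₂⟩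
    · exact .inl ⟨_, h₁.subst, h₂.subst⟩
    · exact .inr ⟨h₁.subst hK.closed hKs (hle h.2.2.2.1),
        h₂.subst hK.closed hKs (hle h.2.2.2.2)⟩
  | choiceR l v qs G₁ G₂ ih₁ ih₂ => exact hGs.elim
  | mu G ih =>
    have hr : (Proto.subst K (ρ.length + 1) G).roles = G.roles := by
      ext s
      rw [Proto.mem_roles_subst hK.closed]
      refine ⟨?_, .inl⟩
      rintro (hs | ⟨ho, hs⟩)
      · exact hs
      · exact h.2.1 ρ.length K.roles (by simp) ho hs
    have hm := hle h
    simp only [Proto.subst, Proto.lift_of_closed fun i _ => hK.closed i]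
    refine ⟨Proto.static_subst hK.closed hKs hGs, fun i A hA hi => ?_, ?_⟩
    · rw [hr]
      have := Proto.occurs_subst (G := .mu G) (k := ρ.length) (i := i) hK.closed hm
        (by simpa only [Proto.subst, Proto.lift_of_closed fun i _ => hK.closed i] using hi)
      exact h.2.1 i A (getElem?_append_of_some hA) this.2
    · rw [hr]
      exact ih (ρ := G.roles :: ρ) hGs h.2.2
  | rvar i =>
    simp only [Proto.subst]
    simp only [GOk, List.length_append, List.length_singleton] at h
    split_ifs with h₁ h₂
    · exact h₁
    · simpa using hK.weaken (ρ' := ρ)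
    · omega
  | fin => trivial

theorem GOk.unfold {D : List Conn} {G : Proto B} (h : GOk D [] (.mu G)) :
    GOk D [] (Proto.subst (.mu G) 0 G) :=
  GOk.subst (ρ := []) h h.1 h.1 h.2.2

theorem GOk.roles_unfold {D : List Conn} {G : Proto B} (h : GOk D [] (.mu G)) :
    (Proto.subst (.mu G) 0 G).roles = G.roles := by
  ext s
  rw [Proto.mem_roles_subst h.closed]
  simp only [Proto.roles]
  tauto

/-! ## Transitions of protocols -/

theorem GStep.role_mem {D : List Conn} {G G' : Proto B} {a : GAct B} (h : GStep G a G')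
    (hG : GOk D [] G) : a.role ∈ G.roles := by
  induction h with
  | sVal => simp [GAct.role, Proto.roles]
  | sChoice => simp [GAct.role, Proto.roles]
  | rVal => simp [GAct.role, Proto.roles]
  | rVal2 => simp [GAct.role, Proto.roles]
  | rChoice => simp [GAct.role, Proto.roles]
  | rChoice2L => simp [GAct.role, Proto.roles]
  | rChoice2R => simp [GAct.role, Proto.roles]
  | unfold _ ih => rw [Proto.roles, ← hG.roles_unfold]; exact ih hG.unfold
  | conc1 _ _ _ ih => simp [Proto.roles, ih hG.2.2]
  | conc2 _ _ _ _ ih₁ ih₂ => simp [Proto.roles, ih₁ hG.2.2.2.1]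
  | conc3 _ _ ih => simp [Proto.roles, ih hG.2]
  | conc4 _ _ ih => simp [Proto.roles, ih hG.2.1]
  | conc5 _ _ ih => simp [Proto.roles, ih hG.2.2]

theorem eq_of_insert_eq_insert {α : Type*} [DecidableEq α] {a : α} {s t : Finset α}
    (hs : a ∉ s) (ht : a ∉ t) (h : insert a s = insert a t) : s = t := by
  rw [← Finset.erase_insert hs, h, Finset.erase_insert ht]

theorem insert_ne_singleton {α : Type*} [DecidableEq α] {a : α} {s : Finset α}
    (hs : a ∉ s) (hne : s.Nonempty) : insert a s ≠ {a} := by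
  intro h
  have := eq_of_insert_eq_insert (t := ∅) hs (by simp) (by simpa using h)
  simp [this] at hne

theorem GStep.deterministic {G G' G'' : Proto B} {a : GAct B} (h : GStep G a G')
    (h' : GStep G a G'') : G' = G'' := by
  induction h generalizing G'' with
  | sVal =>
    cases h' with
    | sVal => rfl
    | conc1 _ hp => exact (hp rfl).elim
  | sChoice =>
    cases h' with
    | sChoice => rfl
    | conc2 _ _ hp => exact (hp rfl).elim
  | @rVal l v qs q G hq hne =>
    generalize hr : insert q qs = rs at h'
    cases h' with
    | rVal hq' => rw [eq_of_insert_eq_insert hq hq' hr]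
    | rVal2 => exact (insert_ne_singleton hq hne hr).elim
    | conc3 _ h => exact (h (by simp [← hr, GAct.role])).elim
  | @rVal2 l v q G =>
    generalize hr : ({q} : Finset Role) = rs at h'
    cases h' with
    | rVal hq' hne => exact (insert_ne_singleton hq' hne hr.symm).elim
    | rVal2 => rfl
    | conc3 _ h => exact (h (by simp [← hr, GAct.role])).elim
  | @rChoice l v qs q G₁ G₂ hq hne =>
    generalize hr : insert q qs = rs at h'
    cases h' with
    | rChoice hq' => rw [eq_of_insert_eq_insert hq hq' hr]
    | rChoice2L => exact (insert_ne_singleton hq hne hr).elim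
    | rChoice2R => exact (insert_ne_singleton hq hne hr).elim
    | conc4 _ h => exact (h (by simp [← hr, GAct.role])).elim
    | conc5 _ h => exact (h (by simp [← hr, GAct.role])).elim
  | @rChoice2L l q G₁ G₂ =>
    generalize hr : ({q} : Finset Role) = rs at h'
    cases h' with
    | rChoice hq' hne => exact (insert_ne_singleton hq' hne hr.symm).elim
    | rChoice2L => rfl
    | conc4 _ h => exact (h (by simp [← hr, GAct.role])).elim
  | @rChoice2R l q G₁ G₂ =>
    generalize hr : ({q} : Finset Role) = rs at h'
    cases h' with
    | rChoice hq' hne => exact (insert_ne_singleton hq' hne hr.symm).elim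
    | rChoice2R => rfl
    | conc5 _ h => exact (h (by simp [← hr, GAct.role])).elim
  | unfold _ ih =>
    cases h' with
    | unfold h' => exact ih h'
  | conc1 _ hp hq ih =>
    cases h' with
    | sVal => exact (hp rfl).elim
    | conc1 h' => rw [ih h']
  | conc2 _ _ hp hq ih₁ ih₂ =>
    cases h' with
    | sChoice => exact (hp rfl).elim
    | conc2 h₁ h₂ => rw [ih₁ h₁, ih₂ h₂]
  | conc3 _ hq ih =>
    cases h' with
    | rVal => exact (hq (by simp [GAct.role])).elim
    | rVal2 => exact (hq (by simp [GAct.role])).elim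
    | conc3 h' => rw [ih h']
  | conc4 _ hq ih =>
    cases h' with
    | rChoice => exact (hq (by simp [GAct.role])).elim
    | rChoice2L => exact (hq (by simp [GAct.role])).elim
    | conc4 h' => rw [ih h']
  | conc5 _ hq ih =>
    cases h' with
    | rChoice => exact (hq (by simp [GAct.role])).elim
    | rChoice2R => exact (hq (by simp [GAct.role])).elim
    | conc5 h' => rw [ih h']

theorem Tree.step {S : Finset Role} {H G G' : Proto B} {a : GAct B} (h : Tree S H G)
    (ha : a.role ∉ S) (hs : GStep G a G') : ∃ H', GStep H a H' ∧ Tree S H' G' := by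
  induction h generalizing G' with
  | leaf => exact ⟨_, hs, .leaf⟩
  | com hp hq _ ih =>
    cases hs with
    | sVal => exact (ha hp).elim
    | conc1 hs _ _ =>
      obtain ⟨H', hH, hT⟩ := ih hs
      exact ⟨H', hH, .com hp hq hT⟩
  | choice hp hq _ _ ih₁ ih₂ =>
    cases hs with
    | sChoice => exact (ha hp).elim
    | conc2 hs₁ hs₂ _ _ =>
      obtain ⟨H', hH, hT⟩ := ih₁ hs₁
      obtain ⟨H'', hH', hT'⟩ := ih₂ hs₂
      cases hH.deterministic hH'
      exact ⟨H', hH, .choice hp hq hT hT'⟩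

theorem Agree.step {D : List Conn} {S : Finset Role} {G₁ G₁' G₂ G₂' : Proto B} {a : GAct B}
    (h : Agree [] S G₁ G₂) (hG₁ : GOk D [] G₁) (ha : a.role ∉ S) (h₁ : GStep G₁ a G₁')
    (h₂ : GStep G₂ a G₂') : ∃ H H', GStep H a H' ∧ Tree S H G₁ ∧ Tree S H G₂ ∧ Tree S H' G₁' ∧
      Tree S H' G₂' := by
  rcases h with ⟨H, hT₁, hT₂⟩ | ⟨hC, -⟩
  · obtain ⟨H', hH, hT⟩ := hT₁.step ha h₁
    obtain ⟨H'', hH', hT'⟩ := hT₂.step ha h₂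
    cases hH.deterministic hH'
    exact ⟨H, H', hH, hT₁, hT₂, hT, hT'⟩
  · exact (ha (hC.2.1 (h₁.role_mem hG₁))).elim

theorem Realises.sender_eq {D : List Conn} {p : Role} {l : MLabel} {qs : Finset Role} {b : Conn}
    (h : Realises D p l qs) (hb : b ∈ D) (hl : b.label = l) : b.sender = p ∧ b.receiver ∈ qs := by
  obtain ⟨z, w, h⟩ := h
  obtain ⟨q, hq, rfl⟩ := (h b).1 ⟨hb, hl⟩
  exact ⟨rfl, hq⟩

theorem Realises.exists_conn {D : List Conn} {p q : Role} {l : MLabel} {qs : Finset Role}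
    (h : Realises D p l qs) (hq : q ∈ qs) :
    ∃ b ∈ D, b.label = l ∧ b.sender = p ∧ b.receiver = q := by
  obtain ⟨z, w, h⟩ := h
  obtain ⟨h₁, h₂⟩ := (h _).2 ⟨q, hq, rfl⟩
  exact ⟨_, h₁, h₂, rfl, rfl⟩

theorem Realises.eq_of_receiver {D : List Conn} {p : Role} {l : MLabel} {qs : Finset Role}
    {b b' : Conn} (h : Realises D p l qs) (hb : b ∈ D) (hl : b.label = l) (hb' : b' ∈ D)
    (hl' : b'.label = l) (hr : b.receiver = b'.receiver) : b = b' := by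
  obtain ⟨z, w, h⟩ := h
  obtain ⟨q, hq, rfl⟩ := (h b).1 ⟨hb, hl⟩
  obtain ⟨q', hq', rfl⟩ := (h b').1 ⟨hb', hl'⟩
  cases hr
  rfl

theorem NoSend.step {D : List Conn} {S : Finset Role} {G G' : Proto B} {a : GAct B}
    (h : GStep G a G') (hG : GOk D [] G) (ha : a.role ∉ S) (hN : NoSend D S G) :
    NoSend D S G' := by
  induction h with
  | sVal => exact ⟨fun b hb hl => by rwa [(hG.1.1.sender_eq hb hl).1], hN⟩
  | sChoice => exact ⟨fun b hb hl => by rwa [(hG.1.1.sender_eq hb hl).1], hN⟩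
  | rVal => exact hN
  | rVal2 => exact hN.2
  | rChoice => exact hN
  | rChoice2L => exact hN.2.1
  | rChoice2R => exact hN.2.2
  | unfold _ ih =>
    exact ih hG.unfold ha (.of_static (Proto.static_subst hG.closed hG.1 hG.1))
  | conc1 _ _ _ ih => exact ih hG.2.2 ha hN
  | conc2 _ _ _ _ ih₁ ih₂ => exact ⟨ih₁ hG.2.2.2.1 ha hN.1, ih₂ hG.2.2.2.2 ha hN.2⟩
  | conc3 _ _ ih => exact ⟨hN.1, ih hG.2 ha hN.2⟩
  | conc4 _ _ ih => exact ⟨hN.1, ih hG.2.1 ha hN.2.1, hN.2.2⟩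
  | conc5 _ _ ih => exact ⟨hN.1, hN.2.1, ih hG.2.2 ha hN.2.2⟩

theorem GOk.step {D : List Conn} {G G' : Proto B} {a : GAct B} (h : GStep G a G')
    (hG : GOk D [] G) : GOk D [] G' := by
  induction h with
  | sVal => exact ⟨⟨⟨_, _, hG.1.1, subset_rfl, hG.1.2.2⟩, hG.1.2.1⟩, hG.2.2⟩
  | sChoice hv => exact ⟨⟨⟨_, _, hG.1.1, subset_rfl, hG.1.2.2⟩, hG.1.2.1, hv⟩, hG.2.2.2⟩
  | rVal hq hne =>
    obtain ⟨⟨⟨p, qs₀, h₁, h₂, h₃⟩, -⟩, h₅⟩ := hG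
    exact ⟨⟨⟨p, qs₀, h₁, (Finset.subset_insert _ _).trans h₂, h₃⟩, hne⟩, h₅⟩
  | rVal2 => exact hG.2
  | rChoice hq hne =>
    obtain ⟨⟨⟨p, qs₀, h₁, h₂, h₃⟩, -, h₄⟩, h₅⟩ := hG
    exact ⟨⟨⟨p, qs₀, h₁, (Finset.subset_insert _ _).trans h₂, h₃⟩, hne, h₄⟩, h₅⟩
  | rChoice2L => exact hG.2.1
  | rChoice2R => exact hG.2.2
  | unfold _ ih => exact ih hG.unfold
  | conc1 hs hp hq ih =>
    exact ⟨hG.1, .step hs hG.2.2 (by simp [hp, hq]) hG.2.1, ih hG.2.2⟩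
  | conc2 hs₁ hs₂ hp hq ih₁ ih₂ =>
    have ha : ∀ {p : Role} {qs : Finset Role} {r : Role}, r ≠ p → r ∉ qs → r ∉ insert p qs :=
      fun h h' => by simp [h, h']
    obtain ⟨H, H', -, -, -, hT₁, hT₂⟩ := hG.2.2.1.step hG.2.2.2.1 (ha hp hq) hs₁ hs₂
    exact ⟨hG.1, ⟨.step hs₁ hG.2.2.2.1 (ha hp hq) hG.2.1.1,
      .step hs₂ hG.2.2.2.2 (ha hp hq) hG.2.1.2⟩, .inl ⟨H', hT₁, hT₂⟩, ih₁ hG.2.2.2.1,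
      ih₂ hG.2.2.2.2⟩
  | conc3 _ _ ih => exact ⟨hG.1, ih hG.2⟩
  | conc4 _ _ ih => exact ⟨hG.1, ih hG.2.1, hG.2.2⟩
  | conc5 _ _ ih => exact ⟨hG.1, hG.2.1, ih hG.2.2⟩

theorem GStep.roles_subset {D : List Conn} {G G' : Proto B} {a : GAct B} (h : GStep G a G')
    (hG : GOk D [] G) : G'.roles ⊆ G.roles := by
  induction h with
  | sVal => simp [Proto.roles]
  | sChoice => simp [Proto.roles]
  | rVal => simp [Proto.roles]
  | rVal2 => simp [Proto.roles]
  | rChoice => simp [Proto.roles]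
  | rChoice2L => intro s hs; simp [Proto.roles, hs]
  | rChoice2R => intro s hs; simp [Proto.roles, hs]
  | unfold _ ih => rw [Proto.roles, ← hG.roles_unfold]; exact ih hG.unfold
  | conc1 _ _ _ ih =>
    exact Finset.insert_subset_insert _ (Finset.union_subset_union_right (ih hG.2.2))
  | conc2 _ _ _ _ ih₁ ih₂ =>
    exact Finset.insert_subset_insert _ (Finset.union_subset_union
      (Finset.union_subset_union_right (ih₁ hG.2.2.2.1)) (ih₂ hG.2.2.2.2))
  | conc3 _ _ ih => exact Finset.union_subset_union_right (ih hG.2)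
  | conc4 _ _ ih =>
    exact Finset.union_subset_union (Finset.union_subset_union_right (ih hG.2.1)) subset_rfl
  | conc5 _ _ ih => exact Finset.union_subset_union_right (ih hG.2.2)

/-! ## Encodings of protocols -/

section Encoding

variable {D : List Conn} {γ : Key → Port} {s : Role}

theorem EncG.liftVar {G : Proto B} {P : Proc B} (h : EncG D γ s G P) (c : ℕ) :
    P.liftVar c = P := by
  induction h generalizing c <;> simp_all [Proc.liftVar]

theorem EncG.substVal {G : Proto B} {P : Proc B} (h : EncG D γ s G P) (v : Val B) (c : ℕ) :
    P.substVal v c = P := by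
  induction h generalizing c with
  | comSend _ _ _ h ih | comRecv _ _ _ _ _ h ih | comRRecv _ _ _ _ h ih =>
    simp [Proc.substVal, h.liftVar, ih]
  | _ => simp_all [Proc.substVal]

theorem EncG.liftRec {G : Proto B} {P : Proc B} (h : EncG D γ s G P) {c : ℕ}
    (hc : ∀ i, c ≤ i → ¬ G.Occurs i) : P.liftRec c = P := by
  induction h generalizing c with
  | comSend _ _ _ h ih => simp only [Proc.liftRec, h.liftVar, ih hc]
  | comRecv _ _ _ _ _ h ih => simp only [Proc.liftRec, h.liftVar, ih hc]
  | comSkip _ _ _ ih => exact ih hc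
  | comRRecv _ _ _ _ h ih => simp only [Proc.liftRec, h.liftVar, ih hc]
  | comRSkip _ _ ih => exact ih hc
  | choiceSend _ _ _ _ _ ih₁ ih₂ =>
    simp only [Proto.Occurs, not_or] at hc
    simp only [Proc.liftRec, ih₁ fun i hi => (hc i hi).1, ih₂ fun i hi => (hc i hi).2]
  | choiceRecv _ _ _ _ _ _ _ ih₁ ih₂ =>
    simp only [Proto.Occurs, not_or] at hc
    simp only [Proc.liftRec, ih₁ fun i hi => (hc i hi).1, ih₂ fun i hi => (hc i hi).2]
  | choiceSkip _ _ _ _ ih₁ _ =>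
    simp only [Proto.Occurs, not_or] at hc
    exact ih₁ fun i hi => (hc i hi).1
  | choiceRRecv _ _ _ _ _ _ ih₁ ih₂ =>
    simp only [Proto.Occurs, not_or] at hc
    simp only [Proc.liftRec, ih₁ fun i hi => (hc i hi).1, ih₂ fun i hi => (hc i hi).2]
  | choiceRSkipL _ _ ih =>
    simp only [Proto.Occurs, not_or] at hc
    exact ih fun i hi => (hc i hi).1
  | choiceRSkipR _ _ ih =>
    simp only [Proto.Occurs, not_or] at hc
    exact ih fun i hi => (hc i hi).2
  | mu _ _ ih =>
    simp only [Proc.liftRec]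
    rw [ih]
    intro i hi
    obtain ⟨j, rfl⟩ : ∃ j, i = j + 1 := ⟨i - 1, by omega⟩
    exact hc j (by omega)
  | muSkip => rfl
  | @rvar i =>
    have : ¬ c ≤ i := fun h => hc i h rfl
    simp [Proc.liftRec, this]
  | fin => rfl

theorem EncG.subst {G K : Proto B} {P Q : Proc B} (hK : GOk D [] K)
    (hQ : EncG D γ s K Q) (h : EncG D γ s G P) {ρ : List (Finset Role)} (hGs : G.Static)
    (hG : GOk D (ρ ++ [K.roles]) G) :
    EncG D γ s (Proto.subst K ρ.length G) (Proc.substRec Q ρ.length 1 P) := by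
  induction h generalizing ρ with
  | comSend hb hl hs h ih =>
    simp only [Proc.substRec, h.liftVar, hQ.liftVar, Equiv.Perm.one_apply]
    have := ih hGs hG.2.2
    rw [← this.liftVar 0]
    exact .comSend hb hl hs this
  | comRecv hq hb hl hr hs h ih =>
    simp only [Proc.substRec, h.liftVar, hQ.liftVar, Equiv.Perm.one_apply]
    have := ih hGs hG.2.2
    rw [← this.liftVar 0]
    exact .comRecv hq hb hl hr hs this
  | comSkip hp hq _ ih => exact .comSkip hp hq (ih hGs hG.2.2)
  | comRRecv => exact hGs.elim
  | comRSkip => exact hGs.elim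
  | choiceSend hb hl hs _ _ ih₁ ih₂ =>
    simp only [Proc.substRec, Equiv.Perm.one_apply]
    exact .choiceSend hb hl hs (ih₁ hGs.1 hG.2.2.2.1) (ih₂ hGs.2 hG.2.2.2.2)
  | choiceRecv hq hb hl hr hs _ _ ih₁ ih₂ =>
    simp only [Proc.substRec, Equiv.Perm.one_apply]
    exact .choiceRecv hq hb hl hr hs (ih₁ hGs.1 hG.2.2.2.1) (ih₂ hGs.2 hG.2.2.2.2)
  | choiceSkip hp hq _ _ ih₁ ih₂ =>
    exact .choiceSkip hp hq (ih₁ hGs.1 hG.2.2.2.1) (ih₂ hGs.2 hG.2.2.2.2)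
  | choiceRRecv => exact hGs.elim
  | choiceRSkipL => exact hGs.elim
  | choiceRSkipR => exact hGs.elim
  | @mu G P hr _ ih =>
    simp only [Proto.subst, Proc.substRec, Proto.lift_of_closed fun i _ => hK.closed i,
      hQ.liftRec fun i _ => hK.closed i]
    exact .mu ((Proto.mem_roles_subst hK.closed).2 (.inl hr)) (ih (ρ := G.roles :: ρ) hGs hG.2.2)
  | @muSkip G hr =>
    simp only [Proto.subst, Proc.substRec, Proto.lift_of_closed fun i _ => hK.closed i]
    refine .muSkip fun hs => hr ?_
    rcases (Proto.mem_roles_subst hK.closed).1 hs with hs | ⟨ho, hs⟩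
    · exact hs
    · exact hG.2.1 ρ.length K.roles (by simp) ho hs
  | @rvar i =>
    simp only [Proto.subst, Proc.substRec]
    split_ifs
    · exact .rvar
    · exact hQ
    · exact .rvar
  | fin => exact .fin

theorem EncG.unfold {G : Proto B} {P : Proc B} (hG : GOk D [] (.mu G)) (hs : s ∈ G.roles)
    (h : EncG D γ s G P) : EncG D γ s (Proto.subst (.mu G) 0 G) P.unfold :=
  EncG.subst (ρ := []) hG (.mu hs h) h hG.1 hG.2.2

theorem EncG.nil_of_notMem {ρ : List (Finset Role)} {G : Proto B} (hG : GOk D ρ G)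
    (hc : ∀ i, ¬ G.Occurs i) (hs : s ∉ G.roles) : EncG D γ s G .nil := by
  induction G generalizing ρ with
  | com p l qs G ih =>
    simp only [Proto.roles, Finset.mem_insert, Finset.mem_union, not_or] at hs
    exact .comSkip hs.1 hs.2.1 (ih hG.2.2 hc hs.2.2)
  | comR l v qs G ih =>
    simp only [Proto.roles, Finset.mem_union, not_or] at hs
    exact .comRSkip hs.1 (ih hG.2 hc hs.2)
  | choice p l qs G₁ G₂ ih₁ ih₂ =>
    simp only [Proto.roles, Finset.mem_insert, Finset.mem_union, not_or] at hs
    simp only [Proto.Occurs, not_or] at hc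
    exact .choiceSkip hs.1 hs.2.1.1 (ih₁ hG.2.2.2.1 (fun i => (hc i).1) hs.2.1.2)
      (ih₂ hG.2.2.2.2 (fun i => (hc i).2) hs.2.2)
  | choiceR l v qs G₁ G₂ ih₁ ih₂ =>
    simp only [Proto.roles, Finset.mem_union, not_or] at hs
    simp only [Proto.Occurs, not_or] at hc
    rcases hG.1.2.2 with rfl | rfl
    · exact .choiceRSkipL hs.1.1 (ih₁ hG.2.1 (fun i => (hc i).1) hs.1.2)
    · exact .choiceRSkipR hs.1.1 (ih₂ hG.2.2 (fun i => (hc i).2) hs.2)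
  | mu G ih => exact .muSkip hs
  | rvar i => exact (hc i rfl).elim
  | fin => exact .fin

theorem Tree.encG_iff {S : Finset Role} {H G : Proto B} {P : Proc B} (h : Tree S H G)
    (hs : s ∉ S) : EncG D γ s G P ↔ EncG D γ s H P := by
  induction h with
  | leaf => rfl
  | com hp hq _ ih =>
    rw [← ih]
    refine ⟨fun h => ?_, .comSkip (fun h => hs (h ▸ hp)) fun h => hs (hq h)⟩
    cases h with
    | comSend => exact (hs hp).elim
    | comRecv h => exact (hs (hq h)).elim
    | comSkip _ _ h => exact h
  | choice hp hq _ _ ih₁ ih₂ =>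
    refine ⟨fun h => ?_, fun h =>
      .choiceSkip (fun h => hs (h ▸ hp)) (fun h => hs (hq h)) (ih₁.2 h) (ih₂.2 h)⟩
    cases h with
    | choiceSend => exact (hs hp).elim
    | choiceRecv h => exact (hs (hq h)).elim
    | choiceSkip _ _ h _ => exact ih₁.1 h

/-! ## Unfolding of loops -/

/-- `Unf P Q`: the process `Q` results from `P` by unfolding loops. -/
inductive Unf : Proc B → Proc B → Prop
  | refl {P} : Unf P P
  | unfold {P Q} (h : Unf P.unfold Q) : Unf (.mu P) Q
  | inp {z P Q} (hc : SCong P Q) (h : ∀ v, Unf (P.substVal v 0) (Q.substVal v 0)) :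
      Unf (.inp z P) (.inp z Q)
  | out {z o P Q} (h : Unf P Q) : Unf (.out z o P) (.out z o Q)
  | branch {z P P' Q Q'} (h₁ : Unf P P') (h₂ : Unf Q Q') : Unf (.branch z P Q) (.branch z P' Q')

theorem Unf.scong {P Q : Proc B} (h : Unf P Q) : SCong P Q := by
  induction h with
  | refl => exact .refl
  | unfold _ ih => exact .trans .unfold ih
  | inp hc _ _ => exact .inp hc
  | out _ ih => exact .out ih
  | branch _ _ ih₁ ih₂ => exact .branch ih₁ ih₂

theorem Unf.trans {P Q R : Proc B} (h : Unf P Q) (h' : Unf Q R) : Unf P R := by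
  induction h generalizing R with
  | refl => exact h'
  | unfold _ ih => exact .unfold (ih h')
  | inp hc h ih =>
    cases h' with
    | refl => exact .inp hc h
    | inp hc' h' => exact .inp (hc.trans hc') fun v => ih v (h' v)
  | out h ih =>
    cases h' with
    | refl => exact .out h
    | out h' => exact .out (ih h')
  | branch h₁ h₂ ih₁ ih₂ =>
    cases h' with
    | refl => exact .branch h₁ h₂
    | branch h₁' h₂' => exact .branch (ih₁ h₁') (ih₂ h₂')

theorem Unf.step {P P' Q : Proc B} {lam : PLab B} (h : Unf P Q) (hs : PStep P lam P') :
    ∃ Q', PStep Q lam Q' ∧ Unf P' Q' := by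
  induction h generalizing P' with
  | refl => exact ⟨_, hs, .refl⟩
  | unfold _ ih =>
    cases hs with
    | unfold hs => exact ih hs
  | inp hc h _ =>
    cases hs with
    | inp => exact ⟨_, .inp, h _⟩
  | out h _ =>
    cases hs with
    | out => exact ⟨_, .out, h⟩
  | branch h₁ h₂ _ _ =>
    cases hs with
    | choL => exact ⟨_, .choL, h₁⟩
    | choR => exact ⟨_, .choR, h₂⟩

theorem Unf.exists_out {P Q : Proc B} {z : Port} {v : Val B} (h : Unf P (.out z (.val v) Q)) :
    ∃ P', PStep P (.prim (.out z v)) P' ∧ Unf P' Q := by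
  generalize hR : Proc.out z (.val v) Q = R at h
  induction h with
  | refl => subst hR; exact ⟨_, .out, .refl⟩
  | unfold _ ih =>
    obtain ⟨P', h₁, h₂⟩ := ih hR
    exact ⟨P', .unfold h₁, h₂⟩
  | inp => cases hR
  | out h _ => cases hR; exact ⟨_, .out, h⟩
  | branch => cases hR

/-- The encoding of a protocol for a role is only unfolded by the actions of other roles. -/
theorem EncG.step_of_ne {G G' : Proto B} {a : GAct B} {P : Proc B} (h : EncG D γ s G P)
    (hG : GOk D [] G) (hs : GStep G a G') (ha : a.role ≠ s) :
    ∃ P', EncG D γ s G' P' ∧ Unf P P' := by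
  induction hs generalizing P with
  | sVal =>
    cases h with
    | comSend => exact (ha rfl).elim
    | comRecv hq hb hl hr _ h => exact ⟨_, .comRRecv hq hb hl hr h, .refl⟩
    | comSkip _ hq h => exact ⟨_, .comRSkip hq h, .refl⟩
  | sChoice hv =>
    cases h with
    | choiceSend => exact (ha rfl).elim
    | choiceRecv hq hb hl hr _ h₁ h₂ => exact ⟨_, .choiceRRecv hq hb hl hr h₁ h₂, .refl⟩
    | choiceSkip _ hq h₁ h₂ =>
      rcases hv with rfl | rfl
      · exact ⟨_, .choiceRSkipL hq h₁, .refl⟩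
      · exact ⟨_, .choiceRSkipR hq h₂, .refl⟩
  | rVal hq hne =>
    cases h with
    | comRRecv hq hb hl hr h =>
      exact ⟨_, .comRRecv (Finset.mem_of_mem_insert_of_ne hq (Ne.symm ha)) hb hl hr h, .refl⟩
    | comRSkip hq h => exact ⟨_, .comRSkip (fun h => hq (Finset.mem_insert_of_mem h)) h, .refl⟩
  | rVal2 =>
    cases h with
    | comRRecv hq hb hl hr h => exact (ha (Finset.mem_singleton.1 hq).symm).elim
    | comRSkip hq h => exact ⟨_, h, .refl⟩
  | rChoice hq hne =>
    cases h with
    | choiceRRecv hq hb hl hr h₁ h₂ =>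
      exact ⟨_, .choiceRRecv (Finset.mem_of_mem_insert_of_ne hq (Ne.symm ha)) hb hl hr h₁ h₂,
        .refl⟩
    | choiceRSkipL hq h =>
      exact ⟨_, .choiceRSkipL (fun h => hq (Finset.mem_insert_of_mem h)) h, .refl⟩
    | choiceRSkipR hq h =>
      exact ⟨_, .choiceRSkipR (fun h => hq (Finset.mem_insert_of_mem h)) h, .refl⟩
  | rChoice2L =>
    cases h with
    | choiceRRecv hq => exact (ha (Finset.mem_singleton.1 hq).symm).elim
    | choiceRSkipL hq h => exact ⟨_, h, .refl⟩
  | rChoice2R =>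
    cases h with
    | choiceRRecv hq => exact (ha (Finset.mem_singleton.1 hq).symm).elim
    | choiceRSkipR hq h => exact ⟨_, h, .refl⟩
  | unfold hs ih =>
    cases h with
    | mu hr h =>
      obtain ⟨P', h₁, h₂⟩ := ih (h.unfold hG hr) hG.unfold ha
      exact ⟨P', h₁, .unfold h₂⟩
    | muSkip hr =>
      have hG' := GOk.step hs hG.unfold
      refine ⟨_, .nil_of_notMem hG' hG'.closed fun h => hr ?_, .refl⟩
      rw [← hG.roles_unfold]
      exact hs.roles_subset hG.unfold h
  | conc1 _ _ _ ih =>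
    cases h with
    | comSend hb hl hs h =>
      obtain ⟨P', h₁, h₂⟩ := ih h hG.2.2 ha
      refine ⟨_, .comSend hb hl hs h₁, ?_⟩
      rw [h.liftVar, h₁.liftVar]
      exact .inp (.out h₂.scong) fun v => by
        simp only [Proc.substVal, h.substVal, h₁.substVal]; exact .out h₂
    | comRecv hq hb hl hr hs h =>
      obtain ⟨P', h₁, h₂⟩ := ih h hG.2.2 ha
      refine ⟨_, .comRecv hq hb hl hr hs h₁, ?_⟩
      rw [h.liftVar, h₁.liftVar]
      exact .inp (.out h₂.scong) fun v => by
        simp only [Proc.substVal, h.substVal, h₁.substVal]; exact .out h₂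
    | comSkip hp hq h =>
      obtain ⟨P', h₁, h₂⟩ := ih h hG.2.2 ha
      exact ⟨_, .comSkip hp hq h₁, h₂⟩
  | @conc2 p' l qs' _ _ _ _ a hs₁ hs₂ hp hq ih₁ ih₂ =>
    cases h with
    | choiceSend hb hl hs h₁ h₂ =>
      obtain ⟨P', h₁, h₁'⟩ := ih₁ h₁ hG.2.2.2.1 ha
      obtain ⟨P'', h₂, h₂'⟩ := ih₂ h₂ hG.2.2.2.2 ha
      exact ⟨_, .choiceSend hb hl hs h₁ h₂, .branch (.out h₁') (.out h₂')⟩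
    | choiceRecv hq hb hl hr hs h₁ h₂ =>
      obtain ⟨P', h₁, h₁'⟩ := ih₁ h₁ hG.2.2.2.1 ha
      obtain ⟨P'', h₂, h₂'⟩ := ih₂ h₂ hG.2.2.2.2 ha
      exact ⟨_, .choiceRecv hq hb hl hr hs h₁ h₂, .branch (.out h₁') (.out h₂')⟩
    | choiceSkip hp' hq' h₁ h₂ =>
      obtain ⟨H, H', hH, -, -, hT₁, hT₂⟩ :=
        hG.2.2.1.step hG.2.2.2.1 (by simp [hp, hq]) hs₁ hs₂
      obtain ⟨P', h₁, h₁'⟩ := ih₁ h₁ hG.2.2.2.1 ha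
      have hsS : s ∉ (insert p' qs' : Finset Role) := by simp [hp', hq']
      exact ⟨P', .choiceSkip hp' hq' h₁ ((hT₂.encG_iff hsS).2 ((hT₁.encG_iff hsS).1 h₁)), h₁'⟩
  | conc3 _ _ ih =>
    cases h with
    | comRRecv hq hb hl hr h =>
      obtain ⟨P', h₁, h₂⟩ := ih h hG.2 ha
      refine ⟨_, .comRRecv hq hb hl hr h₁, ?_⟩
      rw [h.liftVar, h₁.liftVar]
      exact .inp (.out h₂.scong) fun v => by
        simp only [Proc.substVal, h.substVal, h₁.substVal]; exact .out h₂
    | comRSkip hq h =>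
      obtain ⟨P', h₁, h₂⟩ := ih h hG.2 ha
      exact ⟨_, .comRSkip hq h₁, h₂⟩
  | conc4 _ _ ih =>
    cases h with
    | choiceRRecv hq hb hl hr h₁ h₂ =>
      obtain ⟨P', h₁, h₁'⟩ := ih h₁ hG.2.1 ha
      exact ⟨_, .choiceRRecv hq hb hl hr h₁ h₂, .branch (.out h₁') .refl⟩
    | choiceRSkipL hq h =>
      obtain ⟨P', h₁, h₂⟩ := ih h hG.2.1 ha
      exact ⟨_, .choiceRSkipL hq h₁, h₂⟩
  | conc5 _ _ ih =>
    cases h with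
    | choiceRRecv hq hb hl hr h₁ h₂ =>
      obtain ⟨P', h₂, h₂'⟩ := ih h₂ hG.2.2 ha
      exact ⟨_, .choiceRRecv hq hb hl hr h₁ h₂, .branch .refl (.out h₂')⟩
    | choiceRSkipR hq h =>
      obtain ⟨P', h₁, h₂⟩ := ih h hG.2.2 ha
      exact ⟨_, .choiceRSkipR hq h₁, h₂⟩

end Encoding

/-! ## Values in transit -/

/-- The values in transit in a protocol to the role `q` with the label `l`. -/
def fillv (q : Role) (l : MLabel) : Proto B → List (Val B)
  | .com _ _ _ G => fillv q l G
  | .choice _ _ _ G _ => fillv q l G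
  | .mu G => fillv q l G
  | .rvar _ => []
  | .fin => []
  | .comR l' v qs G => (if l' = l ∧ q ∈ qs then [v] else []) ++ fillv q l G
  | .choiceR l' .inl qs G _ => (if l' = l ∧ q ∈ qs then [.inl] else []) ++ fillv q l G
  | .choiceR l' .inr qs _ G => (if l' = l ∧ q ∈ qs then [.inr] else []) ++ fillv q l G
  | .choiceR _ (.base _) _ _ _ => []

theorem fillv_of_static {q : Role} {l : MLabel} {G : Proto B} (h : G.Static) :
    fillv q l G = [] := by
  induction G with
  | com p l qs G ih => exact ih h
  | comR l v qs G ih => exact h.elim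
  | choice p l qs G₁ G₂ ih₁ ih₂ => exact ih₁ h.1
  | choiceR l v qs G₁ G₂ ih₁ ih₂ => exact h.elim
  | mu G ih => exact ih h
  | rvar i => rfl
  | fin => rfl

theorem Tree.fillv_eq {S : Finset Role} {H G : Proto B} (h : Tree S H G) (q : Role) (l : MLabel) :
    fillv q l G = fillv q l H := by
  induction h with
  | leaf => rfl
  | com _ _ _ ih => exact ih
  | choice _ _ _ _ ih₁ _ => exact ih₁

theorem Agree.fillv_eq {ρ : List (Finset Role)} {S : Finset Role} {G₁ G₂ : Proto B}
    (h : Agree ρ S G₁ G₂) (q : Role) (l : MLabel) : fillv q l G₁ = fillv q l G₂ := by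
  rcases h with ⟨H, h₁, h₂⟩ | ⟨h₁, h₂⟩
  · rw [h₁.fillv_eq, h₂.fillv_eq]
  · rw [fillv_of_static h₁.1, fillv_of_static h₂.1]

theorem NoSend.fillv_eq {D : List Conn} {S : Finset Role} {G : Proto B} (h : NoSend D S G)
    {b : Conn} (hb : b ∈ D) (hs : b.sender ∈ S) (q : Role) : fillv q b.label G = [] := by
  induction G with
  | com p l qs G ih => exact ih h
  | comR l v qs G ih =>
    have : l ≠ b.label := fun hl => h.1 b hb hl.symm hs
    simp [fillv, this, ih h.2]
  | choice p l qs G₁ G₂ ih₁ ih₂ => exact ih₁ h.1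
  | choiceR l v qs G₁ G₂ ih₁ ih₂ =>
    have : l ≠ b.label := fun hl => h.1 b hb hl.symm hs
    cases v <;> simp [fillv, this, ih₁ h.2.1, ih₂ h.2.2]
  | mu G ih => exact ih h
  | rvar i => rfl
  | fin => rfl

theorem GStep.fillv_send {D : List Conn} {G G' : Proto B} {p : Role} {l : MLabel} {v : Val B}
    (h : GStep G (.send p l v) G') (hG : GOk D [] G) {b : Conn} (hb : b ∈ D) :
    fillv b.receiver b.label G' =
      fillv b.receiver b.label G ++ if b.label = l then [v] else [] := by
  generalize ha : GAct.send p l v = a at h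
  induction h with
  | sVal =>
    cases ha
    by_cases hl : b.label = l
    · obtain ⟨h₁, h₂⟩ := hG.1.1.sender_eq hb hl
      have := hG.2.1.fillv_eq hb (by simp [h₁]) b.receiver
      simp [fillv, hl, h₂] at this ⊢
      simp [this]
    · simp [fillv, hl, Ne.symm hl]
  | sChoice hv =>
    cases ha
    by_cases hl : b.label = l
    · obtain ⟨h₁, h₂⟩ := hG.1.1.sender_eq hb hl
      have h₃ := hG.2.1.1.fillv_eq hb (by simp [h₁]) b.receiver
      have h₄ := hG.2.1.2.fillv_eq hb (by simp [h₁]) b.receiver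
      rcases hv with rfl | rfl <;> simp_all [fillv]
    · have := hG.2.2.1.fillv_eq b.receiver b.label
      rcases hv with rfl | rfl <;> simp [fillv, hl, Ne.symm hl, this]
  | rVal => cases ha
  | rVal2 => cases ha
  | rChoice => cases ha
  | rChoice2L => cases ha
  | rChoice2R => cases ha
  | unfold _ ih =>
    rw [ih hG.unfold ha, fillv_of_static (G := .mu _) hG.1,
      fillv_of_static (Proto.static_subst hG.closed hG.1 hG.1)]
  | conc1 _ _ _ ih => exact ih hG.2.2 ha
  | conc2 _ _ _ _ ih₁ _ => exact ih₁ hG.2.2.2.1 ha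
  | conc3 _ _ ih => simp only [fillv, ih hG.2 ha, List.append_assoc]
  | conc4 _ _ ih => simp only [fillv, ih hG.2.1 ha, List.append_assoc]
  | conc5 _ _ ih => simp only [fillv, ih hG.2.2 ha, List.append_assoc]

theorem GStep.fillv_recv {D : List Conn} {G G' : Proto B} {q : Role} {l : MLabel} {v : Val B}
    (h : GStep G (.recv q l v) G') (hG : GOk D [] G) (q' : Role) (l' : MLabel) :
    fillv q' l' G = (if q' = q ∧ l' = l then [v] else []) ++ fillv q' l' G' := by
  generalize ha : GAct.recv q l v = a at h
  have key : ∀ (qs : Finset Role) (l'' : MLabel) (w : Val B) (X Y : List (Val B)), q ∉ qs →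
      X = (if q' = q ∧ l' = l then [v] else []) ++ Y →
      (if l'' = l' ∧ q' ∈ qs then [w] else []) ++ X =
        (if q' = q ∧ l' = l then [v] else []) ++ ((if l'' = l' ∧ q' ∈ qs then [w] else []) ++ Y) := by
    intro qs l'' w X Y hq hX
    by_cases hq' : q' = q
    · subst hq'; simp [hq, hX]
    · simp [hq', hX]
  have key' : ∀ (qs : Finset Role) (l : MLabel) (v : Val B), q ∉ qs →
      (if l = l' ∧ q' ∈ insert q qs then [v] else []) =
        (if q' = q ∧ l' = l then [v] else []) ++ (if l = l' ∧ q' ∈ qs then [v] else []) := by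
    intro qs l v hq
    by_cases hq' : q' = q
    · subst hq'
      by_cases hl : l' = l
      · subst hl; simp [hq]
      · simp [hl, Ne.symm hl]
    · simp [hq']
  induction h with
  | sVal => cases ha
  | sChoice => cases ha
  | rVal hq _ => cases ha; simp only [fillv, key' _ _ _ hq, List.append_assoc]
  | rVal2 => cases ha; simp [fillv, eq_comm, and_comm]
  | @rChoice _ v _ _ _ _ hq _ =>
    cases ha
    rcases hG.1.2.2 with rfl | rfl <;> simp only [fillv, key' _ _ _ hq, List.append_assoc]
  | rChoice2L => cases ha; simp [fillv, eq_comm, and_comm]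
  | rChoice2R => cases ha; simp [fillv, eq_comm, and_comm]
  | unfold _ ih =>
    have := ih hG.unfold ha
    rw [fillv_of_static (Proto.static_subst hG.closed hG.1 hG.1)] at this
    rw [← this, fillv_of_static (G := .mu _) hG.1]
  | conc1 _ _ _ ih => exact ih hG.2.2 ha
  | conc2 _ _ _ _ ih₁ _ => exact ih₁ hG.2.2.2.1 ha
  | conc3 _ hq ih => subst ha; exact key _ _ _ _ _ hq (ih hG.2 rfl)
  | conc4 _ hq ih => subst ha; exact key _ _ _ _ _ hq (ih hG.2.1 rfl)
  | conc5 _ hq ih => subst ha; exact key _ _ _ _ _ hq (ih hG.2.2 rfl)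

/-- The queue of a connection binder that holds the values `vs`. -/
def queueWith (γ : Key → Port) (b : Conn) (vs : List (Val B)) : LBinder B :=
  ⟨γ (.label b.receiver b.label), vs.map (Store.single (γ (.label b.sender b.label))), idFun,
    [γ (.label b.sender b.label)]⟩

theorem mem_waiting {γ : Key → Port} (hγ : Function.Injective γ) {l l' : MLabel} {q : Role}
    {qs : Finset Role} : γ (.label q l') ∈ waiting γ l qs ↔ q ∈ qs ∧ l' = l := by
  constructor
  · rintro ⟨q', hq', h⟩
    cases hγ h
    exact ⟨hq', rfl⟩
  · rintro ⟨h, rfl⟩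
    exact ⟨q, h, rfl⟩

theorem enqueue_queueWith {D : List Conn} {γ : Key → Port} (hγ : Function.Injective γ)
    {l : MLabel} {qs : Finset Role} {u' : Port} {v : Val B} {c : Conn → List (Val B)}
    (hu : ∀ b ∈ D, b.receiver ∈ qs → b.label = l → γ (.label b.sender b.label) = u') :
    enqueue (waiting γ l qs) u' v (D.map fun b => queueWith γ b (c b)) =
      D.map fun b => queueWith γ b
        (c b ++ if l = b.label ∧ b.receiver ∈ qs then [v] else []) := by
  simp only [enqueue, List.map_map]
  refine List.map_congr_left fun b hb => ?_
  simp only [Function.comp, queueWith, mem_waiting hγ]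
  by_cases h : b.receiver ∈ qs ∧ b.label = l
  · have h' : l = b.label ∧ b.receiver ∈ qs := ⟨h.2.symm, h.1⟩
    rw [if_pos h, if_pos h']
    simp [hu b hb h.1 h.2]
  · have h' : ¬ (l = b.label ∧ b.receiver ∈ qs) := fun h' => h ⟨h'.2, h'.1.symm⟩
    rw [if_neg h, if_neg h']
    simp

theorem served_queueWith {D : List Conn} {γ : Key → Port} (hγ : Function.Injective γ)
    {p : Role} {l : MLabel} {qs qs₀ : Finset Role} (h : Realises D p l qs₀) (hqs : qs ⊆ qs₀)
    (c : Conn → List (Val B)) :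
    Served (waiting γ l qs) (γ (.label p l)) (D.map fun b => queueWith γ b (c b)) := by
  refine ⟨?_, ?_⟩
  · rintro u ⟨q, hq, rfl⟩
    obtain ⟨b, hb, hl, -, hr⟩ := h.exists_conn (hqs hq)
    exact ⟨_, List.mem_map.2 ⟨b, hb, rfl⟩, by simp [queueWith, hl, hr]⟩
  · intro b hb hb'
    obtain ⟨d, hd, rfl⟩ := List.mem_map.1 hb
    obtain ⟨-, hl⟩ := (mem_waiting hγ).1 hb'
    simp [queueWith, hl, (h.sender_eq hd hl).1]

theorem Served.param_eq {D : List Conn} {γ : Key → Port} {l : MLabel} {qs : Finset Role}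
    {u' : Port} {c : Conn → List (Val B)}
    (h : Served (waiting γ l qs) u' (D.map fun b => queueWith γ b (c b))) :
    ∀ b ∈ D, b.receiver ∈ qs → b.label = l → γ (.label b.sender b.label) = u' := by
  intro b hb hr hl
  have := (h.2 _ (List.mem_map.2 ⟨b, hb, rfl⟩) ⟨b.receiver, hr, by simp [queueWith, hl]⟩).1
  simpa [queueWith] using this

theorem fill_iff {D : List Conn} {γ : Key → Port} (hγ : Function.Injective γ)
    {ρ : List (Finset Role)} {G : Proto B} (hG : GOk D ρ G) (c : Conn → List (Val B))
    (L : List (LBinder B)) :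
    Fill γ G (D.map fun b => queueWith γ b (c b)) L ↔
      L = D.map fun b => queueWith γ b (c b ++ fillv b.receiver b.label G) := by
  induction G generalizing ρ c with
  | com p l qs G ih =>
    simp only [fillv]
    rw [← ih hG.2.2]
    exact ⟨fun h => by cases h; assumption, .com⟩
  | comR l v qs G ih =>
    obtain ⟨⟨⟨p, qs₀, hR, hqs, -⟩, -⟩, hG⟩ := hG
    simp only [fillv, ← List.append_assoc]
    rw [← ih hG]
    constructor
    · intro h
      cases h with
      | comR hu h => rwa [enqueue_queueWith hγ hu.param_eq] at h
    · intro h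
      have hS := served_queueWith hγ hR hqs c
      exact .comR hS (by rwa [enqueue_queueWith hγ hS.param_eq])
  | choice p l qs G₁ G₂ ih₁ ih₂ =>
    have h₁ := ih₁ hG.2.2.2.1 c
    have h₂ := ih₂ hG.2.2.2.2 c
    simp only [← hG.2.2.1.fillv_eq] at h₂
    simp only [fillv]
    rw [← h₁]
    refine ⟨fun h => by cases h; assumption, fun h => .choice h (h₂.2 (h₁.1 h))⟩
  | choiceR l v qs G₁ G₂ ih₁ ih₂ =>
    obtain ⟨⟨⟨p, qs₀, hR, hqs, -⟩, -, hv⟩, hG₁, hG₂⟩ := hG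
    have hS := served_queueWith hγ hR hqs c
    rcases hv with rfl | rfl
    · simp only [fillv, ← List.append_assoc]
      rw [← ih₁ hG₁]
      constructor
      · intro h
        cases h with
        | choiceRL hu h => rwa [enqueue_queueWith hγ hu.param_eq] at h
      · intro h
        exact .choiceRL hS (by rwa [enqueue_queueWith hγ hS.param_eq])
    · simp only [fillv, ← List.append_assoc]
      rw [← ih₂ hG₂]
      constructor
      · intro h
        cases h with
        | choiceRR hu h => rwa [enqueue_queueWith hγ hu.param_eq] at h
      · intro h
        exact .choiceRR hS (by rwa [enqueue_queueWith hγ hS.param_eq])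
  | mu G ih =>
    simp only [fillv]
    rw [← ih hG.2.2]
    exact ⟨fun h => by cases h; assumption, .mu⟩
  | rvar i =>
    simp only [fillv, List.append_nil]
    exact ⟨fun h => by cases h; rfl, fun h => h ▸ .rvar⟩
  | fin =>
    simp only [fillv, List.append_nil]
    exact ⟨fun h => by cases h; rfl, fun h => h ▸ .fin⟩

/-! ## Transitions of monitors -/

section Monitor

variable {D : List Conn} {γ : Key → Port} {s : Role}

theorem Tree.lift_step {S : Finset Role} {H H' G : Proto B} {a : GAct B} (h : Tree S H G)
    (ha : a.role ∉ S) (hs : GStep H a H') : ∃ G', GStep G a G' ∧ Tree S H' G' := by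
  induction h with
  | leaf => exact ⟨_, hs, .leaf⟩
  | com hp hq _ ih =>
    obtain ⟨G', h₁, h₂⟩ := ih
    exact ⟨_, .conc1 h₁ (fun h => ha (h ▸ hp)) fun h => ha (hq h), .com hp hq h₂⟩
  | choice hp hq _ _ ih₁ ih₂ =>
    obtain ⟨G', h₁, h₂⟩ := ih₁
    obtain ⟨G'', h₁', h₂'⟩ := ih₂
    exact ⟨_, .conc2 h₁ h₁' (fun h => ha (h ▸ hp)) fun h => ha (hq h), .choice hp hq h₂ h₂'⟩

/-- `MonStep D γ s G lam M`: a transition `lam` of the monitor for `s` to the process `M` is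
justified by the protocol `G`: it receives a value from the component of `s`, and `s` sends it in
`G`, or it receives a value from the queue, and `s` receives it in `G` provided that it is the first
one in transit. -/
def MonStep (D : List Conn) (γ : Key → Port) (s : Role) (G : Proto B) (lam : PLab B)
    (M : Proc B) : Prop :=
  ∃ b ∈ D, ∃ v P, RealLabel D b.label ∅ ∧
    ((b.sender = s ∧ lam = .prim (.inp (γ (.port s b.sport)) v) ∧
        M = .out (γ (.label s b.label)) (.val v) P ∧
        ∃ G', GStep G (.send s b.label v) G' ∧ EncG D γ s G' P) ∨
      (b.receiver = s ∧ lam = .prim (.inp (γ (.label s b.label)) v) ∧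
        M = .out (γ (.port s b.rport)) (.val v) P ∧
        ∀ vs, fillv s b.label G = v :: vs →
          ∃ G', GStep G (.recv s b.label v) G' ∧ EncG D γ s G' P))

theorem MonStep.map {G H : Proto B} {lam : PLab B} {M : Proc B} (h : MonStep D γ s G lam M)
    (hf : ∀ l, fillv s l H = fillv s l G)
    (hs : ∀ a G', a.role = s → GStep G a G' →
      ∃ H', GStep H a H' ∧ ∀ P, EncG D γ s G' P → EncG D γ s H' P) : MonStep D γ s H lam M := by
  obtain ⟨b, hb, v, P, hR, ⟨h₁, h₂, h₃, G', h₄, h₅⟩ | ⟨h₁, h₂, h₃, h₄⟩⟩ := h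
  · obtain ⟨H', hH, h'⟩ := hs _ _ rfl h₄
    exact ⟨b, hb, v, P, hR, .inl ⟨h₁, h₂, h₃, H', hH, h' _ h₅⟩⟩
  · refine ⟨b, hb, v, P, hR, .inr ⟨h₁, h₂, h₃, fun vs hvs => ?_⟩⟩
    obtain ⟨G', h₅, h₆⟩ := h₄ vs (by rw [← hf, hvs])
    obtain ⟨H', hH, h'⟩ := hs _ _ rfl h₅
    exact ⟨H', hH, h' _ h₆⟩

theorem Realises.realLabel {p : Role} {l : MLabel} {qs : Finset Role} (h : Realises D p l qs)
    (hp : p ∉ qs) : RealLabel D l ∅ :=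
  ⟨p, qs, h, Finset.empty_subset _, hp⟩

theorem RealLabel.mono {l : MLabel} {qs qs' : Finset Role} (h : RealLabel D l qs)
    (hq : qs' ⊆ qs) : RealLabel D l qs' := by
  obtain ⟨p, qs₀, h₁, h₂, h₃⟩ := h
  exact ⟨p, qs₀, h₁, hq.trans h₂, h₃⟩

theorem GStep.recv_comR {l : MLabel} {v : Val B} {qs : Finset Role} {G : Proto B} (hs : s ∈ qs) :
    ∃ G', GStep (.comR l v qs G) (.recv s l v) G' ∧ ∀ P, EncG D γ s G P → EncG D γ s G' P := by
  obtain ⟨rs, hr, rfl⟩ : ∃ rs, s ∉ rs ∧ qs = insert s rs :=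
    ⟨qs.erase s, Finset.notMem_erase _ _, (Finset.insert_erase hs).symm⟩
  rcases rs.eq_empty_or_nonempty with rfl | hne
  · exact ⟨_, .rVal2, fun P h => h⟩
  · exact ⟨_, .rVal hr hne, fun P h => .comRSkip hr h⟩

theorem GStep.recv_choiceR_inl {l : MLabel} {qs : Finset Role} {G₁ G₂ : Proto B} (hs : s ∈ qs) :
    ∃ G', GStep (.choiceR l .inl qs G₁ G₂) (.recv s l .inl) G' ∧
      ∀ P, EncG D γ s G₁ P → EncG D γ s G' P := by
  obtain ⟨rs, hr, rfl⟩ : ∃ rs, s ∉ rs ∧ qs = insert s rs :=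
    ⟨qs.erase s, Finset.notMem_erase _ _, (Finset.insert_erase hs).symm⟩
  rcases rs.eq_empty_or_nonempty with rfl | hne
  · exact ⟨_, .rChoice2L, fun P h => h⟩
  · exact ⟨_, .rChoice hr hne, fun P h => .choiceRSkipL hr h⟩

theorem GStep.recv_choiceR_inr {l : MLabel} {qs : Finset Role} {G₁ G₂ : Proto B} (hs : s ∈ qs) :
    ∃ G', GStep (.choiceR l .inr qs G₁ G₂) (.recv s l .inr) G' ∧
      ∀ P, EncG D γ s G₂ P → EncG D γ s G' P := by
  obtain ⟨rs, hr, rfl⟩ : ∃ rs, s ∉ rs ∧ qs = insert s rs :=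
    ⟨qs.erase s, Finset.notMem_erase _ _, (Finset.insert_erase hs).symm⟩
  rcases rs.eq_empty_or_nonempty with rfl | hne
  · exact ⟨_, .rChoice2R, fun P h => h⟩
  · exact ⟨_, .rChoice hr hne, fun P h => .choiceRSkipR hr h⟩

theorem EncG.monStep_of_unfold {G : Proto B} {M M' : Proc B} {lam : PLab B}
    (h : EncG D γ s G M) (hG : GOk D [] G) (hs : PStep M lam M')
    (hmu : ∀ P, M = .mu P → ∀ G, GOk D [] G → EncG D γ s G P.unfold → MonStep D γ s G lam M') :
    MonStep D γ s G lam M' := by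
  induction h with
  | @comSend l qs G P b hb hl hs' h ih =>
    subst hl
    cases hs with
    | inp =>
      refine ⟨b, hb, _, P, hG.1.1.realLabel hG.1.2.2, .inl ⟨hs', rfl, ?_, _, .sVal,
        .comRSkip hG.1.2.2 h⟩⟩
      simp only [Proc.substVal, h.liftVar, h.substVal]
      rfl
  | @comRecv p l qs G P b hq hb hl hr hs' h ih =>
    subst hl
    cases hs with
    | inp =>
      refine ⟨b, hb, _, P, hG.1.1.realLabel hG.1.2.2, .inr ⟨hr, rfl, ?_, fun vs hvs => ?_⟩⟩
      · simp only [Proc.substVal, h.liftVar, h.substVal]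
        rfl
      · rw [fillv, hG.2.1.fillv_eq hb (by simp [hs'])] at hvs
        cases hvs
  | comSkip hp hq _ ih =>
    refine (ih hG.2.2 hs hmu).map (fun _ => rfl) fun a G' ha hG' => ⟨_, .conc1 hG' ?_ ?_,
      fun P h => .comSkip hp hq h⟩ <;> rwa [ha]
  | @comRRecv l v qs G P b hq hb hl hr h ih =>
    subst hl
    cases hs with
    | inp =>
      refine ⟨b, hb, _, P, hG.1.1.mono (Finset.empty_subset _), .inr ⟨hr, rfl, ?_,
        fun vs hvs => ?_⟩⟩
      · simp only [Proc.substVal, h.liftVar, h.substVal]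
        rfl
      · simp only [fillv, hq, and_self, if_true, List.singleton_append, List.cons.injEq] at hvs
        obtain ⟨rfl, -⟩ := hvs
        obtain ⟨G', h₁, h₂⟩ := GStep.recv_comR (D := D) (γ := γ) (l := b.label) (v := v) (G := G) hq
        exact ⟨G', h₁, h₂ _ h⟩
  | comRSkip hq _ ih =>
    refine (ih hG.2 hs hmu).map (fun l => by simp [fillv, hq]) fun a G' ha hG' =>
      ⟨_, .conc3 hG' ?_, fun P h => .comRSkip hq h⟩
    rwa [ha]
  | @choiceSend l qs G₁ G₂ P₁ P₂ b hb hl hs' h₁ h₂ ih₁ ih₂ =>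
    subst hl
    cases hs with
    | choL =>
      exact ⟨b, hb, _, P₁, hG.1.1.realLabel hG.1.2.2, .inl ⟨hs', rfl, rfl, _, .sChoice (.inl rfl),
        .choiceRSkipL hG.1.2.2 h₁⟩⟩
    | choR =>
      exact ⟨b, hb, _, P₂, hG.1.1.realLabel hG.1.2.2, .inl ⟨hs', rfl, rfl, _, .sChoice (.inr rfl),
        .choiceRSkipR hG.1.2.2 h₂⟩⟩
  | @choiceRecv p l qs G₁ G₂ P₁ P₂ b hq hb hl hr hs' h₁ h₂ ih₁ ih₂ =>
    subst hl
    have hf : ∀ vs (v : Val B), fillv s b.label (.choice p b.label qs G₁ G₂) ≠ v :: vs := by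
      rw [fillv, hG.2.1.1.fillv_eq hb (by simp [hs'])]
      simp
    cases hs with
    | choL =>
      exact ⟨b, hb, _, P₁, hG.1.1.realLabel hG.1.2.2, .inr ⟨hr, rfl, rfl,
        fun vs hvs => (hf _ _ hvs).elim⟩⟩
    | choR =>
      exact ⟨b, hb, _, P₂, hG.1.1.realLabel hG.1.2.2, .inr ⟨hr, rfl, rfl,
        fun vs hvs => (hf _ _ hvs).elim⟩⟩
  | @choiceSkip p l qs _ _ _ hp hq h₁ _ ih₁ _ =>
    refine (ih₁ hG.2.2.2.1 hs hmu).map (fun l => rfl) fun a G' ha hG' => ?_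
    have hS : s ∉ insert p qs := by simp [hp, hq]
    rcases hG.2.2.1 with ⟨H, hT₁, hT₂⟩ | ⟨hC, -⟩
    · obtain ⟨H', hH, hT₁'⟩ := hT₁.step (by rwa [ha]) hG'
      obtain ⟨G'', hG'', hT₂'⟩ := hT₂.lift_step (by rwa [ha]) hH
      refine ⟨_, .conc2 hG' hG'' (by rwa [ha]) (by rwa [ha]), fun P h =>
        .choiceSkip hp hq h ((hT₂'.encG_iff hS).2 ((hT₁'.encG_iff hS).1 h))⟩
    · exact (hS (hC.2.1 (ha ▸ hG'.role_mem hG.2.2.2.1))).elim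
  | @choiceRRecv l v qs G₁ G₂ P₁ P₂ b hq hb hl hr h₁ h₂ ih₁ ih₂ =>
    subst hl
    have hR := hG.1.1.mono (Finset.empty_subset _)
    cases hs with
    | choL =>
      refine ⟨b, hb, _, P₁, hR, .inr ⟨hr, rfl, rfl, fun vs hvs => ?_⟩⟩
      rcases hG.1.2.2 with rfl | rfl
      · obtain ⟨G', h, h'⟩ := GStep.recv_choiceR_inl (D := D) (γ := γ) (l := b.label) (G₁ := G₁)
          (G₂ := G₂) hq
        exact ⟨G', h, h' _ h₁⟩
      · simp [fillv, hq] at hvs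
    | choR =>
      refine ⟨b, hb, _, P₂, hR, .inr ⟨hr, rfl, rfl, fun vs hvs => ?_⟩⟩
      rcases hG.1.2.2 with rfl | rfl
      · simp [fillv, hq] at hvs
      · obtain ⟨G', h, h'⟩ := GStep.recv_choiceR_inr (D := D) (γ := γ) (l := b.label) (G₁ := G₁)
          (G₂ := G₂) hq
        exact ⟨G', h, h' _ h₂⟩
  | choiceRSkipL hq _ ih =>
    refine (ih hG.2.1 hs hmu).map (fun l => by simp [fillv, hq]) fun a G' ha hG' =>
      ⟨_, .conc4 hG' ?_, fun P h => .choiceRSkipL hq h⟩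
    rwa [ha]
  | choiceRSkipR hq _ ih =>
    refine (ih hG.2.2 hs hmu).map (fun l => by simp [fillv, hq]) fun a G' ha hG' =>
      ⟨_, .conc5 hG' ?_, fun P h => .choiceRSkipR hq h⟩
    rwa [ha]
  | @mu G P hr h ih =>
    refine (hmu P rfl _ hG.unfold (h.unfold hG hr)).map (fun l => ?_) fun a G' ha hG' =>
      ⟨G', .unfold hG', fun P h => h⟩
    rw [fillv_of_static (Proto.static_subst hG.closed hG.1 hG.1),
      fillv_of_static (G := .mu _) hG.1]
  | muSkip => cases hs
  | rvar => cases hs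
  | fin => cases hs

theorem EncG.monStep {G : Proto B} {M M' : Proc B} {lam : PLab B} (h : EncG D γ s G M)
    (hG : GOk D [] G) (hs : PStep M lam M') : MonStep D γ s G lam M' := by
  induction hs generalizing G with
  | unfold hs ih =>
    exact h.monStep_of_unfold hG (.unfold hs) fun P hP G hG h => by cases hP; exact ih h hG
  | act h₁ h₂ => exact h.monStep_of_unfold hG (.act h₁ h₂) (by simp)
  | res h₁ h₂ => exact h.monStep_of_unfold hG (.res h₁ h₂) (by simp)
  | parL h₁ => exact h.monStep_of_unfold hG (.parL h₁) (by simp)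
  | parR h₁ => exact h.monStep_of_unfold hG (.parR h₁) (by simp)
  | comL h₁ h₂ => exact h.monStep_of_unfold hG (.comL h₁ h₂) (by simp)
  | comR h₁ h₂ => exact h.monStep_of_unfold hG (.comR h₁ h₂) (by simp)
  | fwd h₁ h₂ h₃ => exact h.monStep_of_unfold hG (.fwd h₁ h₂ h₃) (by simp)
  | fwdInp h₁ => exact h.monStep_of_unfold hG (.fwdInp h₁) (by simp)
  | fwdOut h₁ => exact h.monStep_of_unfold hG (.fwdOut h₁) (by simp)
  | fwdInp2 h₁ => exact h.monStep_of_unfold hG (.fwdInp2 h₁) (by simp)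
  | fwdOut2 h₁ => exact h.monStep_of_unfold hG (.fwdOut2 h₁) (by simp)
  | out => exact h.monStep_of_unfold hG .out (by simp)
  | inp => exact h.monStep_of_unfold hG .inp (by simp)
  | choL => exact h.monStep_of_unfold hG .choL (by simp)
  | choR => exact h.monStep_of_unfold hG .choR (by simp)

end Monitor

/-! ## Restrictions -/

theorem PStep.of_nus {zs : List Port} {P T : Proc B} {lam : PLab B} (h : PStep (nus zs P) lam T) :
    ∃ P', PStep P lam P' ∧ (∀ z ∈ zs, lam.Avoids z) ∧ T = nus zs P' := by
  induction zs generalizing T with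
  | nil => exact ⟨T, h, by simp, rfl⟩
  | cons z zs ih =>
    cases h with
    | res h hz =>
      obtain ⟨P', h₁, h₂, rfl⟩ := ih h
      exact ⟨P', h₁, List.forall_mem_cons.2 ⟨hz, h₂⟩, rfl⟩

theorem PStep.nus {zs : List Port} {P P' : Proc B} {lam : PLab B} (h : PStep P lam P')
    (hz : ∀ z ∈ zs, lam.Avoids z) : PStep (nus zs P) lam (nus zs P') := by
  induction zs with
  | nil => exact h
  | cons z zs ih =>
    rw [List.forall_mem_cons] at hz
    exact .res (ih hz.2) hz.1

theorem SCong.nus {zs : List Port} {P P' : Proc B} (h : SCong P P') :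
    SCong (nus zs P) (nus zs P') := by
  induction zs with
  | nil => exact h
  | cons z zs ih => exact .nu ih

/-! ## Forwarders -/

/-- A sequence of forwarders with their directions, external ports and internal ports. -/
def fwdList (fs : List (Dir × Port × Port)) (P : Proc B) : Proc B :=
  fs.foldr (fun t Q => .fwd t.1 t.2.1 t.2.2 Q) P

theorem fwds_eq {d : Dir} {f g : Port → Port} {xs : List Port} {P : Proc B} :
    fwds d f g xs P = fwdList (xs.map fun x => (d, f x, g x)) P := by
  simp [fwds, fwdList, List.foldr_map]

theorem fwdList_append {fs fs' : List (Dir × Port × Port)} {P : Proc B} :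
    fwdList fs (fwdList fs' P) = fwdList (fs ++ fs') P := by
  simp [fwdList]

/-- `FwdLab fs lam lam'`: the forwarders `fs` turn the label `lam` into `lam'`. -/
inductive FwdLab (fs : List (Dir × Port × Port)) : PLab B → PLab B → Prop
  | pass {lam} (h : ∀ t ∈ fs, lam.Avoids t.2.1 ∧ lam.Avoids t.2.2) : FwdLab fs lam lam
  | queueInp {z w v} (h : (.inp, z, w) ∈ fs) :
      FwdLab fs (.queue (.inp w v)) (.queue (.inp z v))
  | queueOut {z w v} (h : (.out, z, w) ∈ fs) :
      FwdLab fs (.queue (.out w v)) (.queue (.out z v))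
  | primInp {z w v} (h : (.inp, z, w) ∈ fs) :
      FwdLab fs (.prim (.inp w v)) (.prim (.inp z v))
  | primOut {z w v} (h : (.out, z, w) ∈ fs) :
      FwdLab fs (.prim (.out w v)) (.prim (.out z v))

theorem FwdLab.cons {fs : List (Dir × Port × Port)} {t : Dir × Port × Port} {lam lam' : PLab B}
    (h : FwdLab fs lam lam') (h₁ : lam'.Avoids t.2.1) (h₂ : lam'.Avoids t.2.2) :
    FwdLab (t :: fs) lam lam' := by
  cases h with
  | pass h => exact .pass (List.forall_mem_cons.2 ⟨⟨h₁, h₂⟩, h⟩)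
  | queueInp h => exact .queueInp (List.mem_cons_of_mem _ h)
  | queueOut h => exact .queueOut (List.mem_cons_of_mem _ h)
  | primInp h => exact .primInp (List.mem_cons_of_mem _ h)
  | primOut h => exact .primOut (List.mem_cons_of_mem _ h)

theorem PStep.of_fwdList {fs : List (Dir × Port × Port)} {P T : Proc B} {lam : PLab B}
    (hfs : ∀ t ∈ fs, ∀ t' ∈ fs, t.2.1 ≠ t'.2.2) (h : PStep (fwdList fs P) lam T) :
    ∃ lam' P', PStep P lam' P' ∧ FwdLab fs lam' lam ∧ T = fwdList fs P' := by
  induction fs generalizing T lam with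
  | nil => exact ⟨lam, T, h, .pass (by simp), rfl⟩
  | cons t fs ih =>
    have ih := fun {lam T} => @ih lam T fun t ht t' ht' =>
      hfs t (List.mem_cons_of_mem _ ht) t' (List.mem_cons_of_mem _ ht')
    have hne : ∀ t' ∈ fs, t'.2.1 ≠ t.2.2 := fun t' ht' => hfs t' (List.mem_cons_of_mem _ ht') t
      List.mem_cons_self
    obtain ⟨d, z, w⟩ := t
    replace h : PStep (.fwd d z w (fwdList fs P)) lam T := h
    cases h with
    | fwd h hz hw =>
      obtain ⟨lam', P', h₁, h₂, rfl⟩ := ih h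
      exact ⟨lam', P', h₁, h₂.cons hz hw, rfl⟩
    | fwdInp h =>
      obtain ⟨lam', P', h₁, h₂, rfl⟩ := ih h
      cases h₂ with
      | pass => exact ⟨_, P', h₁, .queueInp List.mem_cons_self, rfl⟩
      | queueInp h => exact (hne _ h rfl).elim
    | fwdOut h =>
      obtain ⟨lam', P', h₁, h₂, rfl⟩ := ih h
      cases h₂ with
      | pass => exact ⟨_, P', h₁, .queueOut List.mem_cons_self, rfl⟩
      | queueOut h => exact (hne _ h rfl).elim
    | fwdInp2 h =>
      obtain ⟨lam', P', h₁, h₂, rfl⟩ := ih h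
      cases h₂ with
      | pass => exact ⟨_, P', h₁, .primInp List.mem_cons_self, rfl⟩
      | primInp h => exact (hne _ h rfl).elim
    | fwdOut2 h =>
      obtain ⟨lam', P', h₁, h₂, rfl⟩ := ih h
      cases h₂ with
      | pass => exact ⟨_, P', h₁, .primOut List.mem_cons_self, rfl⟩
      | primOut h => exact (hne _ h rfl).elim

theorem PStep.fwdList_pass {fs : List (Dir × Port × Port)} {P P' : Proc B} {lam : PLab B}
    (h : PStep P lam P') (hfs : ∀ t ∈ fs, lam.Avoids t.2.1 ∧ lam.Avoids t.2.2) :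
    PStep (fwdList fs P) lam (fwdList fs P') := by
  induction fs with
  | nil => exact h
  | cons t fs ih =>
    rw [List.forall_mem_cons] at hfs
    exact .fwd (ih hfs.2) hfs.1.1 hfs.1.2

theorem PStep.fwdList_inp {fs : List (Dir × Port × Port)} {P P' : Proc B} {z w : Port} {v : Val B}
    (h : PStep P (.queue (.inp w v)) P') (hmem : (.inp, z, w) ∈ fs)
    (hext : (fs.map fun t => t.2.1).Nodup) (hint : (fs.map fun t => t.2.2).Nodup)
    (hfs : ∀ t ∈ fs, ∀ t' ∈ fs, t.2.1 ≠ t'.2.2) :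
    PStep (fwdList fs P) (.queue (.inp z v)) (fwdList fs P') := by
  induction fs with
  | nil => simp at hmem
  | cons t fs ih =>
    have hfs' : ∀ t ∈ fs, ∀ t' ∈ fs, t.2.1 ≠ t'.2.2 := fun t ht t' ht' =>
      hfs t (List.mem_cons_of_mem _ ht) t' (List.mem_cons_of_mem _ ht')
    simp only [List.map_cons, List.nodup_cons, List.mem_map, not_exists, not_and] at hext hint
    rcases List.mem_cons.1 hmem with rfl | hmem'
    · refine .fwdInp (h.fwdList_pass fun t ht => ⟨fun hw => ?_, fun hw => ?_⟩)
      · exact hfs t (List.mem_cons_of_mem _ ht) _ List.mem_cons_self hw.symm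
      · exact hint.1 t ht hw.symm
    · refine .fwd (ih hmem' hext.2 hint.2 hfs') (fun hz => ?_) fun hz => ?_
      · exact hext.1 _ hmem' hz
      · exact hfs _ hmem t List.mem_cons_self hz

theorem SCong.fwdList {fs : List (Dir × Port × Port)} {P P' : Proc B} (h : SCong P P') :
    SCong (fwdList fs P) (fwdList fs P') := by
  induction fs with
  | nil => exact h
  | cons t fs ih => exact .fwd ih

/-! ## Parallel compositions -/

/-- The parallel composition of the processes in a list, and a last one. -/
def parList (l : List (Proc B)) (P : Proc B) : Proc B := l.foldr Proc.par P

theorem parList_append {l l' : List (Proc B)} {P : Proc B} :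
    parList (l ++ l') P = parList l (parList l' P) := by
  simp [parList]

theorem PStep.of_parList_prim {l : List (Proc B)} {P T : Proc B} {lam : PLab B}
    (hl : ∀ M ∈ l, ∀ lam M', PStep M lam M' → ∃ a, lam = .prim a)
    (hP : ∀ lam P', PStep P lam P' → ∃ a, lam = .queue a) (h : PStep (parList l P) lam T) :
    (∃ a l₁ M l₂ M', lam = .prim a ∧ l = l₁ ++ M :: l₂ ∧ PStep M (.prim a) M' ∧
        T = parList (l₁ ++ M' :: l₂) P) ∨
      (∃ a P', lam = .queue a ∧ PStep P (.queue a) P' ∧ T = parList l P') ∨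
      ∃ (a : Act B) (l₁ : List (Proc B)) (M : Proc B) (l₂ : List (Proc B)) (M' P' : Proc B),
        lam = .tau ∧ l = l₁ ++ M :: l₂ ∧ PStep M (.prim a.dual) M' ∧
        PStep P (.queue a) P' ∧ T = parList (l₁ ++ M' :: l₂) P' := by
  induction l generalizing lam T with
  | nil =>
    obtain ⟨a, rfl⟩ := hP _ _ h
    exact .inr (.inl ⟨a, T, rfl, h, rfl⟩)
  | cons M l ih =>
    rw [List.forall_mem_cons] at hl
    have ih := fun {lam T} => @ih T lam hl.2
    replace h : PStep (.par M (parList l P)) lam T := h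
    cases h with
    | parL h =>
      obtain ⟨a, rfl⟩ := hl.1 _ _ h
      exact .inl ⟨a, [], M, l, _, rfl, rfl, h, rfl⟩
    | parR h =>
      rcases ih h with ⟨a, l₁, M₁, l₂, M', rfl, rfl, h₁, rfl⟩ | ⟨a, P', rfl, h₁, rfl⟩ |
        ⟨a, l₁, M₁, l₂, M', P', rfl, rfl, h₁, h₂, rfl⟩
      · exact .inl ⟨a, M :: l₁, M₁, l₂, M', rfl, rfl, h₁, rfl⟩
      · exact .inr (.inl ⟨a, P', rfl, h₁, rfl⟩)
      · exact .inr (.inr ⟨a, M :: l₁, M₁, l₂, M', P', rfl, rfl, h₁, h₂, rfl⟩)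
    | comL h₁ h₂ => obtain ⟨a, ha⟩ := hl.1 _ _ h₁; cases ha
    | @comR _ M' _ _ a h₁ h₂ =>
      rcases ih h₂ with ⟨a, l₁, M₁, l₂, M', h, -⟩ | ⟨a, P', h, h₂, rfl⟩ |
        ⟨a, l₁, M₁, l₂, M', P', h, -⟩
      · cases h
      · cases h
        exact .inr (.inr ⟨_, [], M, l, M', P', rfl, rfl, h₁, h₂, rfl⟩)
      · cases h

theorem PStep.of_parList_queue {l : List (Proc B)} {P T : Proc B} {lam : PLab B}
    (hl : ∀ Q ∈ l, ∀ a Q', ¬ PStep Q (.prim a) Q') (h : PStep (parList l P) lam T) :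
    (∃ l₁ Q l₂ Q', l = l₁ ++ Q :: l₂ ∧ PStep Q lam Q' ∧ T = parList (l₁ ++ Q' :: l₂) P) ∨
      (∃ P', PStep P lam P' ∧ T = parList l P') ∨
      ∃ (a : Act B) (l₁ : List (Proc B)) (Q : Proc B) (l₂ : List (Proc B)) (Q' P' : Proc B),
        lam = .tau ∧ l = l₁ ++ Q :: l₂ ∧ PStep Q (.queue a) Q' ∧
        PStep P (.prim a.dual) P' ∧ T = parList (l₁ ++ Q' :: l₂) P' := by
  induction l generalizing lam T with
  | nil => exact .inr (.inl ⟨T, h, rfl⟩)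
  | cons Q l ih =>
    rw [List.forall_mem_cons] at hl
    have ih := fun {lam T} => @ih T lam hl.2
    replace h : PStep (.par Q (parList l P)) lam T := h
    cases h with
    | parL h => exact .inl ⟨[], Q, l, _, rfl, h, rfl⟩
    | parR h =>
      rcases ih h with ⟨l₁, Q₁, l₂, Q', rfl, h₁, rfl⟩ | ⟨P', h₁, rfl⟩ |
        ⟨a, l₁, Q₁, l₂, Q', P', rfl, rfl, h₁, h₂, rfl⟩
      · exact .inl ⟨Q :: l₁, Q₁, l₂, Q', rfl, h₁, rfl⟩
      · exact .inr (.inl ⟨P', h₁, rfl⟩)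
      · exact .inr (.inr ⟨a, Q :: l₁, Q₁, l₂, Q', P', rfl, rfl, h₁, h₂, rfl⟩)
    | comR h₁ h₂ => exact (hl.1 _ _ h₁).elim
    | @comL _ Q' _ _ a h₁ h₂ =>
      rcases ih h₂ with ⟨l₁, Q₁, l₂, Q', rfl, h, -⟩ | ⟨P', h₃, rfl⟩ |
        ⟨a, l₁, Q₁, l₂, Q', P', h, -⟩
      · exact (hl.2 Q₁ (by simp) _ _ h).elim
      · exact .inr (.inr ⟨a, [], Q, l, Q', P', rfl, rfl, h₁, h₃, rfl⟩)
      · cases h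

theorem PStep.parList_last {l : List (Proc B)} {P P' : Proc B} {lam : PLab B}
    (h : PStep P lam P') : PStep (parList l P) lam (parList l P') := by
  induction l with
  | nil => exact h
  | cons Q l ih => exact .parR ih

theorem PStep.parList_mem {l₁ l₂ : List (Proc B)} {Q Q' P : Proc B} {lam : PLab B}
    (h : PStep Q lam Q') :
    PStep (parList (l₁ ++ Q :: l₂) P) lam (parList (l₁ ++ Q' :: l₂) P) := by
  rw [parList_append, parList_append]
  exact .parList_last (.parL h)

theorem PStep.parList_sync_queue {l₁ l₂ : List (Proc B)} {Q Q' P P' : Proc B} {a : Act B}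
    (h : PStep Q (.queue a) Q') (h' : PStep P (.prim a.dual) P') :
    PStep (parList (l₁ ++ Q :: l₂) P) .tau (parList (l₁ ++ Q' :: l₂) P') := by
  rw [parList_append, parList_append]
  exact .parList_last (.comL h (.parList_last h'))

theorem PStep.parList_sync_prim {l₁ l₂ : List (Proc B)} {Q Q' P P' : Proc B} {a : Act B}
    (h : PStep Q (.prim a.dual) Q') (h' : PStep P (.queue a) P') :
    PStep (parList (l₁ ++ Q :: l₂) P) .tau (parList (l₁ ++ Q' :: l₂) P') := by
  rw [parList_append, parList_append]
  exact .parList_last (.comR h (.parList_last h'))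

theorem SCong.parList {l l' : List (Proc B)} {P P' : Proc B} (h : List.Forall₂ SCong l l')
    (hP : SCong P P') : SCong (parList l P) (parList l' P') := by
  induction h with
  | nil => exact hP
  | cons h _ ih => exact .par h ih

/-! ## Local binders -/

theorem LBinder.Step.lhs_eq {b b' : LBinder B} {a : Act B} (h : b.Step a b') : b'.lhs = b.lhs := by
  cases h <;> rfl

theorem LBinder.Step.params_eq {b b' : LBinder B} {a : Act B} (h : b.Step a b') :
    b'.params = b.params := by
  cases h <;> rfl

/-- The stores in the queue of a local binder only have values for its parameters. -/
def LBinder.Ok (b : LBinder B) : Prop := ∀ σ ∈ b.queue, ∀ u, σ u ≠ none → u ∈ b.params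

theorem LBinder.Ok.step {b b' : LBinder B} {a : Act B} (hb : b.Ok) (h : b.Step a b') : b'.Ok := by
  cases h with
  | const => exact hb
  | out => exact fun τ hτ => hb τ (List.mem_cons_of_mem _ hτ)
  | @inpNew _ _ _ _ x _ hx hall =>
    intro τ hτ u hu
    rcases List.mem_append.1 hτ with hτ | hτ
    · exact hb τ hτ u hu
    · rw [List.mem_singleton] at hτ
      subst hτ
      by_cases h : u = x
      · exact h ▸ hx
      · simp [Store.single, h] at hu
  | @inpUpd _ _ σ _ _ _ x _ hx hall hσ =>
    intro τ hτ u hu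
    rcases List.mem_append.1 hτ with hτ | hτ
    · exact hb τ (List.mem_append_left _ hτ) u hu
    · rcases List.mem_cons.1 hτ with rfl | hτ
      · by_cases h : u = x
        · exact h ▸ hx
        · rw [Function.update_of_ne h] at hu
          exact hb σ (by simp) u hu
      · exact hb τ (List.mem_append_right _ (List.mem_cons_of_mem _ hτ)) u hu
  | inpDisc => exact hb

theorem LBinder.Ok.mem_fp {b : LBinder B} (h : b.Ok) {u : Port} :
    u ∈ b.fp ↔ u = b.lhs ∨ u ∈ b.params := by
  constructor
  · rintro (h₁ | h₁ | ⟨σ, hσ, hu⟩)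
    · exact .inl h₁
    · exact .inr h₁
    · exact .inr (h σ hσ u hu)
  · rintro (h₁ | h₁)
    · exact .inl h₁
    · exact .inr (.inl h₁)

theorem LBinder.Step.mem_fp_iff {b b' : LBinder B} {a : Act B} (h : b.Step a b') (hb : b.Ok)
    {u : Port} : u ∈ b'.fp ↔ u ∈ b.fp := by
  rw [hb.mem_fp, (hb.step h).mem_fp, h.lhs_eq, h.params_eq]

theorem LStep.forall₂ {L L' : List (LBinder B)} {a : Act B} (h : LStep L a L') :
    List.Forall₂ (fun b b' => b' = b ∨ LBinder.Step b a b') L L' := by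
  cases h with
  | out h =>
    refine List.rel_append (List.forall₂_same.2 fun b _ => .inl rfl) (.cons (.inr h) ?_)
    exact List.forall₂_same.2 fun b _ => .inl rfl
  | inp h => exact h.imp fun b b' h => .inr h

theorem LStep.ok {L L' : List (LBinder B)} {a : Act B} (h : LStep L a L')
    (hL : ∀ b ∈ L, b.Ok) : ∀ b ∈ L', b.Ok := by
  have := h.forall₂
  clear h
  induction this with
  | nil => simp
  | cons h _ ih =>
    rw [List.forall_mem_cons] at hL ⊢
    refine ⟨?_, ih hL.2⟩
    rcases h with rfl | h
    · exact hL.1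
    · exact hL.1.step h

theorem LStep.mem_fp_iff {L L' : List (LBinder B)} {a : Act B} (h : LStep L a L')
    (hL : ∀ b ∈ L, b.Ok) (u : Port) : (∃ b ∈ L', u ∈ b.fp) ↔ ∃ b ∈ L, u ∈ b.fp := by
  have := h.forall₂
  clear h
  induction this with
  | nil => simp
  | cons h _ ih =>
    rw [List.forall_mem_cons] at hL
    simp only [List.mem_cons, exists_eq_or_imp, ih hL.2]
    rcases h with rfl | h
    · rfl
    · rw [h.mem_fp_iff hL.1]

theorem LBinder.exists_inp (b : LBinder B) (x : Port) (v : Val B) : ∃ b', b.Step (.inp x v) b' := by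
  obtain ⟨y, q, f, xs⟩ := b
  by_cases hx : x ∈ xs
  · by_cases hall : ∀ σ ∈ q, σ x ≠ none
    · exact ⟨_, .inpNew hx hall⟩
    · have : ∃ σs₁ σ σs₂, q = σs₁ ++ σ :: σs₂ ∧ (∀ τ ∈ σs₁, τ x ≠ none) ∧ σ x = none := by
        clear hx
        induction q with
        | nil => simp at hall
        | cons τ q ih =>
          by_cases hτ : τ x = none
          · exact ⟨[], τ, q, rfl, by simp, hτ⟩
          · obtain ⟨σs₁, σ, σs₂, rfl, h₁, h₂⟩ := ih fun h =>
              hall (List.forall_mem_cons.2 ⟨hτ, h⟩)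
            exact ⟨τ :: σs₁, σ, σs₂, rfl, List.forall_mem_cons.2 ⟨hτ, h₁⟩, h₂⟩
      obtain ⟨σs₁, σ, σs₂, rfl, h₁, h₂⟩ := this
      exact ⟨_, .inpUpd hx h₁ h₂⟩
  · exact ⟨_, .inpDisc hx⟩

theorem LStep.exists_inp (L : List (LBinder B)) (x : Port) (v : Val B) :
    ∃ L', LStep L (.inp x v) L' := by
  choose f hf using fun b : LBinder B => b.exists_inp x v
  exact ⟨L.map f, .inp (List.forall₂_map_right_iff.2 (List.forall₂_same.2 fun b _ => hf b))⟩

theorem extend_single {g : Port → Port} (hg : Function.Injective g)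
    (x : Port) (v : Val B) :
    Function.extend g (Store.single x v) (fun _ => none) = Store.single (g x) v := by
  funext u
  by_cases hu : ∃ y, g y = u
  · obtain ⟨y, rfl⟩ := hu
    simp [hg.extend_apply, Store.single, hg.eq_iff]
  · rw [Function.extend_apply' _ _ _ hu]
    have : u ≠ g x := fun h => hu ⟨x, h.symm⟩
    simp [Store.single, this]

theorem extend_update {g : Port → Port} (hg : Function.Injective g)
    (σ : Store B) (x : Port) (v : Val B) :
    Function.extend g (Function.update σ x (some v)) (fun _ => none) =
      Function.update (Function.extend g σ fun _ => none) (g x) (some v) := by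
  funext u
  by_cases hu : ∃ y, g y = u
  · obtain ⟨y, rfl⟩ := hu
    rw [hg.extend_apply]
    by_cases h : y = x
    · subst h; simp
    · rw [Function.update_of_ne h, Function.update_of_ne (hg.ne h), hg.extend_apply]
  · have : u ≠ g x := fun h => hu ⟨x, h.symm⟩
    rw [Function.extend_apply' _ _ _ hu, Function.update_of_ne this,
      Function.extend_apply' _ _ _ hu]

theorem LBinder.Step.out_of_rename {g : Port → Port} (hg : Function.Injective g)
    {b c : LBinder B} {u : Port} {v : Val B}
    (h : (b.rename g).Step (.out u v) c) :
    ∃ y b', u = g y ∧ b.Step (.out y v) b' ∧ c = b'.rename g := by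
  obtain ⟨y, q, f, xs⟩ := b
  generalize hb : LBinder.rename g ⟨y, q, f, xs⟩ = b₀ at h
  generalize ha : Act.out u v = a at h
  cases h with
  | const h =>
    simp only [LBinder.rename, LBinder.mk.injEq, List.map_eq_nil_iff] at hb
    obtain ⟨rfl, rfl, rfl, rfl⟩ := hb
    cases ha
    exact ⟨_, _, rfl, .const h, by simp [LBinder.rename]⟩
  | @out y' σ σs f' xs' vs v' hne hdom hvs h =>
    cases ha
    simp only [LBinder.rename, LBinder.mk.injEq, List.map_eq_cons_iff] at hb
    obtain ⟨rfl, ⟨τ, τs, rfl, rfl, rfl⟩, rfl, rfl⟩ := hb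
    refine ⟨y, ⟨y, τs, f, xs⟩, rfl, .out (vs := vs) (by simpa using hne) (fun x => ?_) ?_ h, rfl⟩
    · rw [← hg.extend_apply τ (fun _ => none), ← hdom, List.mem_map_of_injective hg]
    · simpa [List.forall₂_map_left_iff, hg.extend_apply] using hvs
  | inpNew => cases ha
  | inpUpd => cases ha
  | inpDisc => cases ha

theorem LBinder.Step.inp_of_rename {g : Port → Port} (hg : Function.Injective g)
    {b c : LBinder B} {x : Port} {v : Val B}
    (h : (b.rename g).Step (.inp (g x) v) c) :
    ∃ b', b.Step (.inp x v) b' ∧ c = b'.rename g := by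
  obtain ⟨y, q, f, xs⟩ := b
  generalize hb : LBinder.rename g ⟨y, q, f, xs⟩ = b₀ at h
  generalize ha : Act.inp (g x) v = a at h
  cases h with
  | const h => cases ha
  | out => cases ha
  | inpNew hx hall =>
    cases ha
    simp only [LBinder.rename, LBinder.mk.injEq] at hb
    obtain ⟨rfl, rfl, rfl, rfl⟩ := hb
    refine ⟨_, .inpNew ((List.mem_map_of_injective hg).1 hx) fun σ hσ => ?_, ?_⟩
    · rw [← hg.extend_apply σ (fun _ => none)]
      exact hall _ (List.mem_map_of_mem hσ)
    · simp [LBinder.rename, extend_single hg]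
  | inpUpd hx hall hσ =>
    cases ha
    simp only [LBinder.rename, LBinder.mk.injEq, List.map_eq_append_iff, List.map_eq_cons_iff] at hb
    obtain ⟨rfl, ⟨σs₁, _, rfl, rfl, σ, σs₂, rfl, rfl, rfl⟩, rfl, rfl⟩ := hb
    refine ⟨_, .inpUpd ((List.mem_map_of_injective hg).1 hx) (fun τ hτ => ?_)
      (by rwa [hg.extend_apply] at hσ), ?_⟩
    · rw [← hg.extend_apply τ (fun _ => none)]
      exact hall _ (List.mem_map_of_mem hτ)
    · simp [LBinder.rename, extend_update hg]
  | inpDisc hx =>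
    cases ha
    simp only [LBinder.rename, LBinder.mk.injEq] at hb
    obtain ⟨rfl, rfl, rfl, rfl⟩ := hb
    exact ⟨_, .inpDisc fun h => hx (List.mem_map_of_mem h), rfl⟩

theorem LStep.out_of_rename {g : Port → Port} (hg : Function.Injective g)
    {L L'' : List (LBinder B)} {u : Port} {v : Val B}
    (h : LStep (L.map (LBinder.rename g)) (.out u v) L'') :
    ∃ y L', u = g y ∧ LStep L (.out y v) L' ∧ L'' = L'.map (LBinder.rename g) := by
  generalize hL : L.map (LBinder.rename g) = L₀ at h
  cases h with
  | out h =>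
    obtain ⟨L₁, _, rfl, rfl, h'⟩ := List.map_eq_append_iff.1 hL
    obtain ⟨b, L₂, rfl, rfl, rfl⟩ := List.map_eq_cons_iff.1 h'
    obtain ⟨y, b', rfl, h₁, rfl⟩ := h.out_of_rename hg
    exact ⟨y, L₁ ++ b' :: L₂, rfl, .out h₁, by simp⟩

theorem LStep.inp_of_rename {g : Port → Port} (hg : Function.Injective g)
    {L L'' : List (LBinder B)} {x : Port} {v : Val B}
    (h : LStep (L.map (LBinder.rename g)) (.inp (g x) v) L'') :
    ∃ L', LStep L (.inp x v) L' ∧ L'' = L'.map (LBinder.rename g) := by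
  generalize hL : L.map (LBinder.rename g) = L₀ at h
  cases h with
  | inp h =>
    subst hL
    rw [List.forall₂_map_left_iff] at h
    have : ∃ L', List.Forall₂ (fun b b' => LBinder.Step b (.inp x v) b') L L' ∧
        L'' = L'.map (LBinder.rename g) := by
      induction h with
      | nil => exact ⟨[], .nil, rfl⟩
      | cons h _ ih =>
        obtain ⟨L', h₁, rfl⟩ := ih
        obtain ⟨b', h₂, rfl⟩ := h.inp_of_rename hg
        exact ⟨b' :: L', .cons h₂ h₁, rfl⟩
    obtain ⟨L', h₁, h₂⟩ := this
    exact ⟨L', .inp h₁, h₂⟩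

/-! ## Monitor queues -/

theorem queueWith_step_out {γ : Key → Port} {b : Conn} {vs : List (Val B)} {u : Port} {v : Val B}
    {c : LBinder B} (h : (queueWith γ b vs).Step (.out u v) c) :
    u = γ (.label b.receiver b.label) ∧ ∃ ws, vs = v :: ws ∧ c = queueWith γ b ws := by
  generalize hb : queueWith γ b vs = b₀ at h
  generalize ha : Act.out u v = a at h
  cases h with
  | const h => simp [queueWith] at hb
  | out hne hdom hvs h =>
    cases ha
    simp only [queueWith, LBinder.mk.injEq, List.map_eq_cons_iff] at hb
    obtain ⟨rfl, ⟨w, ws, rfl, rfl, rfl⟩, rfl, rfl⟩ := hb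
    refine ⟨rfl, ws, ?_, rfl⟩
    cases hvs with
    | cons h₁ h₂ =>
      cases h₂
      simp only [Store.single, if_true, Option.some.injEq] at h₁
      subst h₁
      simp only [idFun, Option.some.injEq] at h
      rw [h]
  | inpNew => cases ha
  | inpUpd => cases ha
  | inpDisc => cases ha

theorem queueWith_step_inp {γ : Key → Port} {b : Conn} {vs : List (Val B)} {u : Port} {v : Val B}
    {c : LBinder B} (h : (queueWith γ b vs).Step (.inp u v) c) :
    c = queueWith γ b (vs ++ if γ (.label b.sender b.label) = u then [v] else []) := by
  generalize hb : queueWith γ b vs = b₀ at h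
  generalize ha : Act.inp u v = a at h
  cases h with
  | const h => cases ha
  | out => cases ha
  | inpNew hx hall =>
    cases ha
    simp only [queueWith, LBinder.mk.injEq] at hb
    obtain ⟨rfl, rfl, rfl, rfl⟩ := hb
    rw [List.mem_singleton] at hx
    subst hx
    simp [queueWith]
  | inpUpd hx hall hσ =>
    cases ha
    simp only [queueWith, LBinder.mk.injEq, List.map_eq_append_iff, List.map_eq_cons_iff] at hb
    obtain ⟨rfl, ⟨σs₁, _, rfl, rfl, w, σs₂, rfl, rfl, rfl⟩, rfl, rfl⟩ := hb
    rw [List.mem_singleton] at hx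
    subst hx
    simp [Store.single] at hσ
  | inpDisc hx =>
    cases ha
    simp only [queueWith, LBinder.mk.injEq] at hb
    obtain ⟨rfl, rfl, rfl, rfl⟩ := hb
    have : γ (.label b.sender b.label) ≠ u := fun h => hx (by simp [h])
    simp [this, queueWith]

theorem LStep.queues_out {D : List Conn} (hD : D.Nodup) {γ : Key → Port}
    {c : Conn → List (Val B)} {u : Port} {v : Val B} {L : List (LBinder B)}
    (h : LStep (D.map fun b => queueWith γ b (c b)) (.out u v) L) :
    ∃ b ∈ D, ∃ vs, u = γ (.label b.receiver b.label) ∧ c b = v :: vs ∧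
      ∀ c' : Conn → List (Val B), c' b = vs → (∀ d ∈ D, d ≠ b → c' d = c d) →
        L = D.map fun b => queueWith γ b (c' b) := by
  generalize hL : (D.map fun b => queueWith γ b (c b)) = L₀ at h
  cases h with
  | out h =>
    obtain ⟨D₁, _, rfl, rfl, h'⟩ := List.map_eq_append_iff.1 hL
    obtain ⟨b, D₂, rfl, rfl, rfl⟩ := List.map_eq_cons_iff.1 h'
    obtain ⟨rfl, ws, h₁, rfl⟩ := queueWith_step_out h
    refine ⟨b, by simp, ws, rfl, h₁, fun c' hb hc' => ?_⟩
    rw [List.nodup_append, List.nodup_cons] at hD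
    simp only [List.map_append, List.map_cons, hb]
    congr 1
    · refine List.map_congr_left fun d hd => ?_
      rw [hc' d (by simp [hd]) fun h => hD.2.2 d hd b (by simp) h]
    · congr 1
      refine List.map_congr_left fun d hd => ?_
      rw [hc' d (by simp [hd]) fun h => hD.2.1.1 (h ▸ hd)]

theorem LStep.queues_inp {D : List Conn} {γ : Key → Port} {c : Conn → List (Val B)} {u : Port}
    {v : Val B} {L : List (LBinder B)}
    (h : LStep (D.map fun b => queueWith γ b (c b)) (.inp u v) L) :
    L = D.map fun b => queueWith γ b (c b ++ if γ (.label b.sender b.label) = u then [v] else []) := by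
  generalize hL : (D.map fun b => queueWith γ b (c b)) = L₀ at h
  cases h with
  | inp h =>
    subst hL
    rw [List.forall₂_map_left_iff] at h
    induction h with
    | nil => rfl
    | cons h _ ih => rw [queueWith_step_inp h, ih]; rfl

/-! ## Static protocols that have encodings -/

section Static

variable {D : List Conn} {γ : Key → Port} {s : Role}

/-- The labels of the communication steps of a protocol. -/
def Proto.labels (G : Proto B) : List MLabel := G.steps.map fun t => t.2.1

theorem EncG.exists_label {G : Proto B} {P : Proc B} (h : EncG D γ s G P) (hG : G.Static)
    (hs : s ∈ G.roles) : ∃ l ∈ G.labels, γ (.label s l) ∈ P.fp := by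
  induction h with
  | comSend => exact ⟨_, List.mem_cons_self, by simp [Proc.fp]⟩
  | comRecv => exact ⟨_, List.mem_cons_self, by simp [Proc.fp]⟩
  | comSkip hp hq _ ih =>
    simp only [Proto.roles, Finset.mem_insert, Finset.mem_union, hp, hq, false_or] at hs
    obtain ⟨l, hl, h⟩ := ih hG hs
    exact ⟨l, List.mem_cons_of_mem _ hl, h⟩
  | comRRecv => exact hG.elim
  | comRSkip => exact hG.elim
  | choiceSend => exact ⟨_, List.mem_cons_self, by simp [Proc.fp]⟩
  | choiceRecv => exact ⟨_, List.mem_cons_self, by simp [Proc.fp]⟩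
  | choiceSkip hp hq _ _ ih₁ ih₂ =>
    simp only [Proto.roles, Finset.mem_insert, Finset.mem_union, hp, hq, false_or] at hs
    rcases hs with hs | hs
    · obtain ⟨l, hl, h⟩ := ih₁ hG.1 hs
      refine ⟨l, ?_, h⟩
      simp only [Proto.labels, Proto.steps, List.map_cons, List.map_append]
      exact List.mem_cons_of_mem _ (List.mem_append_left _ hl)
    · obtain ⟨l, hl, h⟩ := ih₂ hG.2 hs
      refine ⟨l, ?_, h⟩
      simp only [Proto.labels, Proto.steps, List.map_cons, List.map_append]
      exact List.mem_cons_of_mem _ (List.mem_append_right _ hl)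
  | choiceRRecv => exact hG.elim
  | choiceRSkipL => exact hG.elim
  | choiceRSkipR => exact hG.elim
  | mu _ _ ih => exact ih hG hs
  | muSkip h => exact (h hs).elim
  | rvar => simp [Proto.roles] at hs
  | fin => simp [Proto.roles] at hs

theorem EncG.mem_labels (hγ : Function.Injective γ) {G : Proto B} {P : Proc B}
    (h : EncG D γ s G P) (hG : G.Static) {l : MLabel} (hl : γ (.label s l) ∈ P.fp) :
    l ∈ G.labels := by
  induction h with
  | comSend _ _ _ h ih =>
    simp only [Proc.fp, h.liftVar, Set.mem_union, Set.mem_singleton_iff, hγ.eq_iff, reduceCtorEq,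
      false_or, Key.label.injEq, true_and] at hl
    rcases hl with rfl | hl
    · exact List.mem_cons_self
    · exact List.mem_cons_of_mem _ (ih hG hl)
  | comRecv _ _ _ _ _ h ih =>
    simp only [Proc.fp, h.liftVar, Set.mem_union, Set.mem_singleton_iff, hγ.eq_iff, reduceCtorEq,
      false_or, Key.label.injEq, true_and] at hl
    rcases hl with rfl | hl
    · exact List.mem_cons_self
    · exact List.mem_cons_of_mem _ (ih hG hl)
  | comSkip _ _ _ ih => exact List.mem_cons_of_mem _ (ih hG hl)
  | comRRecv => exact hG.elim
  | comRSkip => exact hG.elim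
  | choiceSend _ _ _ _ _ ih₁ ih₂ =>
    simp only [Proc.fp, Set.mem_union, Set.mem_singleton_iff, hγ.eq_iff, reduceCtorEq,
      false_or, Key.label.injEq, true_and] at hl
    simp only [Proto.labels, Proto.steps, List.map_cons, List.map_append, List.mem_cons,
      List.mem_append]
    rcases hl with (hl | hl) | hl | hl
    · exact .inl hl
    · exact .inr (.inl (ih₁ hG.1 hl))
    · exact .inl hl
    · exact .inr (.inr (ih₂ hG.2 hl))
  | choiceRecv _ _ _ _ _ _ _ ih₁ ih₂ =>
    simp only [Proc.fp, Set.mem_union, Set.mem_singleton_iff, hγ.eq_iff, reduceCtorEq,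
      false_or, Key.label.injEq, true_and] at hl
    simp only [Proto.labels, Proto.steps, List.map_cons, List.map_append, List.mem_cons,
      List.mem_append]
    rcases hl with (hl | hl) | hl
    · exact .inl hl
    · exact .inr (.inl (ih₁ hG.1 hl))
    · exact .inr (.inr (ih₂ hG.2 hl))
  | choiceSkip _ _ _ _ ih₁ _ =>
    simp only [Proto.labels, Proto.steps, List.map_cons, List.map_append]
    exact List.mem_cons_of_mem _ (List.mem_append_left _ (ih₁ hG.1 hl))
  | choiceRRecv => exact hG.elim
  | choiceRSkipL => exact hG.elim
  | choiceRSkipR => exact hG.elim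
  | mu _ _ ih => exact ih hG hl
  | muSkip => exact hl.elim
  | rvar => exact hl.elim
  | fin => exact hl.elim

theorem EncG.eq_nil_or_rvar {G : Proto B} {P : Proc B} (h : EncG D γ s G P) (hs : s ∉ G.roles) :
    P = .nil ∨ ∃ i, P = .rvar i := by
  induction h <;> simp_all [Proto.roles]

theorem EncG.tree {S : Finset Role} {G : Proto B} {i : ℕ} (h : EncG D γ s G (.rvar i))
    (hG : G.Static) (hS : G.roles ⊆ S) : Tree S (.rvar i) G := by
  induction G with
  | com p l qs G ih =>
    simp only [Proto.roles, Finset.insert_subset_iff, Finset.union_subset_iff] at hS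
    cases h with
    | comSkip _ _ h => exact .com hS.1 hS.2.1 (ih h hG hS.2.2)
  | comR => exact hG.elim
  | choice p l qs G₁ G₂ ih₁ ih₂ =>
    simp only [Proto.roles, Finset.insert_subset_iff, Finset.union_subset_iff] at hS
    cases h with
    | choiceSkip _ _ h₁ h₂ =>
      exact .choice hS.1 hS.2.1.1 (ih₁ h₁ hG.1 hS.2.1.2) (ih₂ h₂ hG.2 hS.2.2)
  | choiceR => exact hG.elim
  | mu => cases h
  | rvar => cases h; exact .leaf
  | fin => cases h

theorem EncG.confined {ρ : List (Finset Role)} {S : Finset Role} {G : Proto B}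
    (h : EncG D γ s G .nil) (hN : G.NestOk ρ) (hG : G.Static) (hS : G.roles ⊆ S) :
    Confined ρ S G := by
  refine ⟨hG, hS, fun i A hA hi => ?_⟩
  induction G with
  | com p l qs G ih =>
    simp only [Proto.roles, Finset.insert_subset_iff, Finset.union_subset_iff] at hS
    cases h with
    | comSkip _ _ h => exact ih h hN hG hS.2.2 hi
  | comR => exact hG.elim
  | choice p l qs G₁ G₂ ih₁ ih₂ =>
    simp only [Proto.roles, Finset.insert_subset_iff, Finset.union_subset_iff] at hS
    cases h with
    | choiceSkip _ _ h₁ h₂ =>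
      rcases hi with hi | hi
      · exact ih₁ h₁ hN.1 hG.1 hS.2.1.2 hi
      · exact ih₂ h₂ hN.2 hG.2 hS.2.2 hi
  | choiceR => exact hG.elim
  | mu => exact (hN.1 i A hA hi).trans hS
  | rvar => cases h
  | fin => exact hi.elim

theorem Proto.NestOk.gOk (hγ : Function.Injective γ) {ρ : List (Finset Role)} {U : Finset Role}
    {G : Proto B} (hN : G.NestOk ρ) (hG : G.Static) (hl : G.labels.Nodup)
    (hst : ∀ t ∈ G.steps, Realises D t.1 t.2.1 t.2.2 ∧ t.2.2.Nonempty ∧ t.1 ∉ t.2.2)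
    (hocc : ∀ i, G.Occurs i → i < ρ.length)
    (hU : ∀ i A, ρ[i]? = some A → G.Occurs i → A ⊆ U) (hr : G.roles ⊆ U)
    (hE : ∀ s ∈ U, ∃ P, EncG D γ s G P) : GOk D ρ G := by
  induction G generalizing ρ U with
  | com p l qs G ih =>
    simp only [Proto.labels, Proto.steps, List.map_cons, List.nodup_cons] at hl
    simp only [Proto.steps, List.forall_mem_cons] at hst
    simp only [Proto.roles, Finset.insert_subset_iff, Finset.union_subset_iff] at hr
    refine ⟨hst.1, .of_static hG, ih hN hG hl.2 hst.2 hocc hU hr.2.2 fun s hs => ?_⟩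
    obtain ⟨P, h⟩ := hE s hs
    cases h with
    | comSend _ _ _ h => exact ⟨_, h⟩
    | comRecv _ _ _ _ _ h => exact ⟨_, h⟩
    | comSkip _ _ h => exact ⟨_, h⟩
  | comR => exact hG.elim
  | choice p l qs G₁ G₂ ih₁ ih₂ =>
    simp only [Proto.labels, Proto.steps, List.map_cons, List.map_append, List.nodup_cons] at hl
    simp only [Proto.steps, List.forall_mem_cons, List.forall_mem_append] at hst
    simp only [Proto.roles, Finset.insert_subset_iff, Finset.union_subset_iff] at hr
    have hE' : ∀ s ∈ U, ∃ P₁ P₂, EncG D γ s G₁ P₁ ∧ EncG D γ s G₂ P₂ ∧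
        (s ∉ insert p qs → P₁ = P₂) := by
      intro s hs
      obtain ⟨P, h⟩ := hE s hs
      cases h with
      | choiceSend _ _ _ h₁ h₂ => exact ⟨_, _, h₁, h₂, fun h => (h (by simp)).elim⟩
      | choiceRecv hq _ _ _ _ h₁ h₂ => exact ⟨_, _, h₁, h₂, fun h => (h (by simp [hq])).elim⟩
      | choiceSkip _ _ h₁ h₂ => exact ⟨_, _, h₁, h₂, fun _ => rfl⟩
    have hdis : ∀ l, l ∈ G₁.labels → l ∈ G₂.labels → False := fun l h₁ h₂ =>
      (List.nodup_append.1 hl.2).2.2 l h₁ l h₂ rfl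
    have hno : ∀ s ∈ U, s ∉ insert p qs → s ∉ G₁.roles ∧ s ∉ G₂.roles := by
      intro s hs hS
      obtain ⟨P, P', h₁, h₂, h⟩ := hE' s hs
      cases h hS
      constructor
      · intro hs
        obtain ⟨l, hl, h⟩ := h₁.exists_label hG.1 hs
        exact hdis l hl (h₂.mem_labels hγ hG.2 h)
      · intro hs
        obtain ⟨l, hl, h⟩ := h₂.exists_label hG.2 hs
        exact hdis l (h₁.mem_labels hγ hG.1 h) hl
    have hS₁ : G₁.roles ⊆ insert p qs := fun s hs => by
      by_contra hS
      exact (hno s (hr.2.1.2 hs) hS).1 hs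
    have hS₂ : G₂.roles ⊆ insert p qs := fun s hs => by
      by_contra hS
      exact (hno s (hr.2.2 hs) hS).2 hs
    have hA : Agree ρ (insert p qs) G₁ G₂ := by
      by_cases hUS : U ⊆ insert p qs
      · exact .inr ⟨⟨hG.1, hS₁, fun i A hA hi => (hU i A hA (.inl hi)).trans hUS⟩,
          hG.2, hS₂, fun i A hA hi => (hU i A hA (.inr hi)).trans hUS⟩
      · obtain ⟨s, hs, hsS⟩ := Finset.not_subset.1 hUS
        obtain ⟨P, P', h₁, h₂, h⟩ := hE' s hs
        cases h hsS
        rcases h₁.eq_nil_or_rvar (hno s hs hsS).1 with rfl | ⟨i, rfl⟩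
        · exact .inr ⟨h₁.confined hN.1 hG.1 hS₁, h₂.confined hN.2 hG.2 hS₂⟩
        · exact .inl ⟨_, h₁.tree hG.1 hS₁, h₂.tree hG.2 hS₂⟩
    refine ⟨hst.1, ⟨.of_static hG.1, .of_static hG.2⟩, hA, ?_, ?_⟩
    · refine ih₁ hN.1 hG.1 (List.nodup_append.1 hl.2).1 hst.2.1 (fun i hi => hocc i (.inl hi))
        (fun i A hA hi => hU i A hA (.inl hi)) hr.2.1.2 fun s hs => ?_
      obtain ⟨P, -, h, -⟩ := hE' s hs
      exact ⟨P, h⟩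
    · refine ih₂ hN.2 hG.2 (List.nodup_append.1 hl.2).2.1 hst.2.2 (fun i hi => hocc i (.inr hi))
        (fun i A hA hi => hU i A hA (.inr hi)) hr.2.2 fun s hs => ?_
      obtain ⟨-, P, -, h, -⟩ := hE' s hs
      exact ⟨P, h⟩
  | choiceR => exact hG.elim
  | mu G ih =>
    refine ⟨hG, hN.1, ih (U := G.roles) hN.2 hG hl hst (fun i hi => ?_) (fun i A hA hi => ?_)
      subset_rfl fun s hs => ?_⟩
    · cases i with
      | zero => simp
      | succ i => simpa using hocc i hi
    · cases i with
      | zero => simp only [List.getElem?_cons_zero, Option.some.injEq] at hA; rw [hA]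
      | succ i => exact hN.1 i A (by simpa using hA) hi
    · obtain ⟨P, h⟩ := hE s (hr hs)
      cases h with
      | mu _ h => exact ⟨_, h⟩
      | muSkip h => exact (h hs).elim
  | rvar i => exact hocc i rfl
  | fin => trivial

end Static

/-! ## Components at runtime -/

theorem Step.ins_eq {C C' : Comp B} {lam : Lab B} (h : Step C lam C') : C'.ins = C.ins := by
  cases h <;> rfl

theorem Step.outs_eq {C C' : Comp B} {lam : Lab B} (h : Step C lam C') : C'.outs = C.outs := by
  cases h <;> rfl

theorem Step.port_mem {C C' : Comp B} {a : Act B} (h : Step C (.act a) C') :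
    a.port ∈ C.ins ++ C.outs := by
  cases h <;> simp_all [Act.port, Comp.ins, Comp.outs]

theorem Steps.ins_eq {C C' : Comp B} (h : Steps C C') : C'.ins = C.ins := by
  induction h with
  | refl => rfl
  | tail _ h ih => rw [h.ins_eq, ih]

theorem Steps.outs_eq {C C' : Comp B} (h : Steps C C') : C'.outs = C.outs := by
  induction h with
  | refl => rfl
  | tail _ h ih => rw [h.outs_eq, ih]

theorem Accepts.mem_ins {C : Comp B} {x : Port} (h : Accepts C x) : x ∈ C.ins := by
  cases h <;> assumption

theorem mem_replace {α : Type*} {l₁ l₂ : List α} {a a' b : α} (h : b ∈ l₁ ++ a :: l₂) :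
    b ∈ l₁ ++ a' :: l₂ ∨ b = a := by
  simp only [List.mem_append, List.mem_cons] at h ⊢
  tauto

theorem exists_accepts_replace {R₁ R₂ : List (Role × Comp B)} {s t : Role} {C C' E : Comp B}
    {x : Port} (h : (t, E) ∈ R₁ ++ (s, C) :: R₂) (hE : Accepts E x)
    (hC : Accepts C x → Accepts C' x) :
    ∃ E', (t, E') ∈ R₁ ++ (s, C') :: R₂ ∧ Accepts E' x := by
  rcases mem_replace (a' := (s, C')) h with h | h
  · exact ⟨E, h, hE⟩
  · cases h
    exact ⟨C', by simp, hC hE⟩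

theorem Accepts.replace {xs ys : List Port} {D : List Conn} {r s : Role} {F : List Fwd}
    {R₁ R₂ : List (Role × Comp B)} {C C' : Comp B} {G G' : Proto B} {x : Port}
    (h : Accepts (.composite xs ys D r F (R₁ ++ (s, C) :: R₂) G) x)
    (hC : ∀ x, Accepts C x → Accepts C' x) :
    Accepts (.composite xs ys D r F (R₁ ++ (s, C') :: R₂) G') x := by
  cases h with
  | composite hx hF hE h =>
    obtain ⟨E', h₁, h₂⟩ := exists_accepts_replace hE h (hC _)
    exact .composite hx hF h₁ h₂

theorem Accepts.step {C C' : Comp B} {lam : Lab B} (h : Step C lam C') {x : Port}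
    (hx : Accepts C x) : Accepts C' x := by
  induction h generalizing x with
  | outBase => cases hx with | base hx => exact .base hx
  | inpBase => cases hx with | base hx => exact .base hx
  | outChor _ _ _ ih => exact hx.replace fun _ => ih
  | inpChor _ _ _ ih => exact hx.replace fun _ => ih
  | internal _ ih => exact hx.replace fun _ => ih
  | outComp _ _ _ ih => exact hx.replace fun _ => ih
  | inpComp _ _ _ ih => exact hx.replace fun _ => ih

/-- The invariant of components at runtime. -/
inductive RWF : Comp B → Prop
  | base {xs ys L} (hports : (xs ++ ys).Nodup) (hL : ∀ b ∈ L, b.Ok) : RWF (.base xs ys L)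
  | composite {xs ys D r F R G} (hports : (xs ++ ys).Nodup)
      (hsub : ∀ s C, (s, C) ∈ R → RWF C) (hG : GOk D [] G)
      (hext : (F.map Fwd.ext).Nodup) (hint : (F.map Fwd.int).Nodup) (hD : D.Nodup)
      (hdir : ∀ b ∈ D, ∀ φ ∈ F, (φ.dir = .inp → b.sender = r → b.sport ≠ φ.int) ∧
        (φ.dir = .out → b.receiver = r → b.rport ≠ φ.int))
      (hin : ∀ b ∈ D, ∃ C, (b.receiver, C) ∈ R ∧ Accepts C b.rport) :
      RWF (.composite xs ys D r F R G)

theorem RWF.ports_nodup {C : Comp B} (h : RWF C) : (C.ins ++ C.outs).Nodup := by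
  cases h <;> assumption

theorem RWF.replace {xs ys : List Port} {D : List Conn} {r s : Role} {F : List Fwd}
    {R₁ R₂ : List (Role × Comp B)} {C C' : Comp B} {G G' : Proto B} {lam : Lab B}
    (h : RWF (.composite xs ys D r F (R₁ ++ (s, C) :: R₂) G)) (hs : Step C lam C')
    (hC : RWF C → RWF C') (hG : GOk D [] G → GOk D [] G') :
    RWF (.composite xs ys D r F (R₁ ++ (s, C') :: R₂) G') := by
  cases h with
  | composite hports hsub hG₀ hext hint hD hdir hin =>
    refine .composite hports (fun t E hE => ?_) (hG hG₀) hext hint hD hdir fun b hb => ?_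
    · rcases mem_replace (a' := (s, C)) hE with h | h
      · exact hsub t E h
      · cases h
        exact hC (hsub s C (by simp))
    · obtain ⟨E, h₁, h₂⟩ := hin b hb
      exact exists_accepts_replace h₁ h₂ (.step hs)

theorem RWF.step {C C' : Comp B} {lam : Lab B} (hC : RWF C) (h : Step C lam C') : RWF C' := by
  induction h with
  | outBase h => cases hC with | base h₁ h₂ => exact .base h₁ (h.ok h₂)
  | inpBase h => cases hC with | base h₁ h₂ => exact .base h₁ (h.ok h₂)
  | outChor h _ hG ih => exact hC.replace h ih (.step hG)
  | inpChor h _ hG ih => exact hC.replace h ih (.step hG)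
  | internal h ih => exact hC.replace h ih id
  | outComp h _ _ ih => exact hC.replace h ih id
  | inpComp h _ _ ih => exact hC.replace h ih id

theorem RWF.steps {C C' : Comp B} (hC : RWF C) (h : Steps C C') : RWF C' := by
  induction h with
  | refl => exact hC
  | tail _ h ih => exact ih.step h

theorem EncR.exists_enc {γ : Key → Port} {dom : Set Key} {R : List (Role × Comp B)}
    {Qs : List (Proc B)} (h : EncR γ dom R Qs) {s : Role} {C : Comp B} (hC : (s, C) ∈ R) :
    ∃ Q, Enc C Q := by
  induction R generalizing Qs with
  | nil => simp at hC
  | cons t R ih =>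
    cases h with
    | cons h _ _ hR =>
      rcases List.mem_cons.1 hC with hC | hC
      · cases hC; exact ⟨_, h⟩
      · exact ih hR hC

theorem WF.rwf {C : Comp B} {E : Proc B} (hC : WF C) (hP : IsProgram C) (hE : Enc C E) : RWF C := by
  induction hC generalizing E with
  | base hports hdef =>
    cases hP with
    | base h => exact .base hports fun b hb σ hσ => by simp [h b hb] at hσ
  | @composite xs ys D r F R G hports hroles hsub hG hext hint hfwd hrecv hsend hreal hin hout ih =>
    cases hP with
    | composite hR hstat =>
    cases hE with
    | composite γ zs ps Qs Ms L hγ hnd hzs hfresh hFin hFout hps hps' hQs hMs hL =>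
    have huniq : ∀ {s : Role} {C C' : Comp B}, (s, C) ∈ R → (s, C') ∈ R → C = C' := by
      intro s C C' h h'
      have := List.inj_on_of_nodup_map hroles h h' rfl
      cases this
      rfl
    refine .composite hports (fun s C h => ?_) ?_ hext hint (.of_map _ hrecv) ?_ hin
    · obtain ⟨Q, hQ⟩ := hQs.exists_enc h
      exact ih s C h (hR s C h) hQ
    · refine hG.2.2.2.gOk (U := G.roles) hγ hstat hG.2.1
        (fun t ht => ⟨hreal t ht, hG.2.2.1 t ht⟩) (fun i hi => (hG.1 i hi).elim) (by simp)
        subset_rfl fun s hs => ?_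
      obtain ⟨i, hi, rfl⟩ := List.getElem_of_mem ((hps' s).2 hs)
      exact ⟨_, (List.forall₂_iff_get.1 hMs).2 i hi (by rw [← hMs.length_eq]; exact hi)⟩
    · intro b hb φ hφ
      obtain ⟨C, hC, h₁, h₂⟩ := hfwd φ hφ
      have hC' := (ih _ _ hC (hR _ _ hC) (hQs.exists_enc hC).choose_spec).ports_nodup
      rw [List.nodup_append] at hC'
      constructor
      · rintro hd hs h
        obtain ⟨C', hC₁, h₃⟩ := hout b hb
        cases huniq hC (hs ▸ hC₁)
        exact hC'.2.2 _ (h₁ hd).2 _ h₃ h.symm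
      · rintro hd hs h
        obtain ⟨C', hC₁, h₃⟩ := hin b hb
        cases huniq hC (hs ▸ hC₁)
        exact hC'.2.2 _ h₃.mem_ins _ (h₂ hd).2 h

theorem IsConfiguration.rwf {C : Comp B} (h : IsConfiguration C) : RWF C := by
  obtain ⟨C₀, E₀, h₁, h₂, h₃, h₄⟩ := h
  have := h₂.rwf h₁ h₃
  induction h₄ with
  | refl => exact this
  | tail _ h ih => obtain ⟨lam, h⟩ := h; exact ih.step h

/-! ## Monitors at runtime -/

/-- The status of a monitor: it is idle, or it has received a value from its component that it has
not yet put into the queue, or it has received a value from the queue that it has not yet delivered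
to its component. -/
inductive Status (B : Type u) where
  | idle : Status B
  | sending : MLabel → Val B → Status B
  | receiving : MLabel → Val B → Status B

/-- The value with label `l` taken out of the queue. -/
def Status.received (l : MLabel) : Status B → List (Val B)
  | .receiving l' v => if l' = l then [v] else []
  | _ => []

/-- The value with label `l` to be put into the queue. -/
def Status.sent (l : MLabel) : Status B → List (Val B)
  | .sending l' v => if l' = l then [v] else []
  | _ => []

section Monitor

variable {D : List Conn} {γ : Key → Port}

/-- `MonSt D γ G p M st`: the process `M` is a monitor for the role `p` in the protocol `G` with the
status `st`. -/
def MonSt (D : List Conn) (γ : Key → Port) (G : Proto B) (p : Role) (M : Proc B) :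
    Status B → Prop
  | .idle => ∃ M₀, EncG D γ p G M₀ ∧ Unf M M₀
  | .sending l v => (∃ b ∈ D, b.label = l ∧ b.sender = p) ∧ RealLabel D l ∅ ∧
      ∃ M₀, EncG D γ p G M₀ ∧ Unf M (.out (γ (.label p l)) (.val v) M₀)
  | .receiving l v => ∃ M₀ M₁, EncG D γ p G M₀ ∧
      PStep M₀ (.prim (.inp (γ (.label p l)) v)) M₁ ∧ Unf M M₁

theorem MonSt.step_of_ne {G G' : Proto B} {p : Role} {M : Proc B} {st : Status B} {a : GAct B}
    (h : MonSt D γ G p M st) (hG : GOk D [] G) (hs : GStep G a G') (ha : a.role ≠ p) :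
    MonSt D γ G' p M st := by
  cases st with
  | idle =>
    obtain ⟨M₀, h₁, h₂⟩ := h
    obtain ⟨M₀', h₃, h₄⟩ := h₁.step_of_ne hG hs ha
    exact ⟨M₀', h₃, h₂.trans h₄⟩
  | sending l v =>
    obtain ⟨hb, hR, M₀, h₁, h₂⟩ := h
    obtain ⟨M₀', h₃, h₄⟩ := h₁.step_of_ne hG hs ha
    exact ⟨hb, hR, M₀', h₃, h₂.trans (.out h₄)⟩
  | receiving l v =>
    obtain ⟨M₀, M₁, h₁, h₂, h₃⟩ := h
    obtain ⟨M₀', h₄, h₅⟩ := h₁.step_of_ne hG hs ha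
    obtain ⟨M₁', h₆, h₇⟩ := h₅.step h₂
    exact ⟨M₀', M₁', h₄, h₆, h₃.trans h₇⟩

/-- The transitions of a monitor. -/
inductive MonMove (D : List Conn) (γ : Key → Port) (G : Proto B) (p : Role) :
    Status B → Act B → Proc B → Prop
  | take {b v G' M'} (hb : b ∈ D) (hs : b.sender = p) (hR : RealLabel D b.label ∅)
      (hG : GStep G (.send p b.label v) G') (h : MonSt D γ G' p M' (.sending b.label v)) :
      MonMove D γ G p .idle (.inp (γ (.port p b.sport)) v) M'
  | pop {b v M'} (hb : b ∈ D) (hr : b.receiver = p) (hR : RealLabel D b.label ∅)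
      (h : MonSt D γ G p M' (.receiving b.label v)) :
      MonMove D γ G p .idle (.inp (γ (.label p b.label)) v) M'
  | push {b v M'} (hb : b ∈ D) (hs : b.sender = p) (hR : RealLabel D b.label ∅)
      (h : MonSt D γ G p M' .idle) :
      MonMove D γ G p (.sending b.label v) (.out (γ (.label p b.label)) v) M'
  | deliver {b v M'} (hb : b ∈ D) (hr : b.receiver = p) (hR : RealLabel D b.label ∅)
      (h : ∀ vs, fillv p b.label G = v :: vs →
        ∃ G', GStep G (.recv p b.label v) G' ∧ MonSt D γ G' p M' .idle) :
      MonMove D γ G p (.receiving b.label v) (.out (γ (.port p b.rport)) v) M'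

theorem MonSt.move (hγ : Function.Injective γ) {G : Proto B} {p : Role} {M M' : Proc B}
    {st : Status B} {lam : PLab B} (h : MonSt D γ G p M st) (hG : GOk D [] G)
    (hs : PStep M lam M') : ∃ a, lam = .prim a ∧ MonMove D γ G p st a M' := by
  cases st with
  | idle =>
    obtain ⟨M₀, h₁, h₂⟩ := h
    obtain ⟨M₁, h₃, h₄⟩ := h₂.step hs
    obtain ⟨b, hb, v, P, hR, ⟨hp, rfl, rfl, G', hG', hE⟩ | ⟨hp, rfl, rfl, -⟩⟩ := h₁.monStep hG h₃
    · exact ⟨_, rfl, .take hb hp hR hG' ⟨⟨b, hb, rfl, hp⟩, hR, P, hE, h₄⟩⟩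
    · exact ⟨_, rfl, .pop hb hp hR ⟨M₀, _, h₁, h₃, h₄⟩⟩
  | sending l v =>
    obtain ⟨⟨b, hb, rfl, hp⟩, hR, M₀, h₁, h₂⟩ := h
    obtain ⟨M₁, h₃, h₄⟩ := h₂.step hs
    cases h₃ with
    | out => exact ⟨_, rfl, .push hb hp hR ⟨M₀, h₁, h₄⟩⟩
  | receiving l v =>
    obtain ⟨M₀, M₁, h₁, h₂, h₃⟩ := h
    obtain ⟨M₂, h₄, h₅⟩ := h₃.step hs
    obtain ⟨b, hb, w, P, hR, ⟨hp, h₆, -⟩ | ⟨hp, h₆, rfl, h₇⟩⟩ := h₁.monStep hG h₂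
    · simp only [PLab.prim.injEq, Act.inp.injEq, hγ.eq_iff, reduceCtorEq, false_and] at h₆
    · simp only [PLab.prim.injEq, Act.inp.injEq, hγ.eq_iff, Key.label.injEq, true_and] at h₆
      obtain ⟨rfl, rfl⟩ := h₆
      cases h₄ with
      | out =>
        refine ⟨_, rfl, .deliver hb hp hR fun vs hvs => ?_⟩
        obtain ⟨G', h₈, h₉⟩ := h₇ vs hvs
        exact ⟨G', h₈, _, h₉, h₅⟩

theorem MonSt.exists_step (hγ : Function.Injective γ) {G : Proto B} {p : Role} {M : Proc B}
    {st : Status B} (h : MonSt D γ G p M st) (hG : GOk D [] G) (hst : st ≠ .idle) :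
    ∃ a M', PStep M (.prim a) M' ∧ MonMove D γ G p st a M' := by
  have : ∃ lam M', PStep M lam M' := by
    cases st with
    | idle => exact (hst rfl).elim
    | sending l v =>
      obtain ⟨-, -, M₀, -, h₂⟩ := h
      obtain ⟨M', h, -⟩ := h₂.exists_out
      exact ⟨_, M', h⟩
    | receiving l v =>
      obtain ⟨M₀, M₁, h₁, h₂, h₃⟩ := h
      obtain ⟨b, hb, w, N, hR, h₄⟩ := h₁.monStep hG h₂
      have : ∃ z, M₁ = .out z (.val w) N := h₄.elim (fun h => ⟨_, h.2.2.1⟩) fun h => ⟨_, h.2.2.1⟩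
      obtain ⟨z, rfl⟩ := this
      obtain ⟨M', h, -⟩ := h₃.exists_out
      exact ⟨_, M', h⟩
  obtain ⟨lam, M', hs⟩ := this
  obtain ⟨a, rfl, h'⟩ := h.move hγ hG hs
  exact ⟨a, M', hs, h'⟩

end Monitor

/-! ## Simulations -/

/-- Rename the port of an action. -/
def Act.map (g : Port → Port) : Act B → Act B
  | .out y v => .out (g y) v
  | .inp x v => .inp (g x) v

/-- Simulations of processes by components that can be completed to encodings. -/
structure Sim (T : Comp B → Proc B → Prop) : Prop where
  rwf : ∀ {C P}, T C P → RWF C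
  step : ∀ {C P lam P'}, T C P → PStep P lam P' →
    (lam = .tau ∧ ∃ C', Steps C C' ∧ T C' P') ∨
      ∃ a C', lam = .queue a ∧ Step C (.act a) C' ∧ T C' P'
  accepts : ∀ {C P x}, T C P → Accepts C x → ∀ v, ∃ P', PStep P (.queue (.inp x v)) P'
  complete : ∀ {C P}, T C P →
    ∃ C' P' E, Steps C C' ∧ PSteps P P' ∧ SCong P' E ∧ Enc C' E

/-- The forwarders around the encoding of a component with the role `p`. -/
def plugFwds (γ : Key → Port) (p : Role) (xs ys : List Port) : List (Dir × Port × Port) :=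
  xs.map (fun x => (.inp, γ (.port p x), x)) ++ ys.map fun y => (.out, γ (.port p y), y)

/-- `Plugged T γ dom t Q`: the process `Q` is related by `T` to the role assignment `t`, up to the
forwarders for its role. -/
def Plugged (T : Comp B → Proc B → Prop) (γ : Key → Port) (dom : Set Key) (t : Role × Comp B)
    (Q : Proc B) : Prop :=
  ∃ Q₀, T t.2 Q₀ ∧ (∀ x, x ∈ t.2.ins ∨ x ∈ t.2.outs → .port t.1 x ∈ dom) ∧
    (∀ k ∈ dom, γ k ∉ t.2.ins ∧ γ k ∉ t.2.outs) ∧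
    Q = nus (t.2.ins ++ t.2.outs) (fwdList (plugFwds γ t.1 t.2.ins t.2.outs) Q₀)

theorem mem_plugFwds {γ : Key → Port} {p : Role} {xs ys : List Port} {t : Dir × Port × Port}
    (h : t ∈ plugFwds γ p xs ys) :
    t.2.1 = γ (.port p t.2.2) ∧ (t.1 = .inp ∧ t.2.2 ∈ xs ∨ t.1 = .out ∧ t.2.2 ∈ ys) := by
  simp only [plugFwds, List.mem_append, List.mem_map] at h
  rcases h with ⟨x, hx, rfl⟩ | ⟨y, hy, rfl⟩ <;> simp_all

section Plugged

variable {T : Comp B → Proc B → Prop} {γ : Key → Port} {dom : Set Key} {p : Role} {C : Comp B}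
  {Q Q' : Proc B} {lam : PLab B}

theorem plugFwds_ne {xs ys : List Port} (hdom : ∀ x, x ∈ xs ∨ x ∈ ys → Key.port p x ∈ dom)
    (hfresh : ∀ k ∈ dom, γ k ∉ xs ∧ γ k ∉ ys) :
    ∀ t ∈ plugFwds γ p xs ys, ∀ t' ∈ plugFwds γ p xs ys, t.2.1 ≠ t'.2.2 := by
  intro t ht t' ht' h
  obtain ⟨h₁, h₂⟩ := mem_plugFwds ht
  obtain ⟨-, h₃⟩ := mem_plugFwds ht'
  have := hfresh _ (hdom t.2.2 (h₂.imp And.right And.right))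
  rw [← h₁, h] at this
  rcases h₃ with h₃ | h₃
  · exact this.1 h₃.2
  · exact this.2 h₃.2

theorem Plugged.step (hT : Sim T) (h : Plugged T γ dom (p, C) Q) (hs : PStep Q lam Q') :
    (lam = .tau ∧ ∃ C', Steps C C' ∧ Plugged T γ dom (p, C') Q') ∨
      ∃ a C', lam = .queue (a.map fun x => γ (.port p x)) ∧ Step C (.act a) C' ∧
        Plugged T γ dom (p, C') Q' := by
  obtain ⟨Q₀, h₁, h₂, h₃, rfl⟩ := h
  obtain ⟨Q₁, hs', hz, rfl⟩ := hs.of_nus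
  obtain ⟨lam', Q₂, hs'', hlam, rfl⟩ := hs'.of_fwdList (plugFwds_ne h₂ h₃)
  rcases hT.step h₁ hs'' with ⟨rfl, C', hC, hT'⟩ | ⟨a, C', rfl, hC, hT'⟩
  · cases hlam with
    | pass =>
      refine .inl ⟨rfl, C', hC, Q₂, hT', ?_⟩
      simp only [hC.ins_eq, hC.outs_eq]
      exact ⟨h₂, h₃, trivial⟩
  · have hP : Plugged T γ dom (p, C')
        (nus (C.ins ++ C.outs) (fwdList (plugFwds γ p C.ins C.outs) Q₂)) := by
      refine ⟨Q₂, hT', ?_⟩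
      simp only [hC.ins_eq, hC.outs_eq]
      exact ⟨h₂, h₃, trivial⟩
    right
    refine ⟨a, C', ?_, hC, hP⟩
    cases hlam with
    | pass h => exact (hz _ hC.port_mem rfl).elim
    | queueInp h => exact congrArg (fun z => PLab.queue (.inp z _)) (mem_plugFwds h).1
    | queueOut h => exact congrArg (fun z => PLab.queue (.out z _)) (mem_plugFwds h).1

theorem Plugged.accepts (hT : Sim T) (hγ : Function.Injective γ) (h : Plugged T γ dom (p, C) Q)
    {x : Port} (hx : Accepts C x) (v : Val B) :
    ∃ Q', PStep Q (.queue (.inp (γ (.port p x)) v)) Q' := by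
  obtain ⟨Q₀, h₁, h₂, h₃, rfl⟩ := h
  obtain ⟨Q₁, hs⟩ := hT.accepts h₁ hx v
  have hnd := (hT.rwf h₁).ports_nodup
  refine ⟨_, .nus (hs.fwdList_inp (z := γ (.port p x)) ?_ ?_ ?_ (plugFwds_ne h₂ h₃)) ?_⟩
  · exact List.mem_append_left _ (List.mem_map.2 ⟨x, hx.mem_ins, rfl⟩)
  · have : (plugFwds γ p C.ins C.outs).map (fun t => t.2.1) =
        (C.ins ++ C.outs).map fun x => γ (.port p x) := by
      simp [plugFwds, Function.comp_def]
    simp only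
    rw [this]
    exact hnd.map fun a b h => by simpa [hγ.eq_iff] using h
  · have : (plugFwds γ p C.ins C.outs).map (fun t => t.2.2) = C.ins ++ C.outs := by
      simp [plugFwds, Function.comp_def]
    simp only
    rwa [this]
  · intro z hz h
    have := h₃ _ (h₂ x (.inl hx.mem_ins))
    simp only [Act.port] at h
    rw [h] at this
    simp only [List.mem_append] at hz
    exact hz.elim this.1 this.2

end Plugged

/-! ## Layers -/

/-- The processes in the encoding of a composite component, without restrictions and forwarders. -/
def innerProc (γ : Key → Port) (D : List Conn) (Qs : List (Proc B)) (ps : List Role)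
    (m : Role → Proc B) (c : Conn → List (Val B)) : Proc B :=
  parList Qs (parList (ps.map m)
    (.box (queuePorts γ D) (D.map fun b => queueWith γ b (c b))))

/-- The invariant of `innerProc`: the monitors `m` of the roles `ps` have the status `st`, and `c`
are the values in the queues. -/
structure Layer (T : Comp B → Proc B → Prop) (γ : Key → Port) (dom : Set Key) (D : List Conn)
    (ps : List Role) (R : List (Role × Comp B)) (G : Proto B) (Qs : List (Proc B))
    (m : Role → Proc B) (st : Role → Status B) (c : Conn → List (Val B)) : Prop where
  plugged : List.Forall₂ (Plugged T γ dom) R Qs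
  roles : ∀ p ∈ G.roles, p ∈ ps
  idle : ∀ p, p ∉ ps → st p = .idle
  mon : ∀ p ∈ ps, MonSt D γ G p (m p) (st p)
  queues : ∀ b ∈ D, fillv b.receiver b.label G =
    (st b.receiver).received b.label ++ (c b ++ (st b.sender).sent b.label)

theorem RealLabel.sender_eq {D : List Conn} {b d : Conn} {qs : Finset Role}
    (h : RealLabel D b.label qs) (hb : b ∈ D) (hd : d ∈ D) (hl : d.label = b.label) :
    d.sender = b.sender := by
  obtain ⟨p, qs₀, hR, -⟩ := h
  rw [(hR.sender_eq hb rfl).1, (hR.sender_eq hd hl).1]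

theorem RealLabel.eq_of_receiver {D : List Conn} {b d : Conn} {qs : Finset Role}
    (h : RealLabel D b.label qs) (hb : b ∈ D) (hd : d ∈ D) (hl : d.label = b.label)
    (hr : d.receiver = b.receiver) : d = b := by
  obtain ⟨p, qs₀, hR, -⟩ := h
  exact hR.eq_of_receiver hd hl hb rfl hr

section Layer

variable {T : Comp B → Proc B → Prop} {γ : Key → Port} {dom : Set Key} {D : List Conn}
  {ps : List Role} {R R' : List (Role × Comp B)} {G G' : Proto B} {Qs Qs' : List (Proc B)}
  {m : Role → Proc B} {st : Role → Status B} {c c' : Conn → List (Val B)}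
  {p : Role} {M : Proc B} {b : Conn} {v : Val B} {vs : List (Val B)}

theorem Layer.pop (h : Layer T γ dom D ps R G Qs m st c) (hp : p ∈ ps) (hst : st p = .idle) (hb : b ∈ D)
    (hr : b.receiver = p) (hR : RealLabel D b.label ∅) (hc : c b = v :: vs) (hc₁ : c' b = vs)
    (hc₂ : ∀ d, d ≠ b → c' d = c d) (hM : MonSt D γ G p M (.receiving b.label v)) :
    Layer T γ dom D ps R G Qs (Function.update m p M)
      (Function.update st p (.receiving b.label v)) c' where
  plugged := h.plugged
  roles := h.roles
  idle q hq := by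
    rw [Function.update_of_ne (fun h : q = p => hq (h ▸ hp)), h.idle q hq]
  mon q hq := by
    by_cases hqp : q = p
    · subst hqp; simpa using hM
    · simpa [hqp] using h.mon q hq
  queues d hd := by
    have hsent : (Function.update st p (.receiving b.label v) d.sender).sent d.label =
        (st d.sender).sent d.label := by
      by_cases hqp : d.sender = p
      · simp [hqp, hst, Status.sent]
      · simp [hqp]
    rw [h.queues d hd, hsent]
    by_cases hdb : d = b
    · subst hdb
      simp [hr, hst, Status.received, hc, hc₁]
    · rw [hc₂ d hdb]
      congr 1
      by_cases hqp : d.receiver = p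
      · have hl : b.label ≠ d.label := fun hl => hdb (hR.eq_of_receiver hb hd hl.symm
          (by rw [hr, hqp]))
        simp [hqp, hst, Status.received, hl]
      · simp [hqp]

theorem Layer.push (hγ : Function.Injective γ) (h : Layer T γ dom D ps R G Qs m st c)
    (hst : st p = .sending b.label v) (hM : MonSt D γ G p M .idle) :
    Layer T γ dom D ps R G Qs (Function.update m p M) (Function.update st p .idle)
      fun d => c d ++ if γ (.label d.sender d.label) = γ (.label p b.label) then [v] else [] where
  plugged := h.plugged
  roles := h.roles
  idle q hq := by
    by_cases hqp : q = p
    · simp [hqp]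
    · simpa [hqp] using h.idle q hq
  mon q hq := by
    by_cases hqp : q = p
    · subst hqp; simpa using hM
    · simpa [hqp] using h.mon q hq
  queues d hd := by
    have hrec : (Function.update st p .idle d.receiver).received d.label =
        (st d.receiver).received d.label := by
      by_cases hqp : d.receiver = p
      · simp [hqp, hst, Status.received]
      · simp [hqp]
    rw [h.queues d hd, hrec]
    simp only [hγ.eq_iff, Key.label.injEq, List.append_assoc]
    congr 2
    by_cases hqp : d.sender = p
    · simp [hqp, hst, Status.sent, eq_comm]
    · simp [hqp]

theorem Layer.emit (h : Layer T γ dom D ps R G Qs m st c) (hG : GOk D [] G) (hb : b ∈ D)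
    (hs : b.sender = p) (hR : RealLabel D b.label ∅) (hp : p ∈ ps) (hst : st p = .idle)
    (hG' : GStep G (.send p b.label v) G') (hM : MonSt D γ G' p M (.sending b.label v))
    (hQ : List.Forall₂ (Plugged T γ dom) R' Qs') :
    Layer T γ dom D ps R' G' Qs' (Function.update m p M)
      (Function.update st p (.sending b.label v)) c where
  plugged := hQ
  roles q hq := h.roles q (hG'.roles_subset hG hq)
  idle q hq := by
    rw [Function.update_of_ne (fun h : q = p => hq (h ▸ hp)), h.idle q hq]
  mon q hq := by
    by_cases hqp : q = p
    · subst hqp; simpa using hM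
    · simpa [hqp] using (h.mon q hq).step_of_ne hG hG' (Ne.symm hqp)
  queues d hd := by
    have hrec : (Function.update st p (.sending b.label v) d.receiver).received d.label =
        (st d.receiver).received d.label := by
      by_cases hqp : d.receiver = p
      · simp [hqp, hst, Status.received]
      · simp [hqp]
    rw [hG'.fillv_send hG hd, h.queues d hd, hrec]
    simp only [List.append_assoc]
    congr 2
    by_cases hqp : d.sender = p
    · simp [hqp, hst, Status.sent, eq_comm]
    · have hl : d.label ≠ b.label := fun hl => hqp (by rw [hR.sender_eq hb hd hl, hs])
      simp [hqp, hl]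

theorem Layer.deliver (h : Layer T γ dom D ps R G Qs m st c) (hG : GOk D [] G)
    (hst : st p = .receiving b.label v)
    (hG' : GStep G (.recv p b.label v) G') (hM : MonSt D γ G' p M .idle)
    (hQ : List.Forall₂ (Plugged T γ dom) R' Qs') :
    Layer T γ dom D ps R' G' Qs' (Function.update m p M) (Function.update st p .idle) c where
  plugged := hQ
  roles q hq := h.roles q (hG'.roles_subset hG hq)
  idle q hq := by
    by_cases hqp : q = p
    · simp [hqp]
    · simpa [hqp] using h.idle q hq
  mon q hq := by
    by_cases hqp : q = p
    · subst hqp; simpa using hM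
    · simpa [hqp] using (h.mon q hq).step_of_ne hG hG' (Ne.symm hqp)
  queues d hd := by
    have hsent : (Function.update st p .idle d.sender).sent d.label =
        (st d.sender).sent d.label := by
      by_cases hqp : d.sender = p
      · simp [hqp, hst, Status.sent]
      · simp [hqp]
    have := h.queues d hd
    rw [hG'.fillv_recv hG] at this
    rw [hsent]
    by_cases hqp : d.receiver = p
    · simp only [hqp, hst, Status.received, true_and] at this
      simp only [hqp, Function.update_self, Status.received, List.nil_append]
      by_cases hl : d.label = b.label
      · simpa [hl] using this
      · simpa [hl, Ne.symm hl] using this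
    · simpa [hqp] using this

end Layer

theorem exists_split_map_update {α β : Type*} [DecidableEq α] {l : List α} (hl : l.Nodup)
    (f : α → β) {a : α} (ha : a ∈ l) : ∃ l₁ l₂, l.map f = l₁ ++ f a :: l₂ ∧
      ∀ y, l₁ ++ y :: l₂ = l.map (Function.update f a y) := by
  obtain ⟨s, t, rfl⟩ := List.append_of_mem ha
  rw [List.nodup_append, List.nodup_cons] at hl
  refine ⟨s.map f, t.map f, by simp, fun y => ?_⟩
  simp only [List.map_append, List.map_cons, Function.update_self]
  congr 1
  · exact List.map_congr_left fun x hx =>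
      (Function.update_of_ne (hl.2.2 x hx a (by simp)) _ _).symm
  · congr 1
    exact List.map_congr_left fun x hx =>
      (Function.update_of_ne (fun h : x = a => hl.2.1.1 (h ▸ hx)) _ _).symm

theorem map_eq_append_cons_update {α β : Type*} [DecidableEq α] {l : List α} (hl : l.Nodup)
    {f : α → β} {l₁ l₂ : List β} {x : β} (h : l.map f = l₁ ++ x :: l₂) :
    ∃ a ∈ l, f a = x ∧ ∀ y, l₁ ++ y :: l₂ = l.map (Function.update f a y) := by
  obtain ⟨s, _, rfl, rfl, h'⟩ := List.map_eq_append_iff.1 h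
  obtain ⟨a, t, rfl, rfl, rfl⟩ := List.map_eq_cons_iff.1 h'
  rw [List.nodup_append, List.nodup_cons] at hl
  refine ⟨a, by simp, rfl, fun y => ?_⟩
  simp only [List.map_append, List.map_cons, Function.update_self]
  congr 1
  · exact List.map_congr_left fun x hx =>
      (Function.update_of_ne (hl.2.2 x hx a (by simp)) _ _).symm
  · congr 1
    exact List.map_congr_left fun x hx =>
      (Function.update_of_ne (fun h : x = a => hl.2.1.1 (h ▸ hx)) _ _).symm

theorem forall₂_split_right {α β : Type*} {r : α → β → Prop} {l : List α} {l₁ l₂ : List β} {y : β}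
    (h : List.Forall₂ r l (l₁ ++ y :: l₂)) : ∃ k₁ x k₂, l = k₁ ++ x :: k₂ ∧ r x y ∧
      ∀ x' y', r x' y' → List.Forall₂ r (k₁ ++ x' :: k₂) (l₁ ++ y' :: l₂) := by
  induction l₁ generalizing l with
  | nil =>
    cases h with
    | cons h₁ h₂ => exact ⟨[], _, _, rfl, h₁, fun x' y' h => .cons h h₂⟩
  | cons z l₁ ih =>
    cases h with
    | cons h₁ h₂ =>
      obtain ⟨k₁, x, k₂, rfl, h₃, h₄⟩ := ih h₂
      exact ⟨_ :: k₁, x, k₂, rfl, h₃, fun x' y' h => .cons h₁ (h₄ x' y' h)⟩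

theorem forall₂_split_left {α β : Type*} {r : α → β → Prop} {l₁ l₂ : List α} {x : α} {l : List β}
    (h : List.Forall₂ r (l₁ ++ x :: l₂) l) : ∃ k₁ y k₂, l = k₁ ++ y :: k₂ ∧ r x y ∧
      ∀ x' y', r x' y' → List.Forall₂ r (l₁ ++ x' :: l₂) (k₁ ++ y' :: k₂) := by
  obtain ⟨k₁, y, k₂, h₁, h₂, h₃⟩ := forall₂_split_right h.flip
  exact ⟨k₁, y, k₂, h₁, h₂, fun x' y' h => (h₃ y' x' h).flip⟩

theorem Steps.replace {C C' : Comp B} (h : Steps C C') (xs ys : List Port) (D : List Conn)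
    (r : Role) (F : List Fwd) (R₁ R₂ : List (Role × Comp B)) (s : Role) (G : Proto B) :
    Steps (.composite xs ys D r F (R₁ ++ (s, C) :: R₂) G)
      (.composite xs ys D r F (R₁ ++ (s, C') :: R₂) G) := by
  induction h with
  | refl => exact .refl
  | tail _ h ih => exact ih.tail (.internal h)

theorem PSteps.lift {f : Proc B → Proc B} (hf : ∀ {P P'}, PStep P .tau P' → PStep (f P) .tau (f P'))
    {P P' : Proc B} (h : PSteps P P') : PSteps (f P) (f P') := by
  induction h with
  | refl => exact .refl
  | tail _ h ih => exact ih.tail (hf h)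

/-! ## Transitions of layers -/

section Layer

variable {T : Comp B → Proc B → Prop} {γ : Key → Port} {dom : Set Key} {D : List Conn}
  {ps : List Role} {R : List (Role × Comp B)} {G : Proto B} {Qs : List (Proc B)}
  {m : Role → Proc B} {st : Role → Status B} {c : Conn → List (Val B)}

theorem PStep.of_queues {S : Proc B} {γ : Key → Port} {a : Act B}
    {L : List (LBinder B)} (h : PStep (.box (queuePorts γ D) L) (.queue a) S) :
    ∃ L', LStep L a L' ∧ S = .box (queuePorts γ D) L' ∧
      ∃ b ∈ D, a.port = γ (.label b.receiver b.label) ∨ a.port = γ (.label b.sender b.label) := by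
  cases h with
  | act h ha => exact ⟨_, h, rfl, ha⟩

theorem Layer.plugged_no_prim (hT : Sim T) (h : Layer T γ dom D ps R G Qs m st c) :
    ∀ Q ∈ Qs, ∀ a Q', ¬ PStep Q (.prim a) Q' := by
  intro Q hQ a Q' hs
  obtain ⟨l₁, l₂, rfl⟩ := List.append_of_mem hQ
  obtain ⟨k₁, ⟨t, C⟩, k₂, rfl, h₁, -⟩ := forall₂_split_right h.plugged
  rcases h₁.step hT hs with ⟨h, -⟩ | ⟨a, C', h, -⟩ <;> cases h

theorem Layer.mon_prim (hγ : Function.Injective γ) (hG : GOk D [] G)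
    (h : Layer T γ dom D ps R G Qs m st c) :
    ∀ M ∈ ps.map m, ∀ lam M', PStep M lam M' → ∃ a, lam = .prim a := by
  intro M hM lam M' hs
  obtain ⟨p, hp, rfl⟩ := List.mem_map.1 hM
  obtain ⟨a, ha, -⟩ := (h.mon p hp).move hγ hG hs
  exact ⟨a, ha⟩

theorem box_queue {S : Set Port} {L : List (LBinder B)} :
    ∀ lam P', PStep (.box S L) lam P' → ∃ a, lam = .queue a := by
  intro lam P' h
  cases h with
  | act => exact ⟨_, rfl⟩

/-- A transition on one of the ports that connect the parts of a layer. -/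
def InternalLab (γ : Key → Port) (D : List Conn) (lam : PLab B) : Prop :=
  ∃ b ∈ D, (∃ v, lam = .prim (.inp (γ (.port b.sender b.sport)) v) ∨
      lam = .prim (.out (γ (.port b.receiver b.rport)) v)) ∨
    ∃ a, (lam = .queue a ∨ lam = .prim a) ∧
      (a.port = γ (.label b.receiver b.label) ∨ a.port = γ (.label b.sender b.label))

theorem Layer.step (hT : Sim T) (hγ : Function.Injective γ) (hps : ps.Nodup) (hD : D.Nodup)
    (hG : GOk D [] G) (h : Layer T γ dom D ps R G Qs m st c) {lam : PLab B} {S : Proc B}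
    (hs : PStep (innerProc γ D Qs ps m c) lam S) :
    (lam = .tau ∧ ∃ R' G' Qs' m' st' c', (∀ xs ys r F,
        Steps (.composite xs ys D r F R G) (.composite xs ys D r F R' G')) ∧
        Layer T γ dom D ps R' G' Qs' m' st' c' ∧ S = innerProc γ D Qs' ps m' c') ∨
      (∃ R₁ t C C' R₂ a Qs', lam = .queue (a.map fun x => γ (.port t x)) ∧
        R = R₁ ++ (t, C) :: R₂ ∧ Step C (.act a) C' ∧
        Layer T γ dom D ps (R₁ ++ (t, C') :: R₂) G Qs' m st c ∧ S = innerProc γ D Qs' ps m c) ∨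
      InternalLab γ D lam := by
  rcases hs.of_parList_queue (h.plugged_no_prim hT) with ⟨l₁, Q, l₂, Q', rfl, hs₁, rfl⟩ |
    ⟨P', hs₁, rfl⟩ | ⟨a, l₁, Q, l₂, Q', P', rfl, rfl, hs₁, hs₂, rfl⟩
  · obtain ⟨R₁, ⟨t, C⟩, R₂, rfl, h₁, h₂⟩ := forall₂_split_right h.plugged
    rcases h₁.step hT hs₁ with ⟨rfl, C', hC, h₃⟩ | ⟨a, C', rfl, hC, h₃⟩
    · exact .inl ⟨rfl, _, _, _, _, _, _, fun _ _ _ _ => hC.replace .., 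
        { h with plugged := h₂ _ _ h₃ }, rfl⟩
    · exact .inr (.inl ⟨R₁, t, C, C', R₂, a, _, rfl, rfl, hC,
        { h with plugged := h₂ _ _ h₃ }, rfl⟩)
  · rcases hs₁.of_parList_prim (h.mon_prim hγ hG) box_queue with
      ⟨a, l₁, M, l₂, M', rfl, hl, hM, rfl⟩ | ⟨a, P', rfl, hs₃, rfl⟩ |
      ⟨a, l₁, M, l₂, M', P', rfl, hl, hM, hB, rfl⟩
    · obtain ⟨p, hp, rfl, -⟩ := map_eq_append_cons_update hps hl
      obtain ⟨_, ha, hmove⟩ := (h.mon p hp).move hγ hG hM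
      cases ha
      right; right
      generalize st p = s at hmove
      cases hmove with
      | take hb hs' => exact ⟨_, hb, .inl ⟨_, .inl (by rw [hs'])⟩⟩
      | pop hb hr => exact ⟨_, hb, .inr ⟨_, .inr rfl, .inl (by rw [hr]; rfl)⟩⟩
      | push hb hs' => exact ⟨_, hb, .inr ⟨_, .inr rfl, .inr (by rw [hs']; rfl)⟩⟩
      | deliver hb hr => exact ⟨_, hb, .inl ⟨_, .inr (by rw [hr])⟩⟩
    · obtain ⟨L', -, -, b, hb, h⟩ := PStep.of_queues hs₃
      exact .inr (.inr ⟨b, hb, .inr ⟨a, .inl rfl, h⟩⟩)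
    · left
      refine ⟨rfl, ?_⟩
      obtain ⟨p, hp, rfl, hl'⟩ := map_eq_append_cons_update hps hl
      obtain ⟨L', hL, rfl, d, hd, hport⟩ := PStep.of_queues hB
      obtain ⟨a', ha, hmove⟩ := (h.mon p hp).move hγ hG hM
      rw [PLab.prim.injEq] at ha
      rw [hl']
      generalize hst : st p = s at hmove
      cases hmove with
      | take =>
        cases a <;> simp only [Act.dual, reduceCtorEq, Act.inp.injEq] at ha
        obtain ⟨rfl, rfl⟩ := ha
        simp [Act.port, hγ.eq_iff] at hport
      | @pop b v M' hb hr hR hM' =>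
        cases a <;> simp only [Act.dual, reduceCtorEq, Act.inp.injEq] at ha
        obtain ⟨rfl, rfl⟩ := ha
        obtain ⟨b', hb', vs, hu, hc, hL'⟩ := hL.queues_out hD
        simp only [hγ.eq_iff, Key.label.injEq] at hu
        obtain rfl : b' = b := hR.eq_of_receiver hb hb' hu.2.symm (by rw [hr, hu.1])
        classical
        have hc₂ : ∀ d, d ≠ b' → Function.update c b' vs d = c d := fun d hd =>
          Function.update_of_ne hd _ _
        refine ⟨R, G, Qs, _, _, Function.update c b' vs, fun _ _ _ _ => .refl,
          h.pop hp hst hb hr hR hc (by simp) hc₂ hM', ?_⟩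
        rw [hL' _ (by simp) fun d _ => hc₂ d]
        rfl
      | @push b v M' hb hs hR hM' =>
        cases a <;> simp only [Act.dual, reduceCtorEq, Act.out.injEq] at ha
        obtain ⟨rfl, rfl⟩ := ha
        rw [hL.queues_inp]
        exact ⟨R, G, Qs, _, _, _, fun _ _ _ _ => .refl, h.push hγ hst hM', rfl⟩
      | deliver =>
        cases a <;> simp only [Act.dual, reduceCtorEq, Act.out.injEq] at ha
        obtain ⟨rfl, rfl⟩ := ha
        simp [Act.port, hγ.eq_iff] at hport
  · left
    refine ⟨rfl, ?_⟩
    obtain ⟨R₁, ⟨t, C⟩, R₂, rfl, h₁, h₂⟩ := forall₂_split_right h.plugged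
    rcases h₁.step hT hs₁ with ⟨h, -⟩ | ⟨a₀, C', ha₀, hC, h₃⟩
    · cases h
    rw [PLab.queue.injEq] at ha₀
    subst ha₀
    rcases hs₂.of_parList_prim (h.mon_prim hγ hG) box_queue with
      ⟨a, k₁, M, k₂, M', ha, hl, hM, rfl⟩ | ⟨a, P', h, -⟩ | ⟨a, k₁, M, k₂, M', P', h, -⟩
    · cases ha
      obtain ⟨p, hp, rfl, hl'⟩ := map_eq_append_cons_update hps hl
      obtain ⟨a', ha, hmove⟩ := (h.mon p hp).move hγ hG hM
      rw [PLab.prim.injEq] at ha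
      rw [hl']
      generalize hst : st p = s at hmove
      cases hmove with
      | @take b v G' M' hb hs hR hG' hM =>
        cases a₀ <;> simp only [Act.map, Act.dual, reduceCtorEq, Act.inp.injEq, hγ.eq_iff,
          Key.port.injEq] at ha
        obtain ⟨⟨rfl, rfl⟩, rfl⟩ := ha
        subst hs
        exact ⟨_, G', _, _, _, _, fun xs ys r F => .single (.outChor hC hb hG'),
          h.emit hG hb rfl hR hp hst hG' hM (h₂ _ _ h₃), rfl⟩
      | pop =>
        cases a₀ <;> simp [Act.map, Act.dual, hγ.eq_iff] at ha
      | push =>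
        cases a₀ <;> simp [Act.map, Act.dual, hγ.eq_iff] at ha
      | @deliver b v M' hb hr hR hM =>
        cases a₀ <;> simp only [Act.map, Act.dual, reduceCtorEq, Act.out.injEq, hγ.eq_iff,
          Key.port.injEq] at ha
        obtain ⟨⟨rfl, rfl⟩, rfl⟩ := ha
        subst hr
        have hq := h.queues b hb
        simp only [hst, Status.received, if_true, List.singleton_append] at hq
        obtain ⟨G', hG', hM'⟩ := hM _ hq
        exact ⟨_, G', _, _, _, _, fun xs ys r F => .single (.inpChor hC hb hG'),
          h.deliver hG hst hG' hM' (h₂ _ _ h₃), rfl⟩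
    · cases h
    · cases h

/-! ## Completion of layers -/

theorem Layer.flush_one (hT : Sim T) (hγ : Function.Injective γ) (hps : ps.Nodup)
    {xs ys : List Port} {r : Role} {F : List Fwd} (hC : RWF (.composite xs ys D r F R G))
    (h : Layer T γ dom D ps R G Qs m st c) {p : Role} (hp : p ∈ ps) (hst : st p ≠ .idle) :
    ∃ R' G' Qs' m' c', Steps (.composite xs ys D r F R G) (.composite xs ys D r F R' G') ∧
      Layer T γ dom D ps R' G' Qs' m' (Function.update st p .idle) c' ∧
      PStep (innerProc γ D Qs ps m c) .tau (innerProc γ D Qs' ps m' c') := by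
  cases hC with
  | composite _ _ hG _ _ hD _ hin =>
  obtain ⟨a, M', hM, hmove⟩ := (h.mon p hp).exists_step hγ hG hst
  obtain ⟨l₁, l₂, hl, hl'⟩ := exists_split_map_update hps m hp
  generalize hst' : st p = s at hmove
  cases hmove with
  | take => exact (hst hst').elim
  | pop => exact (hst hst').elim
  | @push b v M' hb hs hR hM' =>
    obtain ⟨L', hL⟩ := LStep.exists_inp (D.map fun b => queueWith γ b (c b)) (γ (.label p b.label)) v
    refine ⟨R, G, Qs, _, _, .refl, h.push hγ hst' hM', ?_⟩
    rw [innerProc, innerProc, hl, ← hl', ← hL.queues_inp]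
    exact .parList_last (.parList_sync_prim (a := .inp _ _) hM (.act hL ⟨b, hb, .inr (by rw [hs]; rfl)⟩))
  | @deliver b v M' hb hr hR hM' =>
    obtain ⟨C, hCR, hacc⟩ := hin b hb
    obtain ⟨R₁, R₂, rfl⟩ := List.append_of_mem hCR
    obtain ⟨k₁, Q, k₂, rfl, h₁, h₂⟩ := forall₂_split_left h.plugged
    obtain ⟨Q', hQ⟩ := h₁.accepts hT hγ hacc v
    rcases h₁.step hT hQ with ⟨h, -⟩ | ⟨a₀, C', ha₀, hC, h₃⟩
    · cases h
    have ha : a₀ = .inp b.rport v := by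
      cases a₀ <;> simp [Act.map, hγ.eq_iff] at ha₀
      rw [← ha₀.1, ← ha₀.2]
    subst ha hr
    have hq := h.queues b hb
    simp only [hst', Status.received, if_true, List.singleton_append] at hq
    obtain ⟨G', hG', hM''⟩ := hM' _ hq
    refine ⟨_, G', _, _, c, .single (.inpChor hC hb hG'),
      h.deliver hG hst' hG' hM'' (h₂ _ _ h₃), ?_⟩
    rw [innerProc, innerProc, hl, ← hl']
    exact .parList_sync_queue (a := .inp _ _) hQ (.parList_mem hM)

theorem Layer.flush (hT : Sim T) (hγ : Function.Injective γ) (hps : ps.Nodup)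
    {xs ys : List Port} {r : Role} {F : List Fwd} (hC : RWF (.composite xs ys D r F R G))
    (h : Layer T γ dom D ps R G Qs m st c) :
    ∃ R' G' Qs' m' c', Steps (.composite xs ys D r F R G) (.composite xs ys D r F R' G') ∧
      Layer T γ dom D ps R' G' Qs' m' (fun _ => .idle) c' ∧
      PSteps (innerProc γ D Qs ps m c) (innerProc γ D Qs' ps m' c') := by
  have key : ∀ l : List Role, (∀ p ∈ l, p ∈ ps) → ∀ R G Qs m st c,
      RWF (.composite xs ys D r F R G) → Layer T γ dom D ps R G Qs m st c →
      (∀ p, p ∉ l → st p = .idle) →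
      ∃ R' G' Qs' m' c', Steps (.composite xs ys D r F R G) (.composite xs ys D r F R' G') ∧
        Layer T γ dom D ps R' G' Qs' m' (fun _ => .idle) c' ∧
        PSteps (innerProc γ D Qs ps m c) (innerProc γ D Qs' ps m' c') := by
    intro l
    induction l with
    | nil =>
      intro _ R G Qs m st c hC h hst
      obtain rfl : st = fun _ => .idle := funext fun p => hst p (by simp)
      exact ⟨R, G, Qs, m, c, .refl, h, .refl⟩
    | cons p l ih =>
      intro hl R G Qs m st c hC h hst
      rw [List.forall_mem_cons] at hl
      by_cases hp : st p = .idle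
      · refine ih hl.2 R G Qs m st c hC h fun q hq => ?_
        by_cases hqp : q = p
        · rw [hqp, hp]
        · exact hst q (by simp [hqp, hq])
      · obtain ⟨R', G', Qs', m', c', h₁, h₂, h₃⟩ := h.flush_one hT hγ hps hC hl.1 hp
        obtain ⟨R'', G'', Qs'', m'', c'', h₄, h₅, h₆⟩ :=
          ih hl.2 R' G' Qs' m' _ c' (hC.steps h₁) h₂ fun q hq => by
            by_cases hqp : q = p
            · simp [hqp]
            · simpa [hqp] using hst q (by simp [hqp, hq])
        exact ⟨R'', G'', Qs'', m'', c'', h₁.trans h₄, h₅, .head h₃ h₆⟩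
  exact key ps (fun _ h => h) R G Qs m st c hC h h.idle

theorem forall₂_plugged_complete (hT : Sim T) (h : List.Forall₂ (Plugged T γ dom) R Qs) :
    ∃ R' Qs' Es, EncR γ dom R' Es ∧ List.Forall₂ SCong Qs' Es ∧
      (∀ xs ys D r F R₀ G, Steps (.composite xs ys D r F (R₀ ++ R) G)
        (.composite xs ys D r F (R₀ ++ R') G)) ∧
      ∀ P, PSteps (parList Qs P) (parList Qs' P) := by
  induction h with
  | nil => exact ⟨[], [], [], .nil, .nil, fun _ _ _ _ _ _ _ => .refl, fun _ => .refl⟩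
  | @cons t Q R Qs h _ ih =>
    obtain ⟨R', Qs', Es, h₁, h₂, h₃, h₄⟩ := ih
    obtain ⟨p, C⟩ := t
    obtain ⟨Q₀, hC, hdom, hfresh, rfl⟩ := h
    obtain ⟨C', Q₁, E, h₅, h₆, h₇, h₈⟩ := hT.complete hC
    refine ⟨(p, C') :: R', nus (C.ins ++ C.outs) (fwdList (plugFwds γ p C.ins C.outs) Q₁) :: Qs',
      _ :: Es, .cons h₈ ?_ ?_ h₁, .cons ?_ h₂, ?_, ?_⟩
    · simpa only [h₅.ins_eq, h₅.outs_eq] using hdom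
    · simpa only [h₅.ins_eq, h₅.outs_eq] using hfresh
    · simp only [fwds_eq, fwdList_append, h₅.ins_eq, h₅.outs_eq]
      exact .nus (.fwdList h₇)
    · intro xs ys D r F R₀ G
      refine (h₅.replace xs ys D r F R₀ R p G).trans ?_
      simpa [Steps] using h₃ xs ys D r F (R₀ ++ [(p, C')]) G
    · intro P
      refine .trans (b := parList (_ :: Qs) P) ?_ (PSteps.lift (f := Proc.par _) .parR (h₄ P))
      exact PSteps.lift (f := fun Q => parList (nus (C.ins ++ C.outs)
        (fwdList (plugFwds γ p C.ins C.outs) Q) :: Qs) P)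
        (fun h => .parL (.nus (h.fwdList_pass fun _ _ => ⟨trivial, trivial⟩)
          fun _ _ => trivial)) h₆

theorem EncG.eq_nil {s : Role} {P : Proc B} (h : EncG D γ s G P) (hs : s ∉ G.roles)
    (hc : ∀ i, ¬ G.Occurs i) : P = .nil := by
  induction h <;> simp_all [Proto.roles, Proto.Occurs]

theorem scong_monitors {S : Finset Role} {f : Role → Proc B} {P : Proc B}
    (hm : ∀ p ∈ ps, SCong (m p) (f p)) (hf : ∀ p ∈ ps, p ∉ S → f p = .nil) :
    SCong (parList (ps.map m) P) (parList ((ps.filter (· ∈ S)).map f) P) := by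
  induction ps with
  | nil => exact .refl
  | cons p ps ih =>
    rw [List.forall_mem_cons] at hm hf
    by_cases hp : p ∈ S
    · rw [List.filter_cons_of_pos (by simpa using hp)]
      exact .par hm.1 (ih hm.2 hf.2)
    · rw [List.filter_cons_of_neg (by simpa using hp)]
      have h := hm.1
      rw [hf.1 hp] at h
      exact .trans (.par h (ih hm.2 hf.2)) (.trans .par_comm .par_nil)

theorem Layer.scong_enc (hγ : Function.Injective γ) (hps : ps.Nodup) (hG : GOk D [] G)
    (h : Layer T γ dom D ps R G Qs m (fun _ => .idle) c) {Qs' Es : List (Proc B)}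
    (hE : List.Forall₂ SCong Qs' Es) :
    ∃ (ps' : List Role) (Ms : List (Proc B)) (L : List (LBinder B)), ps'.Nodup ∧
      (∀ p, p ∈ ps' ↔ p ∈ G.roles) ∧
      List.Forall₂ (fun p M => EncG D γ p G M) ps' Ms ∧ Fill γ G (D.map (queueOf γ)) L ∧
      SCong (innerProc γ D Qs' ps m c) (parList (Es ++ Ms) (.box (queuePorts γ D) L)) := by
  have : ∀ p, ∃ M, p ∈ ps → EncG D γ p G M ∧ Unf (m p) M := by
    intro p
    by_cases hp : p ∈ ps
    · obtain ⟨M, hM⟩ := h.mon p hp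
      exact ⟨M, fun _ => hM⟩
    · exact ⟨.nil, fun h => (hp h).elim⟩
  choose f hf using this
  refine ⟨ps.filter (· ∈ G.roles), (ps.filter (· ∈ G.roles)).map f,
    D.map fun b => queueWith γ b (c b), hps.filter _, fun p => ?_, ?_, ?_, ?_⟩
  · simp only [List.mem_filter, decide_eq_true_eq]
    exact ⟨And.right, fun hp => ⟨h.roles p hp, hp⟩⟩
  · rw [List.forall₂_map_right_iff, List.forall₂_same]
    exact fun p hp => (hf p (List.mem_of_mem_filter hp)).1
  · refine (fill_iff hγ hG (fun _ => []) _).2 (List.map_congr_left fun b hb => ?_)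
    rw [h.queues b hb]
    simp [Status.received, Status.sent]
  · rw [parList_append]
    refine .parList hE (scong_monitors (fun p hp => (hf p hp).2.scong) fun p hp hpG => ?_)
    exact (hf p hp).1.eq_nil hpG hG.closed

end Layer

/-! ## Runtime encodings -/

/-- The forwarders of a composite component. -/
def extFwds (γ : Key → Port) (r : Role) (F : List Fwd) : List (Dir × Port × Port) :=
  F.map fun φ => (φ.dir, φ.ext, γ (.port r φ.int))

/-- The processes to which the encodings of a component evolve, where `T` relates its subcomponents
to processes. -/
inductive PLayer (T : Comp B → Proc B → Prop) : Comp B → Proc B → Prop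
  | base {xs ys L P} (hC : RWF (.base xs ys L)) (hE : Enc (.base xs ys L) P) :
      PLayer T (.base xs ys L) P
  | composite {xs ys D r F R G γ zs ps m st c Qs} (hC : RWF (.composite xs ys D r F R G))
      (hγ : Function.Injective γ) (hnd : zs.Nodup) (hzs : {z | z ∈ zs} = γ '' compDom D r F)
      (hfresh : ∀ z ∈ zs, z ∉ xs ∧ z ∉ ys)
      (hFin : ∀ φ ∈ F, φ.dir = .inp → φ.ext ∈ xs) (hFout : ∀ φ ∈ F, φ.dir = .out → φ.ext ∈ ys)
      (hps : ps.Nodup) (h : Layer T γ (compDom D r F) D ps R G Qs m st c) :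
      PLayer T (.composite xs ys D r F R G)
        (nus zs (fwdList (extFwds γ r F) (innerProc γ D Qs ps m c)))

theorem Plugged.mono {T T' : Comp B → Proc B → Prop} (h : ∀ C P, T C P → T' C P) {γ : Key → Port}
    {dom : Set Key} {t : Role × Comp B} {Q : Proc B} (hQ : Plugged T γ dom t Q) :
    Plugged T' γ dom t Q := by
  obtain ⟨Q₀, h₁, h₂⟩ := hQ
  exact ⟨Q₀, h _ _ h₁, h₂⟩

theorem PLayer.mono {T T' : Comp B → Proc B → Prop} (h : ∀ C P, T C P → T' C P) {C : Comp B}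
    {P : Proc B} (hP : PLayer T C P) : PLayer T' C P := by
  cases hP with
  | base hC hE => exact .base hC hE
  | composite hC hγ hnd hzs hfresh hFin hFout hps hl =>
    exact .composite hC hγ hnd hzs hfresh hFin hFout hps
      { hl with plugged := hl.plugged.imp fun _ _ => .mono h }

section

variable {xs ys zs : List Port} {D : List Conn} {r : Role} {F : List Fwd} {γ : Key → Port}

theorem mem_extFwds {t : Dir × Port × Port} :
    t ∈ extFwds γ r F ↔ ∃ φ ∈ F, t = (φ.dir, φ.ext, γ (.port r φ.int)) := by
  simp [extFwds, eq_comm]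

theorem mem_of_dom {s : Set Key} (hzs : {z | z ∈ zs} = γ '' s) {k : Key} (hk : k ∈ s) :
    γ k ∈ zs := by
  have : γ k ∈ {z | z ∈ zs} := hzs ▸ Set.mem_image_of_mem γ hk
  exact this

theorem extFwds_ne (hzs : {z | z ∈ zs} = γ '' compDom D r F)
    (hfresh : ∀ z ∈ zs, z ∉ xs ∧ z ∉ ys)
    (hFin : ∀ φ ∈ F, φ.dir = .inp → φ.ext ∈ xs) (hFout : ∀ φ ∈ F, φ.dir = .out → φ.ext ∈ ys) :
    ∀ t ∈ extFwds γ r F, ∀ t' ∈ extFwds γ r F, t.2.1 ≠ t'.2.2 := by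
  intro t ht t' ht' h
  obtain ⟨φ, hφ, rfl⟩ := mem_extFwds.1 ht
  obtain ⟨ψ, hψ, rfl⟩ := mem_extFwds.1 ht'
  have := hfresh _ (mem_of_dom hzs (.inr ⟨ψ, hψ, rfl⟩))
  simp only at h
  rw [← h] at this
  cases hd : φ.dir with
  | inp => exact this.1 (hFin φ hφ hd)
  | out => exact this.2 (hFout φ hφ hd)

/-- The forwarders in the encoding of a base component. -/
def baseFwds (γ : Key → Port) (r : Role) (xs ys : List Port) : List (Dir × Port × Port) :=
  xs.map (fun x => (.inp, x, γ (.port r x))) ++ ys.map fun y => (.out, y, γ (.port r y))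

theorem mem_baseFwds {t : Dir × Port × Port} (h : t ∈ baseFwds γ r xs ys) :
    t.2.2 = γ (.port r t.2.1) ∧ (t.1 = .inp ∧ t.2.1 ∈ xs ∨ t.1 = .out ∧ t.2.1 ∈ ys) := by
  simp only [baseFwds, List.mem_append, List.mem_map] at h
  rcases h with ⟨x, hx, rfl⟩ | ⟨y, hy, rfl⟩ <;> simp_all

theorem base_fwds_eq {P : Proc B} : fwds .inp id (fun x => γ (.port r x)) xs
    (fwds .out id (fun y => γ (.port r y)) ys P) = fwdList (baseFwds γ r xs ys) P := by
  rw [fwds_eq, fwds_eq, fwdList_append]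
  rfl

theorem baseFwds_ne {L : List (LBinder B)} (hzs : {z | z ∈ zs} = γ '' baseDom r xs ys L)
    (hfresh : ∀ z ∈ zs, z ∉ xs ∧ z ∉ ys) :
    ∀ t ∈ baseFwds γ r xs ys, ∀ t' ∈ baseFwds γ r xs ys, t.2.1 ≠ t'.2.2 := by
  intro t ht t' ht' h
  obtain ⟨-, h₁⟩ := mem_baseFwds ht
  obtain ⟨h₂, h₃⟩ := mem_baseFwds ht'
  have := hfresh _ (mem_of_dom hzs (k := .port r t'.2.1) ⟨_, rfl,
    h₃.elim (fun h => .inl h.2) fun h => .inr (.inl h.2)⟩)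
  rw [← h₂, ← h] at this
  exact h₁.elim (fun h => this.1 h.2) fun h => this.2 h.2

end

theorem PLayer.step {T : Comp B → Proc B → Prop} (hT : Sim T) {C : Comp B} {P P' : Proc B}
    {lam : PLab B} (h : PLayer T C P) (hs : PStep P lam P') :
    (lam = .tau ∧ ∃ C', Steps C C' ∧ PLayer T C' P') ∨
      ∃ a C', lam = .queue a ∧ Step C (.act a) C' ∧ PLayer T C' P' := by
  cases h with
  | @base xs ys L _ hC hE =>
    cases hE with
    | @base _ _ _ γ r zs hγ hnd hzs hfresh =>
    have hg : Function.Injective fun x => γ (.port r x) := fun x y h => by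
      simpa [hγ.eq_iff] using h
    have hLok : ∀ b ∈ L, b.Ok := by cases hC; assumption
    rw [base_fwds_eq] at hs
    obtain ⟨P₁, hs₁, hz, rfl⟩ := hs.of_nus
    obtain ⟨lam', P₂, hs₂, hlam, rfl⟩ := hs₁.of_fwdList (baseFwds_ne hzs hfresh)
    have next : ∀ {a a' L'}, LStep L a' L' → Step (.base xs ys L) (.act a) (.base xs ys L') →
        PLayer T (.base xs ys L') (nus zs (fwdList (baseFwds γ r xs ys)
          (.box {z | z ∈ zs} (L'.map (LBinder.rename fun x => γ (.port r x)))))) := by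
      intro a a' L' hL hst
      rw [← base_fwds_eq]
      refine .base (hC.step hst) (.base γ r zs hγ hnd ?_ hfresh)
      simp only [hzs, baseDom, hL.mem_fp_iff hLok]
    right
    cases hs₂ with
    | act hL ha =>
    cases hlam with
    | pass => exact (hz _ ha rfl).elim
    | queueInp h =>
      obtain ⟨h₁, h₂⟩ := mem_baseFwds h
      simp only at h₁ h₂
      subst h₁
      obtain ⟨L', hL', rfl⟩ := hL.inp_of_rename hg
      have hst := Step.inpBase (ys := ys) hL' (by simpa using h₂)
      exact ⟨_, _, rfl, hst, next hL' hst⟩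
    | queueOut h =>
      obtain ⟨h₁, h₂⟩ := mem_baseFwds h
      simp only at h₁ h₂
      obtain ⟨y, L', hy, hL', rfl⟩ := hL.out_of_rename hg
      obtain rfl := hg (h₁.symm.trans hy)
      have hst := Step.outBase (xs := xs) hL' (by simpa using h₂)
      exact ⟨_, _, rfl, hst, next hL' hst⟩
  | @composite xs ys D r F R G γ zs ps m st c Qs hC hγ hnd hzs hfresh hFin hFout hps hl =>
    have hC' := hC
    cases hC' with
    | composite _ _ hG _ _ hD hdir _ =>
    obtain ⟨P₁, hs₁, hz, rfl⟩ := hs.of_nus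
    obtain ⟨lam', P₂, hs₂, hlam, rfl⟩ := hs₁.of_fwdList (extFwds_ne hzs hfresh hFin hFout)
    rcases hl.step hT hγ hps hD hG hs₂ with ⟨rfl, R', G', Qs', m', st', c', h₁, h₂, rfl⟩ |
      ⟨R₁, t, C, C', R₂, a, Qs', rfl, rfl, hst, h₂, rfl⟩ | ⟨b, hb, hint⟩
    · cases hlam with
      | pass =>
        exact .inl ⟨rfl, _, h₁ .., .composite (hC.steps (h₁ ..)) hγ hnd hzs hfresh hFin hFout hps h₂⟩
    · right
      obtain ⟨k₁, Q, k₂, -, ⟨Q₀, -, hdom, -, -⟩, -⟩ := forall₂_split_left hl.plugged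
      have hport := mem_of_dom hzs (hdom a.port (by simpa using hst.port_mem))
      have next : ∀ {a}, Step (.composite xs ys D r F (R₁ ++ (t, C) :: R₂) G) (.act a)
          (.composite xs ys D r F (R₁ ++ (t, C') :: R₂) G) → PLayer T _ _ := fun h =>
        .composite (hC.step h) hγ hnd hzs hfresh hFin hFout hps h₂
      generalize ha₁ : (a.map fun x => γ (.port t x)) = a₁ at hlam
      cases hlam with
      | pass =>
        subst ha₁
        refine (hz _ hport ?_).elim
        cases a <;> rfl
      | queueInp h =>
        obtain ⟨⟨d, x, w⟩, hφ, h⟩ := mem_extFwds.1 h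
        cases h
        cases a <;> simp only [Act.map, reduceCtorEq, Act.inp.injEq, hγ.eq_iff,
          Key.port.injEq] at ha₁
        obtain ⟨⟨rfl, rfl⟩, rfl⟩ := ha₁
        have hst' := Step.inpComp (r := t) (ys := ys) (D := D) (R₁ := R₁) (R₂ := R₂) (G := G) hst hφ
          (hFin _ hφ rfl)
        exact ⟨_, _, rfl, hst', next hst'⟩
      | queueOut h =>
        obtain ⟨⟨d, x, w⟩, hφ, h⟩ := mem_extFwds.1 h
        cases h
        cases a <;> simp only [Act.map, reduceCtorEq, Act.out.injEq, hγ.eq_iff,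
          Key.port.injEq] at ha₁
        obtain ⟨⟨rfl, rfl⟩, rfl⟩ := ha₁
        have hst' := Step.outComp (r := t) (xs := xs) (D := D) (R₁ := R₁) (R₂ := R₂) (G := G) hst hφ
          (hFout _ hφ rfl)
        exact ⟨_, _, rfl, hst', next hst'⟩
    · exfalso
      have hzb : ∀ k ∈ compDom D r F, γ k ∈ zs := fun k hk => mem_of_dom hzs hk
      have h₁ := hzb (.port b.sender b.sport) (.inl ⟨b, hb, by simp⟩)
      have h₂ := hzb (.port b.receiver b.rport) (.inl ⟨b, hb, by simp⟩)
      have h₃ := hzb (.label b.sender b.label) (.inl ⟨b, hb, by simp⟩)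
      have h₄ := hzb (.label b.receiver b.label) (.inl ⟨b, hb, by simp⟩)
      cases hlam with
      | pass =>
        rcases hint with ⟨v, rfl | rfl⟩ | ⟨a, rfl | rfl, ha | ha⟩
        · exact hz _ h₁ rfl
        · exact hz _ h₂ rfl
        · exact hz _ h₄ ha
        · exact hz _ h₃ ha
        · exact hz _ h₄ ha
        · exact hz _ h₃ ha
      | queueInp h | queueOut h =>
        obtain ⟨⟨d, x, w⟩, hφ, h⟩ := mem_extFwds.1 h
        cases h
        rcases hint with ⟨v, h | h⟩ | ⟨a, h | h, ha⟩ <;> cases h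
        simp [Act.port, hγ.eq_iff] at ha
      | primInp h =>
        obtain ⟨⟨d, x, w⟩, hφ, h⟩ := mem_extFwds.1 h
        cases h
        rcases hint with ⟨v, h | h⟩ | ⟨a, h | h, ha⟩
        · simp only [PLab.prim.injEq, Act.inp.injEq, hγ.eq_iff, Key.port.injEq] at h
          exact (hdir b hb _ hφ).1 rfl h.1.1.symm h.1.2.symm
        · cases h
        · cases h
        · cases h
          simp [Act.port, hγ.eq_iff] at ha
      | primOut h =>
        obtain ⟨⟨d, x, w⟩, hφ, h⟩ := mem_extFwds.1 h
        cases h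
        rcases hint with ⟨v, h | h⟩ | ⟨a, h | h, ha⟩
        · cases h
        · simp only [PLab.prim.injEq, Act.out.injEq, hγ.eq_iff, Key.port.injEq] at h
          exact (hdir b hb _ hφ).2 rfl h.1.1.symm h.1.2.symm
        · cases h
        · cases h
          simp [Act.port, hγ.eq_iff] at ha

theorem PLayer.accepts {T : Comp B → Proc B → Prop} (hT : Sim T) {C : Comp B} {P : Proc B}
    {x : Port} (h : PLayer T C P) (hx : Accepts C x) (v : Val B) :
    ∃ P', PStep P (.queue (.inp x v)) P' := by
  cases h with
  | @base xs ys L _ hC hE =>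
    cases hE with
    | @base _ _ _ γ r zs hγ hnd hzs hfresh =>
    cases hx with
    | base hx =>
    have hports : (xs ++ ys).Nodup := hC.ports_nodup
    rw [base_fwds_eq]
    obtain ⟨L', hL⟩ := LStep.exists_inp (L.map (LBinder.rename fun x => γ (.port r x)))
      (γ (.port r x)) v
    refine ⟨_, .nus (.fwdList_inp (.act hL ?_) ?_ ?_ ?_ (baseFwds_ne hzs hfresh)) ?_⟩
    · exact mem_of_dom hzs ⟨x, rfl, .inl hx⟩
    · exact List.mem_append_left _ (List.mem_map.2 ⟨x, hx, rfl⟩)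
    · simpa [baseFwds, Function.comp_def] using hports
    · have : (baseFwds γ r xs ys).map (fun t => t.2.2) =
          (xs ++ ys).map fun x => γ (.port r x) := by
        simp [baseFwds, Function.comp_def]
      rw [this]
      exact hports.map fun a b h => by simpa [hγ.eq_iff] using h
    · rintro z hz rfl
      exact (hfresh _ hz).1 hx
  | @composite xs ys D r F R G γ zs ps m st c Qs hC hγ hnd hzs hfresh hFin hFout hps hl =>
    cases hx with
    | @composite _ _ _ _ _ _ _ _ z C hx hF hCR hacc =>
    cases hC with
    | composite _ _ _ hext hint =>
    obtain ⟨R₁, R₂, rfl⟩ := List.append_of_mem hCR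
    obtain ⟨k₁, Q, k₂, rfl, hQ, -⟩ := forall₂_split_left hl.plugged
    obtain ⟨Q', hs⟩ := hQ.accepts hT hγ hacc v
    refine ⟨_, .nus (.fwdList_inp (.parList_mem hs) (mem_extFwds.2 ⟨_, hF, rfl⟩) ?_ ?_
      (extFwds_ne hzs hfresh hFin hFout)) ?_⟩
    · simpa [extFwds, Function.comp_def] using hext
    · have : (extFwds γ r F).map (fun t => t.2.2) = (F.map Fwd.int).map fun x => γ (.port r x) := by
        simp [extFwds, Function.comp_def]
      rw [this]
      exact hint.map fun a b h => by simpa [hγ.eq_iff] using h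
    · rintro z hz rfl
      exact (hfresh _ hz).1 hx

theorem PLayer.complete {T : Comp B → Proc B → Prop} (hT : Sim T) {C : Comp B} {P : Proc B}
    (h : PLayer T C P) : ∃ C' P' E, Steps C C' ∧ PSteps P P' ∧ SCong P' E ∧ Enc C' E := by
  cases h with
  | base hC hE => exact ⟨_, _, _, .refl, .refl, .refl, hE⟩
  | @composite xs ys D r F R G γ zs ps m st c Qs hC hγ hnd hzs hfresh hFin hFout hps hl =>
    obtain ⟨R', G', Qs', m', c', h₁, h₂, h₃⟩ := hl.flush hT hγ hps hC
    have hG' : GOk D [] G' := by cases hC.steps h₁; assumption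
    obtain ⟨R'', Qs'', Es, h₄, h₅, h₆, h₇⟩ := forall₂_plugged_complete hT h₂.plugged
    obtain ⟨ps', Ms, L, h₈, h₉, h₁₀, h₁₁, h₁₂⟩ := h₂.scong_enc hγ hps hG' h₅
    have hfwd : ∀ {P P' : Proc B}, PSteps P P' → PSteps (nus zs (fwdList (extFwds γ r F) P))
        (nus zs (fwdList (extFwds γ r F) P')) :=
      PSteps.lift (f := fun P => nus zs (fwdList (extFwds γ r F) P)) fun h =>
        .nus (h.fwdList_pass fun _ _ => ⟨trivial, trivial⟩) fun _ _ => trivial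
    refine ⟨_, _, _, h₁.trans (h₆ xs ys D r F [] G'), hfwd (h₃.trans (h₇ _)),
      .nus (.fwdList h₁₂), ?_⟩
    have := Enc.composite γ zs ps' Es Ms L hγ hnd hzs hfresh hFin hFout h₈ h₉ h₄ h₁₀ h₁₁
    simpa only [fwdList, extFwds, List.foldr_map, parList, List.nil_append] using this

theorem PLayer.sim {T : Comp B → Proc B → Prop} (hT : Sim T) : Sim (PLayer T) where
  rwf h := by cases h <;> assumption
  step h hs := h.step hT hs
  accepts h hx v := h.accepts hT hx v
  complete h := h.complete hT

/-- Runtime encodings of components of a bounded nesting depth. -/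
def PEnc : ℕ → Comp B → Proc B → Prop
  | 0 => fun _ _ => False
  | n + 1 => PLayer (PEnc n)

theorem PEnc.sim (n : ℕ) : Sim (PEnc (B := B) n) := by
  induction n with
  | zero => exact ⟨False.elim, False.elim, False.elim, False.elim⟩
  | succ n ih => exact PLayer.sim ih

theorem PEnc.mono {n k : ℕ} (hnk : n ≤ k) {C : Comp B} {P : Proc B} (h : PEnc n C P) :
    PEnc k C P := by
  induction n generalizing k C P with
  | zero => exact h.elim
  | succ n ih =>
    obtain ⟨k, rfl⟩ := Nat.exists_eq_add_of_le' (Nat.one_le_of_lt hnk)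
    exact PLayer.mono (fun C P h => ih (by omega) h) h

theorem exists_map_of_forall₂ {α β : Type*} [DecidableEq α] [Nonempty β] {r : α → β → Prop}
    {l : List α} {l' : List β} (hl : l.Nodup) (h : List.Forall₂ r l l') :
    ∃ f : α → β, l' = l.map f ∧ ∀ a ∈ l, r a (f a) := by
  induction h with
  | nil => exact ⟨fun _ => Classical.arbitrary β, rfl, by simp⟩
  | @cons a b l l' hab _ ih =>
    rw [List.nodup_cons] at hl
    obtain ⟨f, rfl, hf⟩ := ih hl.2
    have hne : ∀ x ∈ l, Function.update f a b x = f x := fun x hx =>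
      Function.update_of_ne (fun h : x = a => hl.1 (h ▸ hx)) _ _
    refine ⟨Function.update f a b, ?_, ?_⟩
    · rw [List.map_cons, Function.update_self, List.map_congr_left hne]
    · rw [List.forall_mem_cons, Function.update_self]
      exact ⟨hab, fun x hx => by rw [hne x hx]; exact hf x hx⟩

mutual

theorem Enc.exists_pEnc {C : Comp B} {E : Proc B} (h : Enc C E) (hC : RWF C) :
    ∃ n, PEnc n C E := by
  match h with
  | .base γ r zs hγ hnd hzs hfresh => exact ⟨1, .base hC (.base γ r zs hγ hnd hzs hfresh)⟩
  | .composite (xs := xs) (ys := ys) (D := D) (r := r) (F := F) (R := R) (G := G) γ zs ps Qs Ms L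
      hγ hnd hzs hfresh hFin hFout hps hroles hQs hMs hL =>
    obtain ⟨hsub, hG⟩ : (∀ s C, (s, C) ∈ R → RWF C) ∧ GOk D [] G := by
      cases hC
      exact ⟨by assumption, by assumption⟩
    obtain ⟨n, hR⟩ := hQs.exists_plugged hsub
    have : Nonempty (Proc B) := ⟨.nil⟩
    obtain ⟨m, rfl, hm⟩ := exists_map_of_forall₂ hps hMs
    obtain rfl := (fill_iff hγ hG (fun _ => []) L).1 hL
    refine ⟨n + 1, ?_⟩
    have : PLayer (PEnc n) _ _ := .composite (m := m) (c := fun b => fillv b.receiver b.label G)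
      (st := fun _ => .idle) hC hγ hnd hzs hfresh hFin hFout hps
      { plugged := hR
        roles := fun p hp => (hroles p).2 hp
        idle := fun _ _ => rfl
        mon := fun p hp => ⟨m p, hm p hp, .refl⟩
        queues := fun b _ => by simp [Status.received, Status.sent] }
    simpa only [PEnc, fwdList, extFwds, List.foldr_map, innerProc, parList, List.foldr_append,
      List.nil_append] using this

theorem EncR.exists_plugged {γ : Key → Port} {dom : Set Key} {R : List (Role × Comp B)}
    {Qs : List (Proc B)} (h : EncR γ dom R Qs) (hR : ∀ s C, (s, C) ∈ R → RWF C) :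
    ∃ n, List.Forall₂ (Plugged (PEnc n) γ dom) R Qs := by
  match h with
  | .nil => exact ⟨0, .nil⟩
  | .cons h hdom hfresh h' =>
    obtain ⟨n, hn⟩ := h.exists_pEnc (hR _ _ List.mem_cons_self)
    obtain ⟨k, hk⟩ := h'.exists_plugged fun s C hs => hR s C (List.mem_cons_of_mem _ hs)
    refine ⟨max n k, .cons ⟨_, PEnc.mono (le_max_left n k) hn, hdom, hfresh, ?_⟩
      (hk.imp fun _ _ => .mono fun _ _ => PEnc.mono (le_max_right n k))⟩
    rw [fwds_eq, fwds_eq, fwdList_append]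
    rfl

end

theorem Sim.steps {T : Comp B → Proc B → Prop} (hT : Sim T) {C : Comp B} {E P : Proc B}
    (h : T C E) (hP : PSteps E P) : ∃ C', Steps C C' ∧ T C' P := by
  induction hP with
  | refl => exact ⟨C, .refl, h⟩
  | tail _ hs ih =>
    obtain ⟨C₁, h₁, h₂⟩ := ih
    rcases hT.step h₂ hs with ⟨-, C₂, h₃, h₄⟩ | ⟨a, C₂, h, -⟩
    · exact ⟨C₂, h₁.trans h₃, h₄⟩
    · cases h

end GC

theorem mainTheorem4 {B : Type*} (C : GC.Comp B) (hC : GC.IsConfiguration C)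
    (E P : GC.Proc B) (hE : GC.Enc C E) (hP : GC.PSteps E P) :
    ∃ C' : GC.Comp B, GC.Steps C C' ∧
      ∃ P' E' : GC.Proc B, GC.PSteps P P' ∧ GC.SCong P' E' ∧ GC.Enc C' E' := by
  obtain ⟨n, hn⟩ := hE.exists_pEnc hC.rwf
  obtain ⟨C₁, h₁, h₂⟩ := (GC.PEnc.sim n).steps hn hP
  obtain ⟨C₂, P', E', h₃, h₄, h₅, h₆⟩ := (GC.PEnc.sim n).complete h₂
  exact ⟨C₂, h₁.trans h₃, P', E', h₄, h₅, h₆⟩
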